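/- **Theorem 3.1.** Let $A\in\mathbb C^{n_A\times n_A}$ and $B\in\mathbb C^{n_B\times n_B}$ with $n_A,n_B\ge 1$, and let $W(A)=\{v^*Av: v\in\mathbb C^{n_A},\ \|v\|_2=1\}$, and likewise $W(B)$, denote the numerical ranges. Let $\Omega_A,\Omega_B\subset\mathbb C$ be smooth, bounded, convex domains with $W(A)\subset\Omega_A$ and $W(B)\subset\Omega_B$; here smooth means that the boundary is a simple closed curve with a continuously differentiable parametrization with nowhere vanishing derivative. Let $F$ be an $m\times p$ complex matrix-valued function that is analytic on $\Omega_A\times\Omega_B$ and continuous on $\overline{\Omega}_A\times\overline{\Omega}_B$. Define $$F\{A,B\}:=-\frac1{4\pi^2}\oint_{\partial\Omega_A}\oint_{\partial\Omega_B}F(x,y)\otimes(yI-B)^{-1}\otimes(xI-A)^{-1}\,\mathrm dy\,\mathrm dx,$$ where $\otimes$ is the Kronecker product and both boundaries are traversed once in the positive (counterclockwise) direction. Then, with $\|\cdot\|_2$ the spectral norm, $$\|F\{A,B\}\|_2\le(1+\sqrt2)^2\max_{(x,y)\in W(A)\times W(B)}\|F(x,y)\|_2,$$ and the maximum on the right-hand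 side is attained. -/

import Mathlib

open Set
open scoped Kronecker Matrix Matrix.Norms.L2Operator

noncomputable section

/-- The numerical range `W(A) = {v* A v : ‖v‖₂ = 1}` of a square complex matrix. -/
def numericalRange {n : Type*} [Fintype n] (A : Matrix n n ℂ) : Set ℂ :=
  {z | ∃ v : EuclideanSpace ℂ n, ‖v‖ = 1 ∧ z = star v.ofLp ⬝ᵥ (A *ᵥ v.ofLp)}

/-- The contour integral `∮ f(z) dz` along a closed curve given by a `2π`-periodic
parametrization `γ`. -/
def contourIntegral {E : Type*} [NormedAddCommGroup E] [NormedSpace ℂ E]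
    (γ : ℝ → ℂ) (f : ℂ → E) : E :=
  ∫ t in (0 : ℝ)..(2 * Real.pi), deriv γ t • f (γ t)

/-- `Ω` is a smooth bounded convex domain in the plane and `γ` is a regular, positively
(counterclockwise) oriented parametrization of its boundary. For smoothness of the boundary it is
enough here that `γ` is continuously differentiable with nowhere vanishing derivative. The
orientation is expressed as usual by the winding number `1` around every point of `Ω`. -/
structure IsSmoothConvexDomain (Ω : Set ℂ) (γ : ℝ → ℂ) : Prop where
  isOpen : IsOpen Ω
  nonempty : Ω.Nonempty
  isBounded : Bornology.IsBounded Ω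
  convex : Convex ℝ Ω
  contDiff : ContDiff ℝ 1 γ
  deriv_ne_zero : ∀ t, deriv γ t ≠ 0
  periodic : Function.Periodic γ (2 * Real.pi)
  injOn : InjOn γ (Ico 0 (2 * Real.pi))
  image_eq : γ '' Ico 0 (2 * Real.pi) = frontier Ω
  winding : ∀ w ∈ Ω, contourIntegral γ (fun z => (z - w)⁻¹) = 2 * Real.pi * Complex.I

/-- The bivariate matrix function
`F{A,B} = -1/(4π²) ∮ ∮ F(x,y) ⊗ (yI - B)⁻¹ ⊗ (xI - A)⁻¹ dy dx`,
where `x` runs through the curve `γA` and `y` through the curve `γB`. -/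
def bivariateMatrixFunction {m p a b : Type*} [Fintype m] [Fintype p] [Fintype a] [Fintype b]
    [DecidableEq m] [DecidableEq p] [DecidableEq a] [DecidableEq b]
    (γA γB : ℝ → ℂ) (F : ℂ × ℂ → Matrix m p ℂ) (A : Matrix a a ℂ) (B : Matrix b b ℂ) :
    Matrix ((m × b) × a) ((p × b) × a) ℂ :=
  (-1 / (4 * (Real.pi : ℂ) ^ 2)) •
    contourIntegral γA fun x => contourIntegral γB fun y =>
      F (x, y) ⊗ₖ (y • (1 : Matrix b b ℂ) - B)⁻¹ ⊗ₖ (x • (1 : Matrix a a ℂ) - A)⁻¹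

end

/-! Since `-1/(4π²) = (2πi)⁻²`, the double integral is an iterated one-variable functional calculus.
Put `G(x) = (2πi)⁻¹ ∮ F(x,y) ⊗ (y - B)⁻¹ dy`; then `F{A,B} = (2πi)⁻¹ ∮ G(x) ⊗ (x - A)⁻¹ dx`
(`bivariateMatrixFunction_eq`). The Crouzeix–Palencia theorem for matrix-valued functions, with a
constant `1 + √2` that does not depend on the size of the values, bounds `‖G(x)‖` for `x ∈ W(A)` by
`(1 + √2) max ‖F(x,·)‖` over `W(B)`. Applied again to `G` and `A`, it yields the square of the
constant.

For one variable, let `X = F(A)` with `‖F‖ ≤ 1` on a convex domain `Ω ⊇ W(A)`. Let `g` be the Cauchy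
transform of the boundary values of `F*`, and `Y = g(A)`. Two facts carry the argument. The
operator-valued double layer kernel is positive with integral `2`, so `‖X + Y*‖ ≤ 2`
(`norm_resolventIntegral_add_le`). The scalar double layer kernel gives `‖g‖ ≤ 1` on `Ω`, up to an
arbitrarily small error near the boundary (`eventually_norm_conjCauchy_le`). With `K` the supremum
of `‖F(A)‖` over all such `F`, the identity `X X* X = X (X + Y*)* X - X Y X`, in which `X Y X` is a
limit of values of `F g F` at `A`, gives `K³ ≤ 2K² + K`, hence `K ≤ 1 + √2`.

The positivity and angle estimates are proved for domains with a `C²` support function of positive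
radius of curvature. To reach the maximum over `W(A)`, such a domain is squeezed between `W(A)`
(convex by Toeplitz–Hausdorff) and a small neighbourhood, by averaging the support function of
`W(A)` (`exists_supportDomain`). Changing the contour is harmless because `F(A)` is characterised
algebraically by `HasMatrixValue`, through Newton interpolation at the eigenvalues and
Cayley–Hamilton. -/

noncomputable section

open Filter Topology MeasureTheory

/-! ### Integrals depending on a parameter. -/

section ParametricIntegrals

variable {X E : Type*} [TopologicalSpace X] [NormedAddCommGroup E] [NormedSpace ℝ E]

theorem continuousOn_intervalIntegral_of_continuousOn {K : Set X} {Φ : X → ℝ → E}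
    (h : ContinuousOn (fun q : X × ℝ => Φ q.1 q.2) (K ×ˢ univ)) (a b : ℝ) :
    ContinuousOn (fun x => ∫ t in a..b, Φ x t) K := by
  rw [continuousOn_iff_continuous_domRestrict]
  refine intervalIntegral.continuous_parametric_intervalIntegral_of_continuous'
    (f := fun (x : K) t => Φ x t) ?_ a b
  exact h.comp_continuous (f := fun q : K × ℝ => ((q.1 : X), q.2)) (by fun_prop) (fun q => by simp)

theorem ContinuousOn.continuous_right {K : Set X} {Φ : X → ℝ → E}
    (h : ContinuousOn (fun q : X × ℝ => Φ q.1 q.2) (K ×ˢ univ)) {x : X} (hx : x ∈ K) :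
    Continuous (Φ x) :=
  h.comp_continuous (f := fun t => (x, t)) (by fun_prop) (fun t => by simp [hx])

/-- An integral of functions which depend holomorphically on a parameter is holomorphic. -/
theorem differentiableOn_intervalIntegral {E : Type*} [NormedAddCommGroup E] [NormedSpace ℂ E]
    [CompleteSpace E] {U : Set ℂ} (hU : IsOpen U) {Φ : ℂ → ℝ → E}
    (hc : ContinuousOn (fun q : ℂ × ℝ => Φ q.1 q.2) (U ×ˢ univ))
    (hd : ∀ t, DifferentiableOn ℂ (fun x => Φ x t) U) (a b : ℝ) :
    DifferentiableOn ℂ (fun x => ∫ t in a..b, Φ x t) U := by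
  intro x₀ hx₀
  obtain ⟨R, hR, hRU⟩ := Metric.isOpen_iff.1 hU x₀ hx₀
  have hR2 : Metric.closedBall x₀ (R / 2) ⊆ U :=
    (Metric.closedBall_subset_ball (by linarith)).trans hRU
  have hcomp : IsCompact (Metric.closedBall x₀ (R / 2) ×ˢ uIcc a b) :=
    (isCompact_closedBall _ _).prod isCompact_uIcc
  obtain ⟨C, hC⟩ := hcomp.exists_bound_of_continuousOn
    (hc.mono (prod_mono hR2 (subset_univ _)))
  have hball : ∀ x ∈ Metric.ball x₀ (R / 4), Metric.closedBall x (R / 4) ⊆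
      Metric.closedBall x₀ (R / 2) := fun x hx => by
    apply Metric.closedBall_subset_closedBall'
    have := Metric.mem_ball.1 hx
    linarith
  have hder : ∀ t, ∀ x ∈ U, HasDerivAt (fun x => Φ x t) (deriv (fun x => Φ x t) x) x :=
    fun t x hx => ((hd t).differentiableAt (hU.mem_nhds hx)).hasDerivAt
  have key := intervalIntegral.hasDerivAt_integral_of_dominated_loc_of_deriv_le
    (μ := volume) (a := a) (b := b) (bound := fun _ => C / (R / 4)) (F := Φ)
    (F' := fun x t => deriv (fun x => Φ x t) x) (x₀ := x₀)
    (Metric.ball_mem_nhds x₀ (by positivity : 0 < R / 4)) ?_ ?_ ?_ ?_ ?_ ?_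
  · exact key.2.differentiableAt.differentiableWithinAt
  · filter_upwards [hU.mem_nhds hx₀] with x hx
    exact (hc.continuous_right hx).aestronglyMeasurable
  · exact (hc.continuous_right hx₀).intervalIntegrable _ _
  -- Measurability of the derivative in `t`: it is the pointwise limit of difference quotients with
  -- steps `δ / 2 / (n + 1)`, each continuous in `t`.
  · obtain ⟨δ, hδ, hδU⟩ := Metric.isOpen_iff.1 hU x₀ hx₀
    have hpos : ∀ n : ℕ, (0 : ℝ) < (δ / 2) / (n + 1) := fun n => by positivity
    refine aestronglyMeasurable_of_tendsto_ae atTop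
      (f := fun (n : ℕ) t => (((δ / 2 / (n + 1) : ℝ) : ℂ))⁻¹ •
        (Φ (x₀ + ((δ / 2 / (n + 1) : ℝ) : ℂ)) t - Φ x₀ t)) (fun n => ?_) (ae_of_all _ fun t => ?_)
    · have hmem : x₀ + ((δ / 2 / (n + 1) : ℝ) : ℂ) ∈ U := by
        apply hδU
        rw [Metric.mem_ball, dist_eq_norm, add_sub_cancel_left, Complex.norm_real,
          Real.norm_of_nonneg (hpos n).le]
        have : δ / 2 / (n + 1) ≤ δ / 2 := div_le_self (by positivity) (by linarith [n.cast_nonneg (α := ℝ)])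
        linarith
      exact (((hc.continuous_right hmem).sub (hc.continuous_right hx₀)).const_smul
        _).aestronglyMeasurable
    · have h1 := (hasDerivAt_iff_tendsto_slope_zero.1 (hder t x₀ hx₀))
      refine h1.comp ?_
      refine tendsto_nhdsWithin_iff.2 ⟨?_, Eventually.of_forall fun n => ?_⟩
      · have h2 : Tendsto (fun n : ℕ => δ / 2 / ((n : ℝ) + 1)) atTop (𝓝 0) := by
          have := (tendsto_one_div_add_atTop_nhds_zero_nat (𝕜 := ℝ)).const_mul (δ / 2)
          simpa only [mul_one_div, mul_zero] using this
        have := (Complex.continuous_ofReal.tendsto 0).comp h2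
        simpa [Function.comp_def] using this
      · simp only [mem_compl_iff, mem_singleton_iff, Complex.ofReal_eq_zero]
        exact (hpos n).ne'
  · refine ae_of_all _ fun t ht x hx => ?_
    -- Cauchy's estimate on circles of radius `R / 4` supplies the dominating constant, since these
    -- circles stay in the compact ball on which `C` bounds `Φ`.
    refine Complex.norm_deriv_le_of_forall_mem_sphere_norm_le (by positivity) ?_ ?_
    · exact ((hd t).mono ((hball x hx).trans hR2)).diffContOnCl_ball subset_rfl
    · intro z hz
      exact hC (z, t) ⟨hball x hx (Metric.sphere_subset_closedBall hz), uIoc_subset_uIcc ht⟩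
  · exact intervalIntegrable_const
  · refine ae_of_all _ fun t _ x hx => hder t x ?_
    exact hR2 (hball x hx (Metric.mem_closedBall_self (by positivity)))

end ParametricIntegrals

/-- A closed `C¹` curve on the boundary of a bounded convex domain with winding number one. -/
structure IsConvexContour (Ω : Set ℂ) (γ : ℝ → ℂ) : Prop where
  isOpen : IsOpen Ω
  isBounded : Bornology.IsBounded Ω
  convex : Convex ℝ Ω
  contDiff : ContDiff ℝ 1 γ
  closed : γ (2 * Real.pi) = γ 0
  mem_frontier : ∀ t, γ t ∈ frontier Ω
  winding : ∀ w ∈ Ω, contourIntegral γ (fun z => (z - w)⁻¹) = 2 * Real.pi * Complex.I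

/-- The Cauchy theory below needs neither injectivity nor regularity of the curve. The weaker
structure serves both the given domains and the auxiliary support domains. -/
theorem IsSmoothConvexDomain.isConvexContour {Ω : Set ℂ} {γ : ℝ → ℂ}
    (h : IsSmoothConvexDomain Ω γ) : IsConvexContour Ω γ where
  isOpen := h.isOpen
  isBounded := h.isBounded
  convex := h.convex
  contDiff := h.contDiff
  closed := by simpa using h.periodic 0
  mem_frontier t := by
    obtain ⟨s, hs, hst⟩ := h.periodic.exists_mem_Ico₀ Real.two_pi_pos t
    rw [hst, ← h.image_eq]
    exact mem_image_of_mem _ hs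
  winding := h.winding

/-! ### Contour integrals, followed by Cauchy's theorem and formula on convex domains. -/

section ContourIntegral

variable {E F : Type*} [NormedAddCommGroup E] [NormedSpace ℂ E] [NormedAddCommGroup F]
  [NormedSpace ℂ F] {γ : ℝ → ℂ} {f g : ℂ → E}

theorem intervalIntegrable_contour (hγ : ContDiff ℝ 1 γ) (hf : Continuous fun t => f (γ t))
    (a b : ℝ) : IntervalIntegrable (fun t => deriv γ t • f (γ t)) volume a b :=
  ((hγ.continuous_deriv le_rfl).smul hf).intervalIntegrable _ _

theorem contourIntegral_add (hγ : ContDiff ℝ 1 γ) (hf : Continuous fun t => f (γ t))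
    (hg : Continuous fun t => g (γ t)) :
    contourIntegral γ (fun z => f z + g z) = contourIntegral γ f + contourIntegral γ g := by
  simp only [contourIntegral, smul_add]
  exact intervalIntegral.integral_add (intervalIntegrable_contour hγ hf _ _)
    (intervalIntegrable_contour hγ hg _ _)

theorem contourIntegral_sub (hγ : ContDiff ℝ 1 γ) (hf : Continuous fun t => f (γ t))
    (hg : Continuous fun t => g (γ t)) :
    contourIntegral γ (fun z => f z - g z) = contourIntegral γ f - contourIntegral γ g := by
  simp only [contourIntegral, smul_sub]
  exact intervalIntegral.integral_sub (intervalIntegrable_contour hγ hf _ _)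
    (intervalIntegrable_contour hγ hg _ _)

theorem contourIntegral_smul (c : ℂ) :
    contourIntegral γ (fun z => c • f z) = c • contourIntegral γ f := by
  simp only [contourIntegral, smul_comm _ c]
  exact intervalIntegral.integral_smul _ _

theorem ContinuousLinearMap.contourIntegral_comp [CompleteSpace E] [CompleteSpace F]
    (L : E →L[ℂ] F)
    (hγ : ContDiff ℝ 1 γ) (hf : Continuous fun t => f (γ t)) :
    contourIntegral γ (fun z => L (f z)) = L (contourIntegral γ f) := by
  simp only [contourIntegral, ← L.map_smul]
  exact L.intervalIntegral_comp_comm (intervalIntegrable_contour hγ hf _ _)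

theorem contourIntegral_congr (h : ∀ t, f (γ t) = g (γ t)) :
    contourIntegral γ f = contourIntegral γ g := by
  simp only [contourIntegral, h]

theorem norm_contourIntegral_le {L C : ℝ} (hL : ∀ t ∈ Icc 0 (2 * Real.pi), ‖deriv γ t‖ ≤ L)
    (hC : ∀ t ∈ Icc 0 (2 * Real.pi), ‖f (γ t)‖ ≤ C) :
    ‖contourIntegral γ f‖ ≤ L * C * (2 * Real.pi) := by
  have h := intervalIntegral.norm_integral_le_of_norm_le_const (a := 0) (b := 2 * Real.pi)
    (f := fun t => deriv γ t • f (γ t)) (C := L * C) (fun t ht => by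
      rw [uIoc_of_le Real.two_pi_pos.le] at ht
      have ht' := Ioc_subset_Icc_self ht
      rw [norm_smul]
      exact mul_le_mul (hL t ht') (hC t ht') (norm_nonneg _) ((norm_nonneg _).trans (hL t ht')))
  rwa [sub_zero, abs_of_pos Real.two_pi_pos] at h

theorem contourIntegral_eq_zero_of_hasDerivAt [CompleteSpace E] (hγ : ContDiff ℝ 1 γ)
    (hcl : γ (2 * Real.pi) = γ 0)
    (hg : ∀ t, HasDerivAt g (f (γ t)) (γ t)) (hf : Continuous fun t => f (γ t)) :
    contourIntegral γ f = 0 := by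
  have h : ∀ t, HasDerivAt (fun t => g (γ t)) (deriv γ t • f (γ t)) t := fun t =>
    (hg t).scomp t (hγ.differentiable one_ne_zero t).hasDerivAt
  rw [contourIntegral, intervalIntegral.integral_eq_sub_of_hasDerivAt (fun t _ => h t)
    (intervalIntegrable_contour hγ hf _ _), hcl, sub_self]

end ContourIntegral

/-- The homothety with center `c` and ratio `r`. -/
def dilate (c : ℂ) (r : ℝ) (z : ℂ) : ℂ := c + r * (z - c)

theorem continuous_dilate (c : ℂ) : Continuous fun q : ℝ × ℂ => dilate c q.1 q.2 := by
  unfold dilate; fun_prop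

@[simp] theorem dilate_one (c z : ℂ) : dilate c 1 z = z := by simp [dilate]

theorem differentiable_dilate (c : ℂ) (r : ℝ) : Differentiable ℂ (dilate c r) := by
  unfold dilate; fun_prop

theorem dilate_mem {Ω : Set ℂ} (ho : IsOpen Ω) (hc : Convex ℝ Ω) {c z : ℂ} {r : ℝ}
    (hcΩ : c ∈ Ω) (hz : z ∈ closure Ω) (h0 : 0 ≤ r) (h1 : r < 1) : dilate c r z ∈ Ω := by
  have := hc.combo_interior_closure_mem_interior (x := c) (y := z) (by rwa [ho.interior_eq]) hz
    (sub_pos.2 h1) h0 (by ring)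
  rw [ho.interior_eq] at this
  convert this using 1
  simp only [dilate, Complex.real_smul]
  push_cast
  ring

namespace IsConvexContour

variable {E : Type*} [NormedAddCommGroup E] [NormedSpace ℂ E] {Ω : Set ℂ} {γ : ℝ → ℂ} {f : ℂ → E}

theorem mem_closure (h : IsConvexContour Ω γ) (t : ℝ) : γ t ∈ closure Ω :=
  frontier_subset_closure (h.mem_frontier t)

theorem notMem (h : IsConvexContour Ω γ) (t : ℝ) : γ t ∉ Ω := fun ht => by
  have := h.mem_frontier t
  rw [frontier, h.isOpen.interior_eq] at this
  exact this.2 ht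

theorem sub_ne_zero (h : IsConvexContour Ω γ) (t : ℝ) {w : ℂ} (hw : w ∈ Ω) : γ t - w ≠ 0 :=
  _root_.sub_ne_zero.2 fun e => h.notMem t (e ▸ hw)

theorem continuous (h : IsConvexContour Ω γ) : Continuous γ := h.contDiff.continuous

theorem continuous_deriv (h : IsConvexContour Ω γ) : Continuous (deriv γ) :=
  h.contDiff.continuous_deriv le_rfl

theorem continuous_comp (h : IsConvexContour Ω γ) (hf : ContinuousOn f (closure Ω)) :
    Continuous fun t => f (γ t) :=
  hf.comp_continuous h.continuous h.mem_closure

variable [CompleteSpace E]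

/-- Cauchy's integral theorem for a convex domain. -/
theorem integral_eq_zero (h : IsConvexContour Ω γ) (hf : DiffContOnCl ℂ f Ω) :
    contourIntegral γ f = 0 := by
  have hne : Ω.Nonempty := closure_nonempty_iff.1 ⟨γ 0, h.mem_closure 0⟩
  obtain ⟨c, hc⟩ := hne
  -- `f` is only continuous on the boundary, so the contour is first contracted towards an interior
  -- point `c` by the ratio `r < 1`; then `r → 1`.
  have hcont : ContinuousOn (fun r : ℝ => contourIntegral γ fun z => f (dilate c r z)) (Icc 0 1) := by
    refine continuousOn_intervalIntegral_of_continuousOn ?_ _ _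
    refine ContinuousOn.smul (h.continuous_deriv.comp continuous_snd).continuousOn ?_
    refine hf.continuousOn.comp (f := fun q : ℝ × ℝ => dilate c q.1 (γ q.2))
      ((continuous_dilate c).comp
        (continuous_fst.prodMk (h.continuous.comp continuous_snd))).continuousOn ?_
    rintro ⟨r, t⟩ ⟨⟨h0, h1⟩, -⟩
    rcases h1.lt_or_eq with h1 | h1
    · exact subset_closure (dilate_mem h.isOpen h.convex hc (h.mem_closure t) h0 h1)
    · simp only at h1
      subst h1
      simpa using h.mem_closure t
  have hzero : ∀ r ∈ Ico (0 : ℝ) 1, contourIntegral γ (fun z => f (dilate c r z)) = 0 := by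
    rintro r ⟨h0, h1⟩
    have hopen : IsOpen (dilate c r ⁻¹' Ω) := h.isOpen.preimage (differentiable_dilate c r).continuous
    have hconv : Convex ℝ (dilate c r ⁻¹' Ω) := by
      intro x hx y hy a b ha hb hab
      have := h.convex hx hy ha hb hab
      simp only [mem_preimage]
      convert this using 1
      simp only [dilate, Complex.real_smul]
      have : (a : ℂ) + b = 1 := by exact_mod_cast hab
      linear_combination (-c + r * c) * this
    -- The contracted function is holomorphic on an open convex set containing the whole curve, so
    -- it has a primitive there.
    obtain ⟨g, hg⟩ := hconv.exists_forall_hasDerivWithinAt (𝕜 := ℂ)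
      (f := fun z => f (dilate c r z))
      (hf.differentiableOn.comp (differentiable_dilate c r).differentiableOn fun z hz => hz)
    have hmem : ∀ t, γ t ∈ dilate c r ⁻¹' Ω := fun t =>
      dilate_mem h.isOpen h.convex hc (h.mem_closure t) h0 h1
    refine contourIntegral_eq_zero_of_hasDerivAt h.contDiff h.closed
      (fun t => (hg _ (hmem t)).hasDerivAt (hopen.mem_nhds (hmem t))) ?_
    exact hf.differentiableOn.continuousOn.comp_continuous
      ((differentiable_dilate c r).continuous.comp h.continuous) hmem
  have hlim := (hcont 1 (by simp)).mono Ico_subset_Icc_self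
  have h1 : Tendsto (fun r : ℝ => contourIntegral γ fun z => f (dilate c r z)) (𝓝[Ico 0 1] 1)
      (𝓝 (contourIntegral γ f)) := by simpa [ContinuousWithinAt] using hlim
  have h2 : Tendsto (fun r : ℝ => contourIntegral γ fun z => f (dilate c r z)) (𝓝[Ico 0 1] 1)
      (𝓝 0) := tendsto_const_nhds.congr' (by
        filter_upwards [self_mem_nhdsWithin] with r hr using (hzero r hr).symm)
  have : (𝓝[Ico (0 : ℝ) 1] 1).NeBot := by
    rw [← mem_closure_iff_nhdsWithin_neBot, closure_Ico (by norm_num)]; simp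
  exact tendsto_nhds_unique h1 h2

/-- Removable singularity: dividing `f - f w` by `z - w` does not leave the class. This serves both
Cauchy's formula and the Newton interpolation that defines the value of a function at a matrix. -/
theorem diffContOnCl_dslope (ho : IsOpen Ω) (hf : DiffContOnCl ℂ f Ω) {w : ℂ} (hw : w ∈ Ω) :
    DiffContOnCl ℂ (dslope f w) Ω :=
  ⟨(Complex.differentiableOn_dslope (ho.mem_nhds hw)).2 hf.differentiableOn,
    (continuousOn_dslope (mem_of_superset (ho.mem_nhds hw) subset_closure)).2
      ⟨hf.continuousOn, hf.differentiableOn.differentiableAt (ho.mem_nhds hw)⟩⟩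

/-- Cauchy's integral formula for a convex domain. -/
theorem integral_formula (h : IsConvexContour Ω γ) (hf : DiffContOnCl ℂ f Ω) {w : ℂ}
    (hw : w ∈ Ω) :
    contourIntegral γ (fun z => (z - w)⁻¹ • f z) = (2 * Real.pi * Complex.I : ℂ) • f w := by
  have hinv : Continuous fun t => (γ t - w)⁻¹ :=
    (h.continuous.sub continuous_const).inv₀ fun t => h.sub_ne_zero t hw
  have h0 := h.integral_eq_zero (diffContOnCl_dslope h.isOpen hf hw)
  have h1 : contourIntegral γ (dslope f w) =
      contourIntegral γ (fun z => (z - w)⁻¹ • f z - (z - w)⁻¹ • f w) :=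
    contourIntegral_congr fun t => by
      have hne : γ t ≠ w := _root_.sub_ne_zero.1 (h.sub_ne_zero t hw)
      rw [dslope_of_ne _ hne, slope_def_module, smul_sub]
  rw [h1, contourIntegral_sub h.contDiff (hinv.smul (h.continuous_comp hf.continuousOn))
    (hinv.smul continuous_const), sub_eq_zero] at h0
  rw [h0, ← h.winding w hw]
  simp only [contourIntegral, ← smul_assoc]
  exact intervalIntegral.integral_smul_const _ _

/-- Integrals of Cauchy type are holomorphic off the contour. -/
theorem differentiableOn_cauchyIntegral (h : IsConvexContour Ω γ) {k : ℝ → E} (hk : Continuous k) :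
    DifferentiableOn ℂ (fun w => ∫ t in (0 : ℝ)..(2 * Real.pi), (γ t - w)⁻¹ • k t) Ω := by
  refine differentiableOn_intervalIntegral h.isOpen ?_ ?_ _ _
  · refine ContinuousOn.smul (ContinuousOn.inv₀ ?_ ?_) (hk.comp continuous_snd).continuousOn
    · exact ((h.continuous.comp continuous_snd).sub continuous_fst).continuousOn
    · rintro ⟨w, t⟩ ⟨hw, -⟩
      exact h.sub_ne_zero t hw
  · intro t
    refine DifferentiableOn.smul_const (DifferentiableOn.inv (by fun_prop) ?_) _
    intro w hw
    exact h.sub_ne_zero t hw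

end IsConvexContour

/-! ### The numerical range: convexity, compactness, eigenvalues. -/

section NumericalRange

open scoped InnerProductSpace ComplexConjugate

variable {V : Type*} [NormedAddCommGroup V] [InnerProductSpace ℂ V]

/-- The imaginary part is a real linear form in `(u.re, u.im)`, so it vanishes on a line; `u` is a
unit vector on that line. This phase makes the cross terms real in the Toeplitz–Hausdorff argument.
-/
theorem exists_unit_im_eq_zero (p q : ℂ) :
    ∃ u : ℂ, conj u * u = 1 ∧ (conj u * p + u * q).im = 0 := by
  by_cases h : (⟨q.re - p.re, -(p.im + q.im)⟩ : ℂ) = 0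
  · refine ⟨1, by simp, ?_⟩
    have := congrArg Complex.im h
    simp only [Complex.zero_im] at this
    simp only [map_one, one_mul, Complex.add_im]
    linarith
  · set z : ℂ := ⟨q.re - p.re, -(p.im + q.im)⟩ with hz
    have hn : (‖z‖ : ℂ) ≠ 0 := by simpa using h
    refine ⟨(‖z‖ : ℂ)⁻¹ * z, ?_, ?_⟩
    · rw [map_mul, map_inv₀, Complex.conj_ofReal]
      have h2 : conj z * z = (‖z‖ : ℂ) ^ 2 := by rw [Complex.conj_mul']
      field_simp
      linear_combination h2
    · have : conj ((‖z‖ : ℂ)⁻¹ * z) * p + (‖z‖ : ℂ)⁻¹ * z * q =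
          ((‖z‖⁻¹ : ℝ) : ℂ) * (conj z * p + z * q) := by
        rw [map_mul, map_inv₀, Complex.conj_ofReal]; push_cast; ring
      rw [this, Complex.im_ofReal_mul, hz]
      simp only [Complex.add_im, Complex.mul_im, Complex.conj_re, Complex.conj_im]
      ring

/-- The **Toeplitz–Hausdorff theorem**: the numerical range of an operator is convex. -/
theorem convex_numericalRange_linearMap (T : V →ₗ[ℂ] V) :
    Convex ℝ {z : ℂ | ∃ v : V, ‖v‖ = 1 ∧ z = ⟪v, T v⟫_ℂ} := by
  rw [convex_iff_segment_subset]
  rintro _ ⟨x, hx, rfl⟩ _ ⟨y, hy, rfl⟩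
  set a := ⟪x, T x⟫_ℂ with ha
  set b := ⟪y, T y⟫_ℂ with hb
  by_cases hab : a = b
  · rw [← hab, segment_same]
    rintro _ rfl
    exact ⟨x, hx, ha⟩
  have hba : b - a ≠ 0 := sub_ne_zero.2 (Ne.symm hab)
  -- Affine normalisation: the two given values `a`, `b` of the quadratic form become `0` and `1`.
  set S : V →ₗ[ℂ] V := (b - a)⁻¹ • (T - a • LinearMap.id) with hS
  have hxx : ⟪x, x⟫_ℂ = 1 := by rw [inner_self_eq_norm_sq_to_K, hx]; simp
  have hyy : ⟪y, y⟫_ℂ = 1 := by rw [inner_self_eq_norm_sq_to_K, hy]; simp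
  have hSv : ∀ v : V, ⟪v, S v⟫_ℂ = (b - a)⁻¹ * (⟪v, T v⟫_ℂ - a * ⟪v, v⟫_ℂ) := fun v => by
    simp [hS, mul_sub]
  have hSx : ⟪x, S x⟫_ℂ = 0 := by rw [hSv, ← ha, hxx]; simp
  have hSy : ⟪y, S y⟫_ℂ = 1 := by rw [hSv, ← hb, hyy]; simp [hba]
  obtain ⟨u, hu1, hu2⟩ := exists_unit_im_eq_zero ⟪x, S y⟫_ℂ ⟪y, S x⟫_ℂ
  set k : ℂ := conj u * ⟪x, S y⟫_ℂ + u * ⟪y, S x⟫_ℂ with hk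
  have hkre : k = (k.re : ℂ) := Complex.ext (by simp) (by simpa using hu2)
  -- A path from `u • x` to `y`. By the choice of the phase `u` the form of `S` is real along it, so
  -- the Rayleigh quotient runs continuously from `0` to `1` and the intermediate value theorem
  -- applies.
  set v : ℝ → V := fun t => ((1 - t : ℝ) : ℂ) • (u • x) + ((t : ℝ) : ℂ) • y with hv
  have hvS : ∀ t, ⟪v t, S (v t)⟫_ℂ = (((1 - t) * t * k.re + t ^ 2 : ℝ) : ℂ) := fun t => by
    simp only [hv, map_add, map_smul, inner_add_left, inner_add_right, inner_smul_left,
      inner_smul_right, hSx, hSy, Complex.conj_ofReal]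
    push_cast
    rw [← hkre, hk]
    ring
  have hu0 : u ≠ 0 := by rintro rfl; simp at hu1
  -- If the path met `0`, then `y` would be a multiple of `x` (or `x` would vanish), and the form of
  -- `S` at `y` would be `0` instead of `1`.
  have hv0 : ∀ t, v t ≠ 0 := fun t h0 => by
    by_cases ht : t = 0
    · subst ht
      simp only [hv, sub_zero, Complex.ofReal_one, one_smul, Complex.ofReal_zero, zero_smul,
        add_zero, smul_eq_zero, hu0, false_or] at h0
      simp [h0] at hx
    · have ht' : (t : ℂ) ≠ 0 := by exact_mod_cast ht
      have hy' : y = (-((t : ℂ)⁻¹ * ((1 - t : ℝ) : ℂ) * u)) • x := by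
        have h1 : (t : ℂ) • y = -(((1 - t : ℝ) : ℂ) • (u • x)) :=
          (neg_eq_of_add_eq_zero_right h0).symm
        have h2 : y = (t : ℂ)⁻¹ • ((t : ℂ) • y) := by rw [smul_smul, inv_mul_cancel₀ ht', one_smul]
        rw [h2, h1, ← smul_neg, smul_smul]
        rw [neg_smul, smul_neg, smul_smul]
      rw [hy', map_smul, inner_smul_left, inner_smul_right, hSx] at hSy
      simp at hSy
  have hvc : Continuous v := by
    simp only [hv]; fun_prop
  have hφ : ContinuousOn (fun t : ℝ => ((1 - t) * t * k.re + t ^ 2) / ‖v t‖ ^ 2) (Icc 0 1) := by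
    refine Continuous.continuousOn ?_
    refine Continuous.div (by fun_prop) (by fun_prop) fun t => ?_
    exact pow_ne_zero _ (norm_ne_zero_iff.2 (hv0 t))
  have hivt := intermediate_value_Icc (zero_le_one' ℝ) hφ
  rw [segment_eq_image']
  rintro _ ⟨τ, hτ, rfl⟩
  have hv1 : v 1 = y := by simp [hv]
  obtain ⟨t, -, ht⟩ := hivt (by simpa [hv1, hy] using hτ)
  have hn : (‖v t‖ : ℂ) ≠ 0 := by simpa using hv0 t
  refine ⟨((‖v t‖ : ℂ)⁻¹) • v t, ?_, ?_⟩
  · rw [norm_smul, norm_inv, Complex.norm_real, norm_norm,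
      inv_mul_cancel₀ (norm_ne_zero_iff.2 (hv0 t))]
  · have h1 := hvS t
    rw [hSv, inner_self_eq_norm_sq_to_K] at h1
    have h2 : ((τ : ℝ) : ℂ) * (‖v t‖ : ℂ) ^ 2 = (((1 - t) * t * k.re + t ^ 2 : ℝ) : ℂ) := by
      rw [← ht]; push_cast; field_simp
    rw [← h2] at h1
    have h3 : ⟪v t, T (v t)⟫_ℂ = (a + τ * (b - a)) * (‖v t‖ : ℂ) ^ 2 := by
      field_simp at h1
      simp only [Complex.coe_algebraMap] at h1
      linear_combination h1
    rw [map_smul, inner_smul_left, inner_smul_right, h3, map_inv₀, Complex.conj_ofReal]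
    simp only [Complex.real_smul]
    field_simp

variable {n : Type*} [Fintype n] [DecidableEq n]

theorem star_dotProduct_mulVec_eq_inner (A : Matrix n n ℂ) (v : EuclideanSpace ℂ n) :
    star v.ofLp ⬝ᵥ (A *ᵥ v.ofLp) = ⟪v, Matrix.toEuclideanLin A v⟫_ℂ := by
  rw [EuclideanSpace.inner_eq_star_dotProduct, dotProduct_comm]
  rfl

theorem numericalRange_eq (A : Matrix n n ℂ) :
    numericalRange A =
      {z : ℂ | ∃ v : EuclideanSpace ℂ n, ‖v‖ = 1 ∧ z = ⟪v, Matrix.toEuclideanLin A v⟫_ℂ} := by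
  simp only [numericalRange, star_dotProduct_mulVec_eq_inner]

theorem convex_numericalRange (A : Matrix n n ℂ) : Convex ℝ (numericalRange A) := by
  rw [numericalRange_eq]
  exact convex_numericalRange_linearMap _

theorem isCompact_numericalRange (A : Matrix n n ℂ) : IsCompact (numericalRange A) := by
  have : numericalRange A =
      (fun v : EuclideanSpace ℂ n => ⟪v, Matrix.toEuclideanLin A v⟫_ℂ) '' Metric.sphere 0 1 := by
    rw [numericalRange_eq]
    ext z
    simp [eq_comm]
  rw [this]
  refine (isCompact_sphere _ _).image ?_
  have : Continuous (Matrix.toEuclideanLin A) := LinearMap.continuous_of_finiteDimensional _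
  fun_prop

theorem numericalRange_nonempty [Nonempty n] (A : Matrix n n ℂ) : (numericalRange A).Nonempty := by
  rw [numericalRange_eq]
  obtain ⟨i⟩ := ‹Nonempty n›
  exact ⟨_, EuclideanSpace.single i 1, by simp, rfl⟩

/-- The quadratic form of `A` at an arbitrary vector. -/
theorem inner_toEuclideanLin_mem (A : Matrix n n ℂ) {v : EuclideanSpace ℂ n} (hv : v ≠ 0) :
    ∃ w ∈ numericalRange A, ⟪v, Matrix.toEuclideanLin A v⟫_ℂ = (‖v‖ : ℂ) ^ 2 * w := by
  have hn : (‖v‖ : ℂ) ≠ 0 := by simpa using hv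
  rw [numericalRange_eq]
  refine ⟨_, ⟨((‖v‖ : ℂ)⁻¹) • v, ?_, rfl⟩, ?_⟩
  · rw [norm_smul, norm_inv, Complex.norm_real, norm_norm, inv_mul_cancel₀ (norm_ne_zero_iff.2 hv)]
  · rw [map_smul, inner_smul_left, inner_smul_right, map_inv₀, Complex.conj_ofReal]
    field_simp

theorem det_sub_ne_zero {A : Matrix n n ℂ} {z : ℂ} (hz : z ∉ numericalRange A) :
    (z • (1 : Matrix n n ℂ) - A).det ≠ 0 := by
  intro h
  obtain ⟨v, hv, hv0⟩ := Matrix.exists_mulVec_eq_zero_iff.2 h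
  have hv' : WithLp.toLp 2 v ≠ 0 := by simpa using hv
  obtain ⟨w, hw, hvw⟩ := inner_toEuclideanLin_mem A hv'
  have h1 : Matrix.toEuclideanLin A (WithLp.toLp 2 v) = z • WithLp.toLp 2 v := by
    rw [Matrix.sub_mulVec, Matrix.smul_mulVec, Matrix.one_mulVec, sub_eq_zero] at hv0
    ext i
    have := congrFun hv0 i
    simpa using this.symm
  rw [h1, inner_smul_right, inner_self_eq_norm_sq_to_K, mul_comm] at hvw
  have hn : ((‖WithLp.toLp 2 v‖ : ℂ)) ^ 2 ≠ 0 := pow_ne_zero _ (by simpa using hv)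
  exact hz ((mul_left_cancel₀ hn hvw) ▸ hw)

theorem isRoot_charpoly_mem {A : Matrix n n ℂ} {z : ℂ} (hz : A.charpoly.IsRoot z) :
    z ∈ numericalRange A := by
  by_contra h
  refine det_sub_ne_zero h ?_
  rw [Polynomial.IsRoot, Matrix.eval_charpoly] at hz
  rwa [Matrix.smul_one_eq_diagonal]

end NumericalRange

/-! ### Resolvents and their contour integrals. -/

section Resolvent

variable {n : Type*} [Fintype n] [DecidableEq n]

theorem continuousOn_matrix_inv {X : Type*} [TopologicalSpace X] {s : Set X}
    {M : X → Matrix n n ℂ} (hM : ContinuousOn M s) (h : ∀ x ∈ s, (M x).det ≠ 0) :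
    ContinuousOn (fun x => (M x)⁻¹) s := by
  simp only [Matrix.inv_def, Ring.inverse_eq_inv']
  have h1 : ContinuousOn (fun x => (M x).det) s :=
    (Continuous.matrix_det continuous_id).comp_continuousOn hM
  have h2 : ContinuousOn (fun x => (M x).adjugate) s :=
    (Continuous.matrix_adjugate continuous_id).comp_continuousOn hM
  exact (h1.inv₀ h).smul h2

theorem inv_mul_eq_mul_inv {m : Type*} [Fintype m] [DecidableEq m] {M' : Matrix m m ℂ}
    {M : Matrix n n ℂ} {X : Matrix m n ℂ} (hM' : M'.det ≠ 0) (hM : M.det ≠ 0)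
    (h : M' * X = X * M) : M'⁻¹ * X = X * M⁻¹ := by
  have h1 : M'⁻¹ * (M' * X) * M⁻¹ = M'⁻¹ * (X * M) * M⁻¹ := by rw [h]
  rw [← Matrix.mul_assoc, Matrix.nonsing_inv_mul _ (isUnit_iff_ne_zero.2 hM'), Matrix.one_mul,
    ← Matrix.mul_assoc, Matrix.mul_assoc (M'⁻¹ * X),
    Matrix.mul_nonsing_inv _ (isUnit_iff_ne_zero.2 hM), Matrix.mul_one] at h1
  exact h1.symm

theorem matrix_inv_sub_inv {M N : Matrix n n ℂ} (hM : M.det ≠ 0) (hN : N.det ≠ 0) :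
    M⁻¹ - N⁻¹ = M⁻¹ * (N - M) * N⁻¹ := by
  rw [mul_sub, sub_mul, Matrix.nonsing_inv_mul _ (isUnit_iff_ne_zero.2 hM), one_mul, mul_assoc,
    Matrix.mul_nonsing_inv _ (isUnit_iff_ne_zero.2 hN), mul_one]

/-- Carathéodory's criterion for differentiability. -/
theorem hasDerivWithinAt_of_sub_eq_smul {𝕜 E : Type*} [NontriviallyNormedField 𝕜]
    [NormedAddCommGroup E] [NormedSpace 𝕜 E] {f q : 𝕜 → E} {s : Set 𝕜} {x : 𝕜}
    (h : ∀ y ∈ s, f y - f x = (y - x) • q y) (hq : ContinuousWithinAt q s x) :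
    HasDerivWithinAt f (q x) s x := by
  rw [hasDerivWithinAt_iff_tendsto_slope]
  refine (hq.mono sdiff_subset).tendsto.congr' ?_
  filter_upwards [self_mem_nhdsWithin] with y hy
  rw [slope_def_module, h y hy.1, smul_smul, inv_mul_cancel₀ (sub_ne_zero.2 hy.2), one_smul]

theorem isOpen_det_ne_zero (A : Matrix n n ℂ) :
    IsOpen {z : ℂ | (z • (1 : Matrix n n ℂ) - A).det ≠ 0} :=
  isOpen_ne.preimage (Continuous.matrix_det (by fun_prop))

theorem hasDerivAt_resolvent (A : Matrix n n ℂ) {z : ℂ}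
    (hz : (z • (1 : Matrix n n ℂ) - A).det ≠ 0) :
    HasDerivAt (fun z => (z • (1 : Matrix n n ℂ) - A)⁻¹)
      (-((z • (1 : Matrix n n ℂ) - A)⁻¹ * (z • (1 : Matrix n n ℂ) - A)⁻¹)) z := by
  have ho := isOpen_det_ne_zero A
  refine (hasDerivWithinAt_of_sub_eq_smul (s := {z : ℂ | (z • (1 : Matrix n n ℂ) - A).det ≠ 0})
    (q := fun y => -((y • (1 : Matrix n n ℂ) - A)⁻¹ * (z • (1 : Matrix n n ℂ) - A)⁻¹))
    (fun y hy => ?_) ?_).hasDerivAt (ho.mem_nhds hz)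
  · rw [matrix_inv_sub_inv hy hz]
    have : z • (1 : Matrix n n ℂ) - A - (y • 1 - A) = -((y - z) • 1) := by
      rw [sub_smul]; abel
    rw [this]
    simp
  · have h1 : ContinuousOn (fun y : ℂ => (y • (1 : Matrix n n ℂ) - A)⁻¹)
        {z : ℂ | (z • (1 : Matrix n n ℂ) - A).det ≠ 0} :=
      continuousOn_matrix_inv (by fun_prop) fun y hy => hy
    exact ((h1.mul continuousOn_const).neg) z hz

namespace IsConvexContour

variable {Ω : Set ℂ} {γ : ℝ → ℂ} {A : Matrix n n ℂ}

theorem det_ne_zero (h : IsConvexContour Ω γ) (hA : numericalRange A ⊆ Ω) (t : ℝ) :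
    (γ t • (1 : Matrix n n ℂ) - A).det ≠ 0 :=
  det_sub_ne_zero fun ht => h.notMem t (hA ht)

theorem continuous_resolvent (h : IsConvexContour Ω γ) (hA : numericalRange A ⊆ Ω) :
    Continuous fun t => (γ t • (1 : Matrix n n ℂ) - A)⁻¹ := by
  rw [← continuousOn_univ]
  refine continuousOn_matrix_inv ?_ fun t _ => h.det_ne_zero hA t
  have := h.continuous
  fun_prop

end IsConvexContour

/-- The matrix `(1 - s) w + s A`. -/
def matrixDilate (w : ℂ) (s : ℝ) (A : Matrix n n ℂ) : Matrix n n ℂ :=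
  w • 1 + (s : ℂ) • (A - w • 1)

theorem numericalRange_matrixDilate (w : ℂ) (s : ℝ) (A : Matrix n n ℂ) :
    numericalRange (matrixDilate w s A) = dilate w s '' numericalRange A := by
  have key : ∀ v : EuclideanSpace ℂ n, ‖v‖ = 1 →
      star v.ofLp ⬝ᵥ (matrixDilate w s A *ᵥ v.ofLp) =
        dilate w s (star v.ofLp ⬝ᵥ (A *ᵥ v.ofLp)) := fun v hv => by
    have h1 : star v.ofLp ⬝ᵥ v.ofLp = 1 := by
      have := EuclideanSpace.inner_eq_star_dotProduct v v
      rw [inner_self_eq_norm_sq_to_K, hv, dotProduct_comm] at this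
      simpa using this.symm
    simp only [matrixDilate, dilate, Matrix.add_mulVec, Matrix.smul_mulVec, Matrix.sub_mulVec,
      Matrix.one_mulVec, dotProduct_add, dotProduct_sub, dotProduct_smul, h1, smul_eq_mul]
    ring
  ext z
  constructor
  · rintro ⟨v, hv, rfl⟩
    exact ⟨_, ⟨v, hv, rfl⟩, (key v hv).symm⟩
  · rintro ⟨_, ⟨v, hv, rfl⟩, rfl⟩
    exact ⟨v, hv, (key v hv).symm⟩

theorem continuous_matrixDilate (w : ℂ) (A : Matrix n n ℂ) :
    Continuous fun s : ℝ => matrixDilate w s A := by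
  unfold matrixDilate
  fun_prop

namespace IsConvexContour

variable {Ω : Set ℂ} {γ : ℝ → ℂ} {A : Matrix n n ℂ}

/-- By convexity of `Ω`, the homotopy from the scalar matrix `w` to `A` never moves the spectrum
onto the contour. -/
theorem numericalRange_matrixDilate_subset (h : IsConvexContour Ω γ) (hA : numericalRange A ⊆ Ω)
    {w : ℂ} (hw : w ∈ Ω) {s : ℝ} (hs : s ∈ Icc (0 : ℝ) 1) :
    numericalRange (matrixDilate w s A) ⊆ Ω := by
  rw [numericalRange_matrixDilate]
  rintro _ ⟨z, hz, rfl⟩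
  rcases hs.2.lt_or_eq with h1 | h1
  · exact dilate_mem h.isOpen h.convex hw (subset_closure (hA hz)) hs.1 h1
  · rw [h1, dilate_one]; exact hA hz

theorem continuousOn_resolvent_matrixDilate (h : IsConvexContour Ω γ)
    (hA : numericalRange A ⊆ Ω) {w : ℂ} (hw : w ∈ Ω) :
    ContinuousOn (fun q : ℝ × ℝ => (γ q.2 • (1 : Matrix n n ℂ) - matrixDilate w q.1 A)⁻¹)
      (Icc 0 1 ×ˢ univ) := by
  refine continuousOn_matrix_inv ?_ fun q hq =>
    h.det_ne_zero (h.numericalRange_matrixDilate_subset hA hw hq.1) q.2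
  have := h.continuous
  have := (continuous_matrixDilate w A).comp (continuous_fst (X := ℝ) (Y := ℝ))
  exact Continuous.continuousOn (Continuous.sub (by fun_prop) this)

/-- Deform `A` to the scalar matrix `w` through `matrixDilate`. The derivative in `s` of the
integral is `∮ R N R`, where `N = A - w` commutes with the resolvent `R`; the integrand is the
`z`-derivative of `-N R`, so the derivative vanishes. At `s = 0` only the winding number around `w`
remains. -/
theorem integral_resolvent (h : IsConvexContour Ω γ) (hA : numericalRange A ⊆ Ω) :
    contourIntegral γ (fun z => (z • (1 : Matrix n n ℂ) - A)⁻¹) =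
      (2 * Real.pi * Complex.I : ℂ) • (1 : Matrix n n ℂ) := by
  obtain ⟨w, hw⟩ : Ω.Nonempty := closure_nonempty_iff.1 ⟨γ 0, h.mem_closure 0⟩
  set N := A - w • (1 : Matrix n n ℂ) with hN
  set R : ℝ → ℂ → Matrix n n ℂ := fun s z => (z • (1 : Matrix n n ℂ) - matrixDilate w s A)⁻¹ with hR
  have hRc := h.continuousOn_resolvent_matrixDilate hA hw
  have hdet : ∀ s ∈ Icc (0 : ℝ) 1, ∀ t,
      (γ t • (1 : Matrix n n ℂ) - matrixDilate w s A).det ≠ 0 := fun s hs t =>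
    h.det_ne_zero (h.numericalRange_matrixDilate_subset hA hw hs) t
  have hRct : ∀ s ∈ Icc (0 : ℝ) 1, Continuous fun t => R s (γ t) := fun s hs =>
    hRc.continuous_right (Φ := fun s t => R s (γ t)) hs
  set J : ℝ → Matrix n n ℂ := fun s => contourIntegral γ (R s) with hJ
  have hder : ∀ s₀ ∈ Icc (0 : ℝ) 1, HasDerivWithinAt J 0 (Icc 0 1) s₀ := by
    intro s₀ hs₀
    have hq : ContinuousOn (fun s => contourIntegral γ fun z => R s z * N * R s₀ z) (Icc 0 1) := by
      refine continuousOn_intervalIntegral_of_continuousOn ?_ _ _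
      refine ContinuousOn.smul (h.continuous_deriv.comp continuous_snd).continuousOn ?_
      exact (hRc.mul continuousOn_const).mul ((hRct s₀ hs₀).comp continuous_snd).continuousOn
    have h0 : contourIntegral γ (fun z => R s₀ z * N * R s₀ z) = 0 := by
      have hcomm : ∀ t, Commute (R s₀ (γ t)) N := fun t => by
        refine Commute.symm ?_
        have : Commute N (γ t • (1 : Matrix n n ℂ) - matrixDilate w s₀ A) := by
          refine ((Commute.one_right N).smul_right _).sub_right ?_
          exact ((Commute.one_right N).smul_right _).add_right ((Commute.refl N).smul_right _)
        exact (inv_mul_eq_mul_inv (hdet s₀ hs₀ t) (hdet s₀ hs₀ t) this.eq.symm).symm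
      refine contourIntegral_eq_zero_of_hasDerivAt (g := fun z => -(N * R s₀ z)) h.contDiff
        h.closed (fun t => ?_) (((hRct s₀ hs₀).mul continuous_const).mul (hRct s₀ hs₀))
      have := ((hasDerivAt_resolvent (matrixDilate w s₀ A) (hdet s₀ hs₀ t)).const_mul N).fun_neg
      convert this using 1
      rw [mul_neg, neg_neg, ← mul_assoc, (hcomm t).eq]
    have := hasDerivWithinAt_of_sub_eq_smul (f := J) (fun s hs => ?_) (hq s₀ hs₀)
    · rwa [h0] at this
    · rw [hJ]
      simp only
      rw [← contourIntegral_sub h.contDiff (hRct s hs) (hRct s₀ hs₀)]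
      have hsm : ∀ M : Matrix n n ℂ, (s - s₀) • M = ((s - s₀ : ℝ) : ℂ) • M := fun M =>
        (Complex.coe_smul _ _).symm
      rw [hsm, ← contourIntegral_smul]
      refine contourIntegral_congr fun t => ?_
      simp only [hR]
      rw [matrix_inv_sub_inv (hdet s hs t) (hdet s₀ hs₀ t)]
      have : γ t • (1 : Matrix n n ℂ) - matrixDilate w s₀ A - (γ t • 1 - matrixDilate w s A) =
          ((s - s₀ : ℝ) : ℂ) • N := by
        simp only [matrixDilate, hN]
        push_cast
        rw [sub_smul (s : ℂ)]
        abel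
      rw [this]
      simp
  have hconst := constant_of_derivWithin_zero (f := J) (a := 0) (b := 1)
    (fun s hs => (hder s hs).differentiableWithinAt) (fun s hs =>
      (hder s (Ico_subset_Icc_self hs)).derivWithin
        (uniqueDiffOn_Icc zero_lt_one s (Ico_subset_Icc_self hs))) 1 (by simp)
  have h1 : R 1 = fun z => (z • (1 : Matrix n n ℂ) - A)⁻¹ := by
    funext z; simp [hR, matrixDilate]
  have h0 : J 0 = contourIntegral γ fun z => (z - w)⁻¹ • (1 : Matrix n n ℂ) := by
    refine contourIntegral_congr fun t => ?_
    have hne := h.sub_ne_zero t hw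
    simp only [hR, matrixDilate, Complex.ofReal_zero, zero_smul, add_zero, ← sub_smul]
    refine Matrix.inv_eq_right_inv ?_
    rw [smul_mul_smul_comm, mul_inv_cancel₀ hne, one_smul, one_mul]
  simp only [hJ] at hconst h0
  rw [h1, h0] at hconst
  rw [hconst, ← h.winding w hw]
  simp only [contourIntegral, ← smul_assoc]
  exact intervalIntegral.integral_smul_const _ _

end IsConvexContour

end Resolvent

/-! ### Kronecker and matrix products as bounded bilinear maps. -/

section Bilinear

theorem DiffContOnCl.clm_apply₂ {E F G : Type*} [NormedAddCommGroup E] [NormedSpace ℂ E]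
    [NormedAddCommGroup F] [NormedSpace ℂ F] [NormedAddCommGroup G] [NormedSpace ℂ G]
    (L : E →L[ℂ] F →L[ℂ] G) {Ω : Set ℂ} {f : ℂ → E} {g : ℂ → F} (hf : DiffContOnCl ℂ f Ω)
    (hg : DiffContOnCl ℂ g Ω) : DiffContOnCl ℂ (fun z => L (f z) (g z)) Ω :=
  ⟨L.isBoundedBilinearMap.differentiable.comp_differentiableOn
    (hf.differentiableOn.prodMk hg.differentiableOn),
   L.isBoundedBilinearMap.continuous.comp_continuousOn
    (hf.continuousOn.prodMk hg.continuousOn)⟩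

variable {l m n p a b : Type*} [Fintype l] [Fintype m] [Fintype n] [Fintype p] [Fintype a]
  [Fintype b] [DecidableEq l] [DecidableEq m] [DecidableEq n] [DecidableEq p] [DecidableEq a]
  [DecidableEq b]

/-- The Kronecker product as a continuous bilinear map. -/
def kroneckerCLM (m p a b : Type*) [Fintype m] [Fintype p] [Fintype a] [Fintype b]
    [DecidableEq m] [DecidableEq p] [DecidableEq a] [DecidableEq b] :
    Matrix m p ℂ →L[ℂ] Matrix a b ℂ →L[ℂ] Matrix (m × a) (p × b) ℂ :=
  (LinearMap.mk₂ ℂ (fun X Y => X ⊗ₖ Y) Matrix.add_kronecker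
    (fun c X Y => Matrix.smul_kronecker c X Y) Matrix.kronecker_add
    (fun c X Y => Matrix.kronecker_smul c X Y)).toContinuousBilinearMap

@[simp] theorem kroneckerCLM_apply (X : Matrix m p ℂ) (Y : Matrix a b ℂ) :
    kroneckerCLM m p a b X Y = X ⊗ₖ Y := rfl

/-- The product of matrices as a continuous bilinear map. -/
def matrixMulCLM (m n p : Type*) [Fintype m] [Fintype n] [Fintype p]
    [DecidableEq m] [DecidableEq n] [DecidableEq p] :
    Matrix m n ℂ →L[ℂ] Matrix n p ℂ →L[ℂ] Matrix m p ℂ :=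
  (LinearMap.mk₂ ℂ (fun X Y => X * Y) Matrix.add_mul (fun c X Y => Matrix.smul_mul c X Y)
    Matrix.mul_add (fun c X Y => Matrix.mul_smul X c Y)).toContinuousBilinearMap

@[simp] theorem matrixMulCLM_apply (X : Matrix m n ℂ) (Y : Matrix n p ℂ) :
    matrixMulCLM m n p X Y = X * Y := rfl

theorem ContinuousOn.kronecker {X : Type*} [TopologicalSpace X] {s : Set X}
    {f : X → Matrix m p ℂ} {g : X → Matrix a b ℂ} (hf : ContinuousOn f s) (hg : ContinuousOn g s) :
    ContinuousOn (fun x => f x ⊗ₖ g x) s :=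
  (kroneckerCLM m p a b).isBoundedBilinearMap.continuous.comp_continuousOn (hf.prodMk hg)

theorem Continuous.kronecker {X : Type*} [TopologicalSpace X]
    {f : X → Matrix m p ℂ} {g : X → Matrix a b ℂ} (hf : Continuous f) (hg : Continuous g) :
    Continuous (fun x => f x ⊗ₖ g x) :=
  (kroneckerCLM m p a b).isBoundedBilinearMap.continuous.comp (hf.prodMk hg)

theorem DiffContOnCl.kronecker {Ω : Set ℂ} {f : ℂ → Matrix m p ℂ} {g : ℂ → Matrix a b ℂ}
    (hf : DiffContOnCl ℂ f Ω) (hg : DiffContOnCl ℂ g Ω) :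
    DiffContOnCl ℂ (fun z => f z ⊗ₖ g z) Ω :=
  hf.clm_apply₂ (kroneckerCLM m p a b) hg

theorem DiffContOnCl.matrix_mul {Ω : Set ℂ} {f : ℂ → Matrix m n ℂ} {g : ℂ → Matrix n p ℂ}
    (hf : DiffContOnCl ℂ f Ω) (hg : DiffContOnCl ℂ g Ω) :
    DiffContOnCl ℂ (fun z => f z * g z) Ω :=
  hf.clm_apply₂ (matrixMulCLM m n p) hg

end Bilinear

/-! ### Spectral norms of Kronecker products and integration against positive densities. -/

section Norms

open scoped InnerProductSpace ComplexOrder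

variable {m p a : Type*} [Fintype m] [Fintype p] [Fintype a]
  [DecidableEq m] [DecidableEq p] [DecidableEq a]

/-- The ampliation `X ↦ X ⊗ 1` as a star homomorphism. -/
def kroneckerOneHom (p a : Type*) [Fintype p] [Fintype a] [DecidableEq p] [DecidableEq a] :
    Matrix p p ℂ →⋆ₐ[ℂ] Matrix (p × a) (p × a) ℂ where
  toFun X := X ⊗ₖ (1 : Matrix a a ℂ)
  map_one' := Matrix.one_kronecker_one
  map_mul' X Y := by rw [← Matrix.mul_kronecker_mul, one_mul]
  map_zero' := Matrix.zero_kronecker _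
  map_add' X Y := Matrix.add_kronecker _ _ _
  commutes' c := by
    rw [Algebra.algebraMap_eq_smul_one, Matrix.smul_kronecker, Matrix.one_kronecker_one,
      Algebra.algebraMap_eq_smul_one]
  map_star' X := by
    simp only [Matrix.star_eq_conjTranspose]
    rw [Matrix.conjTranspose_kronecker, Matrix.conjTranspose_one]

/-- Star homomorphisms of C⋆-algebras are contractive, and `X ↦ X ⊗ 1` is one on square matrices.
The C⋆-identity for `Xᴴ * X` reduces the rectangular case to this. -/
theorem norm_kronecker_one_le (X : Matrix m p ℂ) : ‖X ⊗ₖ (1 : Matrix a a ℂ)‖ ≤ ‖X‖ := by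
  have h1 := NonUnitalStarAlgHom.norm_apply_le (kroneckerOneHom p a) (Xᴴ * X)
  have h2 : kroneckerOneHom p a (Xᴴ * X) =
      (X ⊗ₖ (1 : Matrix a a ℂ))ᴴ * (X ⊗ₖ (1 : Matrix a a ℂ)) := by
    rw [Matrix.conjTranspose_kronecker, ← Matrix.mul_kronecker_mul, Matrix.conjTranspose_one,
      one_mul]
    rfl
  rw [h2, Matrix.l2_opNorm_conjTranspose_mul_self, Matrix.l2_opNorm_conjTranspose_mul_self] at h1
  exact (mul_self_le_mul_self_iff (norm_nonneg _) (norm_nonneg _)).2 h1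

/-- The sesquilinear form of a matrix, as a functional of the matrix. -/
def sesqForm (u : EuclideanSpace ℂ m) (v : EuclideanSpace ℂ p) : Matrix m p ℂ →L[ℂ] ℂ :=
  LinearMap.toContinuousLinearMap
    { toFun := fun X => ⟪u, Matrix.toEuclideanLin X v⟫_ℂ
      map_add' := fun X Y => by simp
      map_smul' := fun c X => by simp }

theorem sesqForm_apply (u : EuclideanSpace ℂ m) (v : EuclideanSpace ℂ p) (X : Matrix m p ℂ) :
    sesqForm u v X = ⟪u, Matrix.toEuclideanLin X v⟫_ℂ := rfl

theorem norm_toEuclideanLin_le (X : Matrix m p ℂ) (v : EuclideanSpace ℂ p) :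
    ‖Matrix.toEuclideanLin X v‖ ≤ ‖X‖ * ‖v‖ :=
  X.l2_opNorm_mulVec v

theorem norm_sesqForm_le (u : EuclideanSpace ℂ m) (v : EuclideanSpace ℂ p) (X : Matrix m p ℂ) :
    ‖sesqForm u v X‖ ≤ ‖X‖ * ‖u‖ * ‖v‖ := by
  rw [sesqForm_apply]
  calc _ ≤ ‖u‖ * ‖Matrix.toEuclideanLin X v‖ := norm_inner_le_norm _ _
    _ ≤ ‖u‖ * (‖X‖ * ‖v‖) := by gcongr; exact norm_toEuclideanLin_le X v
    _ = _ := by ring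

theorem norm_le_of_sesqForm {X : Matrix m p ℂ} {C : ℝ} (hC : 0 ≤ C)
    (h : ∀ u v, ‖u‖ = 1 → ‖v‖ = 1 → ‖sesqForm u v X‖ ≤ C) : ‖X‖ ≤ C := by
  rw [Matrix.l2_opNorm_def]
  refine ContinuousLinearMap.opNorm_le_of_unit_norm hC fun v hv => ?_
  change ‖Matrix.toEuclideanLin X v‖ ≤ C
  set w := Matrix.toEuclideanLin X v with hw
  by_cases hw0 : w = 0
  · rw [hw0, norm_zero]; exact hC
  have hn : ‖w‖ ≠ 0 := norm_ne_zero_iff.2 hw0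
  have h1 := h (((‖w‖ : ℂ)⁻¹) • w) v (by
    rw [norm_smul, norm_inv, Complex.norm_real, norm_norm, inv_mul_cancel₀ hn]) hv
  rw [sesqForm_apply, ← hw, inner_smul_left, inner_self_eq_norm_sq_to_K] at h1
  simp only [map_inv₀, Complex.conj_ofReal, Complex.coe_algebraMap, norm_mul, norm_inv,
    Complex.norm_real, norm_norm, norm_pow] at h1
  rw [pow_two, inv_mul_cancel_left₀ hn] at h1
  exact h1

theorem sesqForm_conjTranspose_mul_mul {m' p' : Type*} [Fintype m'] [Fintype p'] [DecidableEq m']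
    [DecidableEq p'] (L : Matrix m' m ℂ) (K : Matrix p' p ℂ) (X : Matrix m' p' ℂ)
    (u : EuclideanSpace ℂ m) (v : EuclideanSpace ℂ p) :
    sesqForm u v (Lᴴ * X * K) =
      sesqForm (Matrix.toEuclideanLin L u) (Matrix.toEuclideanLin K v) X := by
  rw [sesqForm_apply, sesqForm_apply, Matrix.mul_assoc]
  have e1 : Matrix.toEuclideanLin (Lᴴ * (X * K)) v =
      Matrix.toEuclideanLin Lᴴ (Matrix.toEuclideanLin (X * K) v) := by
    ext i
    simp [Matrix.mulVec_mulVec]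
  have e2 : Matrix.toEuclideanLin (X * K) v =
      Matrix.toEuclideanLin X (Matrix.toEuclideanLin K v) := by
    ext i
    simp [Matrix.mulVec_mulVec]
  rw [e1, e2, Matrix.toEuclideanLin_conjTranspose_eq_adjoint, LinearMap.adjoint_inner_right]

theorem Matrix.PosSemidef.exists_conjTranspose_mul_self {M : Matrix a a ℂ} (hM : M.PosSemidef) :
    ∃ N : Matrix a a ℂ, M = Nᴴ * N := by
  open scoped MatrixOrder in
  exact CStarAlgebra.nonneg_iff_eq_star_mul_self.mp hM.nonneg

theorem kronecker_conjTranspose_mul_self (X : Matrix m p ℂ) (N : Matrix a a ℂ) :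
    X ⊗ₖ (Nᴴ * N) =
      ((1 : Matrix m m ℂ) ⊗ₖ N)ᴴ * (X ⊗ₖ (1 : Matrix a a ℂ)) * ((1 : Matrix p p ℂ) ⊗ₖ N) := by
  rw [Matrix.conjTranspose_kronecker, ← Matrix.mul_kronecker_mul, ← Matrix.mul_kronecker_mul,
    Matrix.conjTranspose_one, Matrix.one_mul, Matrix.mul_one, Matrix.mul_one]

theorem re_sesqForm_one_kronecker (N : Matrix a a ℂ) (u : EuclideanSpace ℂ (m × a)) :
    (sesqForm u u ((1 : Matrix m m ℂ) ⊗ₖ (Nᴴ * N))).re =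
      ‖Matrix.toEuclideanLin ((1 : Matrix m m ℂ) ⊗ₖ N) u‖ ^ 2 := by
  rw [kronecker_conjTranspose_mul_self, sesqForm_conjTranspose_mul_mul, sesqForm_apply,
    Matrix.one_kronecker_one]
  have : ∀ w : EuclideanSpace ℂ (m × a),
      Matrix.toEuclideanLin (1 : Matrix (m × a) (m × a) ℂ) w = w := fun w => by ext i; simp
  rw [this, inner_self_eq_norm_sq_to_K]
  simp [← Complex.ofReal_pow]

/-- Write `M = Nᴴ * N`, move `1 ⊗ N` onto the two vectors, and apply Cauchy–Schwarz and the
arithmetic-geometric mean inequality. The resulting bound is linear in `M` for fixed `‖X‖`, so it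
can be integrated. -/
theorem norm_sesqForm_kronecker_le {M : Matrix a a ℂ} (hM : M.PosSemidef) (X : Matrix m p ℂ)
    (u : EuclideanSpace ℂ (m × a)) (v : EuclideanSpace ℂ (p × a)) :
    ‖sesqForm u v (X ⊗ₖ M)‖ ≤ ‖X‖ / 2 *
      ((sesqForm u u ((1 : Matrix m m ℂ) ⊗ₖ M)).re +
        (sesqForm v v ((1 : Matrix p p ℂ) ⊗ₖ M)).re) := by
  obtain ⟨N, rfl⟩ := hM.exists_conjTranspose_mul_self
  rw [re_sesqForm_one_kronecker, re_sesqForm_one_kronecker, kronecker_conjTranspose_mul_self,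
    sesqForm_conjTranspose_mul_mul]
  set x := ‖Matrix.toEuclideanLin ((1 : Matrix m m ℂ) ⊗ₖ N) u‖
  set y := ‖Matrix.toEuclideanLin ((1 : Matrix p p ℂ) ⊗ₖ N) v‖
  calc _ ≤ ‖X ⊗ₖ (1 : Matrix a a ℂ)‖ * x * y := norm_sesqForm_le _ _ _
    _ ≤ ‖X‖ * (x * y) := by
      rw [mul_assoc]
      exact mul_le_mul_of_nonneg_right (norm_kronecker_one_le X) (by positivity)
    _ ≤ ‖X‖ * ((x ^ 2 + y ^ 2) / 2) := by
      gcongr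
      nlinarith [sq_nonneg (x - y)]
    _ = _ := by ring

theorem sesqForm_one (u : EuclideanSpace ℂ m) (hu : ‖u‖ = 1) :
    sesqForm u u (1 : Matrix m m ℂ) = 1 := by
  have : Matrix.toEuclideanLin (1 : Matrix m m ℂ) u = u := by ext i; simp
  rw [sesqForm_apply, this, inner_self_eq_norm_sq_to_K, hu]
  simp

theorem integral_re_sesqForm_one_kronecker {M : ℝ → Matrix a a ℂ} {x y D : ℝ}
    (hM : Continuous M) (hD : ∫ t in x..y, M t = (D : ℂ) • (1 : Matrix a a ℂ))
    {u : EuclideanSpace ℂ (m × a)} (hu : ‖u‖ = 1) :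
    ∫ t in x..y, (sesqForm u u ((1 : Matrix m m ℂ) ⊗ₖ M t)).re = D := by
  set L : Matrix a a ℂ →L[ℂ] ℂ := (sesqForm u u).comp (kroneckerCLM m m a a 1) with hL
  have h1 : ∫ t in x..y, L (M t) = L (∫ t in x..y, M t) :=
    L.intervalIntegral_comp_comm (hM.intervalIntegrable _ _)
  have h2 : ∫ t in x..y, Complex.reCLM (L (M t)) = Complex.reCLM (∫ t in x..y, L (M t)) :=
    Complex.reCLM.intervalIntegral_comp_comm ((L.continuous.comp hM).intervalIntegrable _ _)
  have h3 : L (1 : Matrix a a ℂ) = 1 := by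
    simp only [hL, ContinuousLinearMap.comp_apply, kroneckerCLM_apply, Matrix.one_kronecker_one]
    exact sesqForm_one u hu
  rw [h1, hD, map_smul, h3] at h2
  simpa [hL] using h2

/-- Integrating a bounded matrix function against a positive matrix valued density. -/
theorem norm_integral_kronecker_le {φ : ℝ → Matrix m p ℂ} {M : ℝ → Matrix a a ℂ} {x y C D : ℝ}
    (hxy : x ≤ y) (hφ : Continuous φ) (hM : Continuous M) (hpos : ∀ t, (M t).PosSemidef)
    (hC : ∀ t, ‖φ t‖ ≤ C) (hD : ∫ t in x..y, M t = (D : ℂ) • (1 : Matrix a a ℂ)) (hD0 : 0 ≤ D) :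
    ‖∫ t in x..y, φ t ⊗ₖ M t‖ ≤ C * D := by
  have hC0 : 0 ≤ C := (norm_nonneg _).trans (hC 0)
  refine norm_le_of_sesqForm (by positivity) fun u v hu hv => ?_
  have hcont : Continuous fun t => φ t ⊗ₖ M t := hφ.kronecker hM
  rw [← (sesqForm u v).intervalIntegral_comp_comm (hcont.intervalIntegrable _ _)]
  have hcu : Continuous fun t => (sesqForm u u ((1 : Matrix m m ℂ) ⊗ₖ M t)).re :=
    Complex.continuous_re.comp ((sesqForm u u).continuous.comp (continuous_const.kronecker hM))
  have hcv : Continuous fun t => (sesqForm v v ((1 : Matrix p p ℂ) ⊗ₖ M t)).re :=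
    Complex.continuous_re.comp ((sesqForm v v).continuous.comp (continuous_const.kronecker hM))
  -- Both forms on the right integrate to `D`, because the density integrates to `D • 1` and `u`,
  -- `v` are unit vectors. The size of the values of `φ` does not enter.
  calc ‖∫ t in x..y, sesqForm u v (φ t ⊗ₖ M t)‖
      ≤ ∫ t in x..y, C / 2 * ((sesqForm u u ((1 : Matrix m m ℂ) ⊗ₖ M t)).re +
        (sesqForm v v ((1 : Matrix p p ℂ) ⊗ₖ M t)).re) := by
        refine intervalIntegral.norm_integral_le_of_norm_le hxy (ae_of_all _ fun t _ => ?_)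
          ((continuous_const.mul (hcu.add hcv)).intervalIntegrable _ _)
        refine (norm_sesqForm_kronecker_le (hpos t) (φ t) u v).trans ?_
        refine mul_le_mul_of_nonneg_right (by linarith [hC t]) ?_
        obtain ⟨N, hN⟩ := (hpos t).exists_conjTranspose_mul_self
        rw [hN, re_sesqForm_one_kronecker, re_sesqForm_one_kronecker]
        positivity
    _ = C * D := by
        rw [intervalIntegral.integral_const_mul, intervalIntegral.integral_add
          (hcu.intervalIntegrable _ _) (hcv.intervalIntegrable _ _),
          integral_re_sesqForm_one_kronecker hM hD hu, integral_re_sesqForm_one_kronecker hM hD hv]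
        ring

end Norms

/-! ### The value of a matrix-valued function at a matrix, independent of the contour. -/

section FunctionalCalculus

variable {m n p a : Type*} [Fintype m] [Fintype n] [Fintype p] [Fintype a]
  [DecidableEq m] [DecidableEq n] [DecidableEq p] [DecidableEq a]
  {Ω : Set ℂ} {γ : ℝ → ℂ} {A : Matrix a a ℂ}

/-- The value `(2πi)⁻¹ ∮ F(z) ⊗ (z - A)⁻¹ dz` of a matrix function at a matrix. -/
def resolventIntegral (γ : ℝ → ℂ) (A : Matrix a a ℂ) (F : ℂ → Matrix m p ℂ) :
    Matrix (m × a) (p × a) ℂ :=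
  (2 * Real.pi * Complex.I : ℂ)⁻¹ •
    contourIntegral γ fun z => F z ⊗ₖ (z • (1 : Matrix a a ℂ) - A)⁻¹

/-- `X` is the value at `A` of the matrix function `F`, expressed by divisibility of `F ⊗ 1 - X`
by the characteristic matrix of `A`. -/
def HasMatrixValue (Ω : Set ℂ) (A : Matrix a a ℂ) (F : ℂ → Matrix m p ℂ)
    (X : Matrix (m × a) (p × a) ℂ) : Prop :=
  ((1 : Matrix m m ℂ) ⊗ₖ A) * X = X * ((1 : Matrix p p ℂ) ⊗ₖ A) ∧
    ∃ Q : ℂ → Matrix (m × a) (p × a) ℂ, DiffContOnCl ℂ Q Ω ∧ ∀ z ∈ closure Ω,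
      F z ⊗ₖ (1 : Matrix a a ℂ) - X = Q z * ((1 : Matrix p p ℂ) ⊗ₖ (z • (1 : Matrix a a ℂ) - A))

theorem HasMatrixValue.mono {Ω' : Set ℂ} {F : ℂ → Matrix m p ℂ} {X : Matrix (m × a) (p × a) ℂ}
    (h : HasMatrixValue Ω A F X) (hΩ : Ω' ⊆ Ω) : HasMatrixValue Ω' A F X := by
  obtain ⟨h1, Q, hQ, h2⟩ := h
  exact ⟨h1, Q, hQ.mono hΩ, fun z hz => h2 z (closure_mono hΩ hz)⟩

theorem kronecker_eq_mul_one_kronecker (X : Matrix m p ℂ) (Y : Matrix a a ℂ) :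
    X ⊗ₖ Y = (X ⊗ₖ (1 : Matrix a a ℂ)) * ((1 : Matrix p p ℂ) ⊗ₖ Y) := by
  rw [← Matrix.mul_kronecker_mul, Matrix.mul_one, Matrix.one_mul]

theorem one_kronecker_mul_inv {M : Matrix a a ℂ} (hM : M.det ≠ 0) :
    ((1 : Matrix p p ℂ) ⊗ₖ M) * ((1 : Matrix p p ℂ) ⊗ₖ M⁻¹) = 1 := by
  rw [← Matrix.mul_kronecker_mul, Matrix.mul_one,
    Matrix.mul_nonsing_inv _ (isUnit_iff_ne_zero.2 hM), Matrix.one_kronecker_one]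

theorem one_kronecker_inv_mul {M : Matrix a a ℂ} (hM : M.det ≠ 0) :
    ((1 : Matrix p p ℂ) ⊗ₖ M⁻¹) * ((1 : Matrix p p ℂ) ⊗ₖ M) = 1 := by
  rw [← Matrix.mul_kronecker_mul, Matrix.mul_one,
    Matrix.nonsing_inv_mul _ (isUnit_iff_ne_zero.2 hM), Matrix.one_kronecker_one]

/-- With `R` the resolvent, `(F G) ⊗ R = (F ⊗ R) Y + (F ⊗ 1) Q`: divisibility removes the resolvent
from the last term, and `Y` moves past it because it commutes with `A`. The last term is holomorphic
and integrates to zero. -/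
theorem HasMatrixValue.resolventIntegral_mul {F : ℂ → Matrix m n ℂ} {G : ℂ → Matrix n p ℂ}
    {Y : Matrix (n × a) (p × a) ℂ} (hΩ : IsConvexContour Ω γ) (hA : numericalRange A ⊆ Ω)
    (hF : DiffContOnCl ℂ F Ω) (hY : HasMatrixValue Ω A G Y) :
    resolventIntegral γ A (fun z => F z * G z) = resolventIntegral γ A F * Y := by
  obtain ⟨hcomm, Q, hQ, hGQ⟩ := hY
  have hR := hΩ.continuous_resolvent hA
  have hFc := hΩ.continuous_comp hF.continuousOn
  have hpt : ∀ t, (F (γ t) * G (γ t)) ⊗ₖ (γ t • (1 : Matrix a a ℂ) - A)⁻¹ =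
      F (γ t) ⊗ₖ (γ t • (1 : Matrix a a ℂ) - A)⁻¹ * Y +
        (F (γ t) ⊗ₖ (1 : Matrix a a ℂ)) * Q (γ t) := by
    intro t
    have hdet := hΩ.det_ne_zero hA t
    set R := (γ t • (1 : Matrix a a ℂ) - A) with hRdef
    have h1 : (F (γ t) * G (γ t)) ⊗ₖ R⁻¹ = (F (γ t) ⊗ₖ (1 : Matrix a a ℂ)) *
        ((G (γ t) ⊗ₖ (1 : Matrix a a ℂ)) * ((1 : Matrix p p ℂ) ⊗ₖ R⁻¹)) := by
      rw [← kronecker_eq_mul_one_kronecker, ← Matrix.mul_kronecker_mul, Matrix.one_mul]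
    have h2 : G (γ t) ⊗ₖ (1 : Matrix a a ℂ) = Y + Q (γ t) * ((1 : Matrix p p ℂ) ⊗ₖ R) := by
      rw [← hGQ _ (hΩ.mem_closure t)]; abel
    have hcomm' : ((1 : Matrix n n ℂ) ⊗ₖ R) * Y = Y * ((1 : Matrix p p ℂ) ⊗ₖ R) := by
      rw [hRdef, sub_eq_add_neg, Matrix.kronecker_add, Matrix.kronecker_add, Matrix.add_mul,
        Matrix.mul_add, ← neg_one_smul ℂ A, Matrix.kronecker_smul, Matrix.kronecker_smul,
        Matrix.kronecker_smul, Matrix.kronecker_smul, Matrix.one_kronecker_one,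
        Matrix.one_kronecker_one, Matrix.smul_mul, Matrix.smul_mul, Matrix.mul_smul,
        Matrix.mul_smul, hcomm, Matrix.one_mul, Matrix.mul_one]
    have hcomm2 : Y * ((1 : Matrix p p ℂ) ⊗ₖ R⁻¹) = ((1 : Matrix n n ℂ) ⊗ₖ R⁻¹) * Y := by
      calc Y * ((1 : Matrix p p ℂ) ⊗ₖ R⁻¹)
          = ((1 : Matrix n n ℂ) ⊗ₖ R⁻¹) * (((1 : Matrix n n ℂ) ⊗ₖ R) * Y) *
            ((1 : Matrix p p ℂ) ⊗ₖ R⁻¹) := by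
              rw [← Matrix.mul_assoc, one_kronecker_inv_mul hdet, Matrix.one_mul]
        _ = _ := by
              rw [hcomm', Matrix.mul_assoc, Matrix.mul_assoc, one_kronecker_mul_inv hdet,
                Matrix.mul_one]
    rw [h1, h2, Matrix.add_mul, Matrix.mul_assoc (Q _), one_kronecker_mul_inv hdet, Matrix.mul_one,
      Matrix.mul_add, hcomm2, ← Matrix.mul_assoc, ← kronecker_eq_mul_one_kronecker]
  rw [resolventIntegral, contourIntegral_congr
    (g := fun z => F z ⊗ₖ (z • (1 : Matrix a a ℂ) - A)⁻¹ * Y + (F z ⊗ₖ (1 : Matrix a a ℂ)) * Q z) hpt,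
    contourIntegral_add hΩ.contDiff]
  · have h0 : contourIntegral γ (fun z => (F z ⊗ₖ (1 : Matrix a a ℂ)) * Q z) = 0 :=
      hΩ.integral_eq_zero ((hF.kronecker diffContOnCl_const).matrix_mul hQ)
    rw [h0, add_zero, resolventIntegral, Matrix.smul_mul]
    congr 1
    exact ((matrixMulCLM (m × a) (n × a) (p × a)).flip Y).contourIntegral_comp hΩ.contDiff
      (f := fun z => F z ⊗ₖ (z • (1 : Matrix a a ℂ) - A)⁻¹) (hFc.kronecker hR)
  · exact (hFc.kronecker hR).matrix_mul continuous_const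
  · exact (hFc.kronecker continuous_const).matrix_mul (hΩ.continuous_comp hQ.continuousOn)

theorem resolventIntegral_const (hΩ : IsConvexContour Ω γ) (hA : numericalRange A ⊆ Ω)
    (X : Matrix m p ℂ) :
    resolventIntegral γ A (fun _ => X) = X ⊗ₖ (1 : Matrix a a ℂ) := by
  rw [resolventIntegral]
  have := (kroneckerCLM m p a a X).contourIntegral_comp hΩ.contDiff (hΩ.continuous_resolvent hA)
    (f := fun z => (z • (1 : Matrix a a ℂ) - A)⁻¹)
  simp only [kroneckerCLM_apply] at this
  rw [this, hΩ.integral_resolvent hA, Matrix.kronecker_smul, smul_smul, inv_mul_cancel₀, one_smul]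
  simp [Real.pi_ne_zero]

/-- The case `F = 1` of multiplicativity. Since `Y` does not refer to `γ`, the integral is the same
for all admissible contours. -/
theorem HasMatrixValue.resolventIntegral_eq {G : ℂ → Matrix m p ℂ} {Y : Matrix (m × a) (p × a) ℂ}
    (hY : HasMatrixValue Ω A G Y) (hΩ : IsConvexContour Ω γ) (hA : numericalRange A ⊆ Ω) :
    resolventIntegral γ A G = Y := by
  have := hY.resolventIntegral_mul hΩ hA (F := fun _ => (1 : Matrix m m ℂ)) diffContOnCl_const
  rw [resolventIntegral_const hΩ hA, Matrix.one_kronecker_one, Matrix.one_mul] at this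
  simpa using this

/-- Newton interpolation with nodes `s`. For a new node `w`, replace `H` by `H w + (z - w) • dslope
H w z` and split `z - w = (z - A) + (A - w)`: the first part goes into the quotient `Q`, the second
adds a factor to the polynomial in `A`. -/
theorem exists_newton_remainder (ho : IsOpen Ω) (A : Matrix a a ℂ) {F : ℂ → Matrix m p ℂ}
    (hF : DiffContOnCl ℂ F Ω) (s : Multiset ℂ) (hs : ∀ w ∈ s, w ∈ Ω) :
    ∃ X : Matrix (m × a) (p × a) ℂ, ∃ Q : ℂ → Matrix (m × a) (p × a) ℂ, ∃ H : ℂ → Matrix m p ℂ,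
      ((1 : Matrix m m ℂ) ⊗ₖ A) * X = X * ((1 : Matrix p p ℂ) ⊗ₖ A) ∧
      DiffContOnCl ℂ Q Ω ∧ DiffContOnCl ℂ H Ω ∧ ∀ z ∈ closure Ω,
        F z ⊗ₖ (1 : Matrix a a ℂ) - X =
          Q z * ((1 : Matrix p p ℂ) ⊗ₖ (z • (1 : Matrix a a ℂ) - A)) +
            H z ⊗ₖ Polynomial.aeval A (s.map fun w => Polynomial.X - Polynomial.C w).prod := by
  induction s using Multiset.induction_on with
  | empty =>
    refine ⟨0, 0, F, by simp, diffContOnCl_const, hF, fun z hz => by simp⟩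
  | cons w s ih =>
    obtain ⟨X, Q, H, hX, hQ, hH, h⟩ := ih fun v hv => hs v (Multiset.mem_cons_of_mem hv)
    have hw := hs w (Multiset.mem_cons_self w s)
    set P := (s.map fun w => Polynomial.X - Polynomial.C w).prod with hP
    set N := Polynomial.aeval A P with hN
    have hNA : A * N = N * A := by
      have := congrArg (Polynomial.aeval A) (mul_comm Polynomial.X P)
      rwa [map_mul, map_mul, Polynomial.aeval_X] at this
    have hH' := IsConvexContour.diffContOnCl_dslope ho hH hw
    refine ⟨X + H w ⊗ₖ N, fun z => Q z + dslope H w z ⊗ₖ N, dslope H w, ?_,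
      hQ.add (hH'.kronecker diffContOnCl_const), hH', fun z hz => ?_⟩
    · rw [Matrix.mul_add, Matrix.add_mul, hX, ← Matrix.mul_kronecker_mul,
        ← Matrix.mul_kronecker_mul, Matrix.one_mul, Matrix.mul_one, hNA]
    · have hstep : H z = H w + (z - w) • dslope H w z := by
        rw [sub_smul_dslope]; abel
      have hN' : Polynomial.aeval A ((w ::ₘ s).map fun w => Polynomial.X - Polynomial.C w).prod =
          N * (A - w • (1 : Matrix a a ℂ)) := by
        rw [Multiset.map_cons, Multiset.prod_cons, mul_comm, map_mul, map_sub, Polynomial.aeval_X,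
          Polynomial.aeval_C, Algebra.algebraMap_eq_smul_one]
      have hsplit : (z - w) • N = N * (z • (1 : Matrix a a ℂ) - A) +
          N * (A - w • (1 : Matrix a a ℂ)) := by
        rw [← mul_add, sub_add_sub_cancel, ← sub_smul, mul_smul_comm, mul_one]
      have e1 : H z ⊗ₖ N = H w ⊗ₖ N + dslope H w z ⊗ₖ ((z - w) • N) := by
        rw [hstep, Matrix.add_kronecker, Matrix.smul_kronecker, Matrix.kronecker_smul]
      rw [← sub_sub, h z hz, e1, hsplit, hN', Matrix.kronecker_add, Matrix.add_mul,
        ← Matrix.mul_kronecker_mul, Matrix.mul_one]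
      abel

/-- Take the eigenvalues with multiplicity as nodes; they lie in `W(A) ⊆ Ω`. By Cayley–Hamilton the
remainder vanishes. -/
theorem exists_hasMatrixValue (ho : IsOpen Ω) (hA : numericalRange A ⊆ Ω) {F : ℂ → Matrix m p ℂ}
    (hF : DiffContOnCl ℂ F Ω) : ∃ X, HasMatrixValue Ω A F X := by
  obtain ⟨X, Q, H, hX, hQ, -, h⟩ := exists_newton_remainder ho A hF A.charpoly.roots
    fun w hw => hA (isRoot_charpoly_mem (Polynomial.isRoot_of_mem_roots hw))
  refine ⟨X, hX, Q, hQ, fun z hz => ?_⟩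
  rw [h z hz, ← (IsAlgClosed.splits A.charpoly).eq_prod_roots_of_monic A.charpoly_monic,
    Matrix.aeval_self_charpoly, Matrix.kronecker_zero, add_zero]

end FunctionalCalculus

/-! ### Convex domains given by a smooth support function. -/

section SupportCurve

open Complex (I exp)

/-- The unit vector `e^{iφ}`. -/
def unitVec (φ : ℝ) : ℂ := exp (φ * I)

theorem unitVec_ne_zero (φ : ℝ) : unitVec φ ≠ 0 := Complex.exp_ne_zero _

theorem unitVec_add (φ ψ : ℝ) : unitVec (φ + ψ) = unitVec φ * unitVec ψ := by
  rw [unitVec, unitVec, unitVec, ← Complex.exp_add]; push_cast; ring_nf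

@[simp] theorem unitVec_zero : unitVec 0 = 1 := by simp [unitVec]

theorem unitVec_neg_mul (φ : ℝ) : unitVec (-φ) * unitVec φ = 1 := by
  rw [← unitVec_add]; simp

theorem unitVec_two_pi : unitVec (2 * Real.pi) = 1 := by
  rw [unitVec]; push_cast; exact Complex.exp_two_pi_mul_I

theorem unitVec_periodic (φ : ℝ) : unitVec (φ + 2 * Real.pi) = unitVec φ := by
  rw [unitVec_add, unitVec_two_pi, mul_one]

theorem unitVec_neg_periodic (φ : ℝ) : unitVec (-(φ + 2 * Real.pi)) = unitVec (-φ) := by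
  rw [← unitVec_periodic (-(φ + 2 * Real.pi))]; congr 1; ring

theorem continuous_unitVec : Continuous unitVec := by unfold unitVec; fun_prop

theorem hasDerivAt_unitVec (φ : ℝ) : HasDerivAt unitVec (I * unitVec φ) φ := by
  have h1 : HasDerivAt (fun t : ℝ => (t : ℂ) * I) (1 * I) φ :=
    (Complex.ofRealCLM.hasDerivAt (x := φ)).mul_const I
  exact h1.cexp.congr_deriv (by rw [unitVec]; ring)

theorem hasDerivAt_unitVec_neg (φ : ℝ) :
    HasDerivAt (fun t => unitVec (-t)) (-I * unitVec (-φ)) φ := by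
  exact ((hasDerivAt_unitVec (-φ)).scomp φ (hasDerivAt_neg φ)).congr_deriv (by simp)

theorem unitVec_re (φ : ℝ) : (unitVec φ).re = Real.cos φ := Complex.exp_ofReal_mul_I_re φ

theorem unitVec_im (φ : ℝ) : (unitVec φ).im = Real.sin φ := Complex.exp_ofReal_mul_I_im φ

theorem conj_unitVec (φ : ℝ) : (starRingEnd ℂ) (unitVec φ) = unitVec (-φ) := by
  rw [unitVec, unitVec, ← Complex.exp_conj]; simp

/-- The component of `z` in the direction `e^{iφ}`. -/
def dirRe (φ : ℝ) (z : ℂ) : ℝ := (unitVec (-φ) * z).re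

theorem dirRe_periodic (φ : ℝ) (z : ℂ) : dirRe (φ + 2 * Real.pi) z = dirRe φ z := by
  rw [dirRe, unitVec_neg_periodic, dirRe]

theorem dirRe_sub (φ : ℝ) (z w : ℂ) : dirRe φ (z - w) = dirRe φ z - dirRe φ w := by
  simp [dirRe, mul_sub]

theorem dirRe_add (φ : ℝ) (z w : ℂ) : dirRe φ (z + w) = dirRe φ z + dirRe φ w := by
  simp [dirRe, mul_add]

theorem dirRe_smul (φ : ℝ) (r : ℝ) (z : ℂ) : dirRe φ (r * z) = r * dirRe φ z := by
  rw [dirRe, mul_left_comm, Complex.re_ofReal_mul, dirRe]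

theorem continuous_dirRe : Continuous fun q : ℂ × ℝ => dirRe q.2 q.1 :=
  Complex.continuous_re.comp
    ((continuous_unitVec.comp (continuous_neg.comp continuous_snd)).mul continuous_fst)

/-- A smooth support function `h` with derivative `h₁` and radius of curvature `ρ = h + h''`. -/
structure IsSupportFunction (h h₁ ρ : ℝ → ℝ) : Prop where
  deriv₁ : ∀ t, HasDerivAt h (h₁ t) t
  deriv₂ : ∀ t, HasDerivAt h₁ (ρ t - h t) t
  continuous : Continuous ρ
  pos : ∀ t, 0 < ρ t
  periodic : ∀ t, h (t + 2 * Real.pi) = h t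

/-- The curve with support function `h`. -/
def supportCurve (h h₁ : ℝ → ℝ) (t : ℝ) : ℂ := unitVec t * (h t + I * h₁ t)

/-- The convex domain with support function `h`. -/
def supportDomain (h : ℝ → ℝ) : Set ℂ := {z | ∀ φ, dirRe φ z < h φ}

variable {h h₁ ρ : ℝ → ℝ}

namespace IsSupportFunction

theorem continuous_h (H : IsSupportFunction h h₁ ρ) : Continuous h :=
  continuous_iff_continuousAt.2 fun t => (H.deriv₁ t).continuousAt

theorem periodic₁ (H : IsSupportFunction h h₁ ρ) (t : ℝ) : h₁ (t + 2 * Real.pi) = h₁ t := by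
  have h1 := (H.deriv₁ (t + 2 * Real.pi)).comp_add_const t (2 * Real.pi)
  simp only [H.periodic] at h1
  exact h1.unique (H.deriv₁ t)

theorem curve_periodic (H : IsSupportFunction h h₁ ρ) (t : ℝ) :
    supportCurve h h₁ (t + 2 * Real.pi) = supportCurve h h₁ t := by
  rw [supportCurve, unitVec_periodic, H.periodic, H.periodic₁, supportCurve]

/-- The parameter `t` is the angle of the outer normal, so the tangent direction is `i e^{it}` and
the speed is the radius of curvature. -/
theorem hasDerivAt_curve (H : IsSupportFunction h h₁ ρ) (t : ℝ) :
    HasDerivAt (supportCurve h h₁) (I * unitVec t * ρ t) t := by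
  have h1 := (H.deriv₁ t).ofReal_comp
  have h2 := (H.deriv₂ t).ofReal_comp.const_mul I
  refine ((hasDerivAt_unitVec t).mul (h1.add h2)).congr_deriv ?_
  simp only [Pi.add_apply]
  push_cast
  linear_combination (unitVec t * (h₁ t : ℂ)) * Complex.I_mul_I

theorem deriv_curve (H : IsSupportFunction h h₁ ρ) (t : ℝ) :
    deriv (supportCurve h h₁) t = I * unitVec t * ρ t := (H.hasDerivAt_curve t).deriv

theorem contDiff_curve (H : IsSupportFunction h h₁ ρ) : ContDiff ℝ 1 (supportCurve h h₁) := by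
  rw [contDiff_one_iff_deriv]
  refine ⟨fun t => (H.hasDerivAt_curve t).differentiableAt, ?_⟩
  have : deriv (supportCurve h h₁) = fun t => I * unitVec t * ρ t := funext H.deriv_curve
  rw [this]
  exact (continuous_const.mul continuous_unitVec).mul (Complex.continuous_ofReal.comp H.continuous)

theorem continuous_curve (H : IsSupportFunction h h₁ ρ) : Continuous (supportCurve h h₁) :=
  H.contDiff_curve.continuous

theorem dirRe_curve_self (h h₁ : ℝ → ℝ) (t : ℝ) : dirRe t (supportCurve h h₁ t) = h t := by
  rw [dirRe, supportCurve, ← mul_assoc, unitVec_neg_mul]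
  simp

/-- The component in direction `φ` has derivative `-sin s · ρ(φ + s)` along the curve. It increases
strictly on `[-π, 0]` and decreases strictly on `[0, π]`, with maximum `h φ` at `s = 0`. -/
theorem dirRe_curve_lt (H : IsSupportFunction h h₁ ρ) (φ : ℝ) {s : ℝ} (hs0 : s ≠ 0)
    (hs : s ∈ Icc (-Real.pi) Real.pi) : dirRe φ (supportCurve h h₁ (φ + s)) < h φ := by
  have hd : ∀ s, HasDerivAt (fun s => dirRe φ (supportCurve h h₁ (φ + s)))
      (-(Real.sin s * ρ (φ + s))) s := fun s => by
    have h1 := ((H.hasDerivAt_curve (φ + s)).comp_const_add φ s).const_mul (unitVec (-φ))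
    have h2 := Complex.reCLM.hasFDerivAt.comp_hasDerivAt s h1
    refine h2.congr_deriv ?_
    have : unitVec (-φ) * (I * unitVec (φ + s) * ρ (φ + s)) = (ρ (φ + s) : ℝ) * (I * unitVec s) := by
      rw [unitVec_add]; linear_combination (I * unitVec s * ρ (φ + s)) * unitVec_neg_mul φ
    rw [this]
    simp only [Complex.reCLM_apply, Complex.re_ofReal_mul, Complex.I_mul_re, unitVec_im]
    ring
  have h0 : dirRe φ (supportCurve h h₁ (φ + 0)) = h φ := by
    rw [add_zero]; exact dirRe_curve_self h h₁ φ
  have hcont : Continuous fun s => dirRe φ (supportCurve h h₁ (φ + s)) :=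
    continuous_iff_continuousAt.2 fun s => (hd s).continuousAt
  rw [← h0]
  rcases lt_or_gt_of_ne hs0 with hneg | hpos
  · refine strictMonoOn_of_deriv_pos (convex_Icc (-Real.pi) 0) hcont.continuousOn
      (fun x hx => ?_) ⟨hs.1, hneg.le⟩ ⟨by linarith [Real.pi_pos], le_rfl⟩ hneg
    rw [interior_Icc] at hx
    rw [(hd x).deriv, ← neg_mul]
    exact mul_pos (by linarith [Real.sin_neg_of_neg_of_neg_pi_lt hx.2 hx.1]) (H.pos _)
  · refine strictAntiOn_of_deriv_neg (convex_Icc 0 Real.pi) hcont.continuousOn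
      (fun x hx => ?_) ⟨le_rfl, Real.pi_pos.le⟩ ⟨hpos.le, hs.2⟩ hpos
    rw [interior_Icc] at hx
    rw [(hd x).deriv, neg_lt_zero]
    exact mul_pos (Real.sin_pos_of_mem_Ioo hx) (H.pos _)

theorem dirRe_curve_le (H : IsSupportFunction h h₁ ρ) (φ θ : ℝ) :
    dirRe φ (supportCurve h h₁ θ) ≤ h φ := by
  have hper : Function.Periodic (fun θ => supportCurve h h₁ θ) (2 * Real.pi) := H.curve_periodic
  obtain ⟨y, hy, hy'⟩ := hper.exists_mem_Ico Real.two_pi_pos θ (φ - Real.pi)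
  rw [hy']
  have hmem : y - φ ∈ Icc (-Real.pi) Real.pi := ⟨by linarith [hy.1], by linarith [hy.2]⟩
  by_cases h0 : y - φ = 0
  · rw [sub_eq_zero.1 h0, dirRe_curve_self]
  · have := (H.dirRe_curve_lt φ h0 hmem).le
    rwa [add_sub_cancel] at this

/-- Periodicity leaves a compact set of directions, and a strict inequality over a compact set is
stable. -/
theorem isOpen_domain (H : IsSupportFunction h h₁ ρ) : IsOpen (supportDomain h) := by
  have heq : supportDomain h = {z | ∀ φ ∈ Icc 0 (2 * Real.pi), dirRe φ z < h φ} := by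
    ext z
    refine ⟨fun hz φ _ => hz φ, fun hz φ => ?_⟩
    have hper : Function.Periodic (fun φ => h φ - dirRe φ z) (2 * Real.pi) := fun φ => by
      simp only [H.periodic, dirRe_periodic]
    obtain ⟨y, hy, hy'⟩ := hper.exists_mem_Ico₀ Real.two_pi_pos φ
    have := hz y (Ico_subset_Icc_self hy)
    linarith
  rw [heq, isOpen_iff_mem_nhds]
  intro z hz
  refine isCompact_Icc.eventually_forall_of_forall_eventually
    (P := fun z φ => dirRe φ z < h φ) fun φ hφ => ?_
  exact (isOpen_lt continuous_dirRe (H.continuous_h.comp continuous_snd)).mem_nhds (hz φ hφ)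

theorem convex_domain (h : ℝ → ℝ) : Convex ℝ (supportDomain h) := by
  intro x hx y hy a b ha hb hab φ
  simp only [Complex.real_smul, dirRe_add, dirRe_smul]
  have h1 := hx φ
  have h2 := hy φ
  rcases ha.lt_or_eq with ha | rfl
  · have h3 : h φ = a * h φ + b * h φ := by rw [← add_mul, hab, one_mul]
    nlinarith [mul_lt_mul_of_pos_left h1 ha, mul_le_mul_of_nonneg_left h2.le hb]
  · have : b = 1 := by linarith
    subst this; linarith

theorem dirRe_le_of_mem_closure (h : ℝ → ℝ) {z : ℂ} (hz : z ∈ closure (supportDomain h)) (φ : ℝ) :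
    dirRe φ z ≤ h φ := by
  have hcl : IsClosed {z | dirRe φ z ≤ h φ} :=
    isClosed_le (continuous_dirRe.comp (continuous_id.prodMk continuous_const)) continuous_const
  exact closure_minimal (fun w hw => (hw φ).le) hcl hz

theorem mem_closure_of_dirRe_le {c : ℂ} (hc : c ∈ supportDomain h) {z : ℂ}
    (hz : ∀ φ, dirRe φ z ≤ h φ) : z ∈ closure (supportDomain h) := by
  have hlim : Tendsto (fun r : ℝ => dilate c r z) (𝓝[<] 1) (𝓝 z) := by
    have : Continuous fun r : ℝ => dilate c r z :=
      (continuous_dilate c).comp (continuous_id.prodMk continuous_const)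
    have h1 := (this.tendsto 1).mono_left (nhdsWithin_le_nhds (s := Iio 1))
    simpa using h1
  refine mem_closure_of_tendsto hlim ?_
  have hpos : ∀ᶠ r : ℝ in 𝓝[<] 1, 0 ≤ r :=
    nhdsWithin_le_nhds ((eventually_gt_nhds (zero_lt_one' ℝ)).mono fun r hr => hr.le)
  filter_upwards [self_mem_nhdsWithin, hpos] with r hr hr0
  intro φ
  have : dilate c r z = ((1 - r : ℝ) : ℂ) * c + (r : ℂ) * z := by
    simp only [dilate]; push_cast; ring
  rw [this, dirRe_add, dirRe_smul, dirRe_smul]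
  have h1 := hc φ
  have h2 := hz φ
  have hr' : r < 1 := hr
  nlinarith

theorem isBounded_domain (H : IsSupportFunction h h₁ ρ) :
    Bornology.IsBounded (supportDomain h) := by
  obtain ⟨C, hC⟩ := (isCompact_Icc (a := -Real.pi) (b := Real.pi)).exists_bound_of_continuousOn
    H.continuous_h.continuousOn
  refine (Metric.isBounded_iff_subset_closedBall 0).2 ⟨C, fun z hz => ?_⟩
  rw [mem_closedBall_zero_iff]
  have h1 := hz z.arg
  have h2 : dirRe z.arg z = ‖z‖ := by
    have : z = ‖z‖ * unitVec z.arg := (Complex.norm_mul_exp_arg_mul_I z).symm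
    rw [dirRe]
    nth_rewrite 2 [this]
    rw [mul_left_comm, unitVec_neg_mul]
    simp
  have h3 := hC z.arg ⟨(Complex.neg_pi_lt_arg z).le, Complex.arg_le_pi z⟩
  rw [← h2]
  exact h1.le.trans ((le_abs_self _).trans h3)

theorem notMem_domain (h h₁ : ℝ → ℝ) (t : ℝ) : supportCurve h h₁ t ∉ supportDomain h := fun ht => by
  have := ht t
  rw [dirRe_curve_self] at this
  exact lt_irrefl _ this

theorem curve_mem_frontier (H : IsSupportFunction h h₁ ρ) (hne : (supportDomain h).Nonempty)
    (t : ℝ) : supportCurve h h₁ t ∈ frontier (supportDomain h) := by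
  obtain ⟨c, hc⟩ := hne
  rw [frontier, H.isOpen_domain.interior_eq]
  exact ⟨mem_closure_of_dirRe_le hc fun φ => H.dirRe_curve_le φ t, notMem_domain h h₁ t⟩

/-- At a boundary point the nonnegative function `ψ ↦ h ψ - dirRe ψ z` vanishes for some `φ`. The
first-order condition at this minimum fixes the tangential component as `h₁ φ`, which identifies the
point. -/
theorem exists_curve_eq (H : IsSupportFunction h h₁ ρ) {z : ℂ}
    (hz : z ∈ frontier (supportDomain h)) : ∃ t, z = supportCurve h h₁ t := by
  rw [frontier, H.isOpen_domain.interior_eq] at hz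
  have hle := dirRe_le_of_mem_closure h hz.1
  obtain ⟨φ, hφ⟩ : ∃ φ, h φ ≤ dirRe φ z := by
    by_contra! hcon
    exact hz.2 hcon
  have heq : dirRe φ z = h φ := le_antisymm (hle φ) hφ
  have hd : HasDerivAt (fun ψ => h ψ - dirRe ψ z) (h₁ φ - (unitVec (-φ) * z).im) φ := by
    refine (H.deriv₁ φ).sub ?_
    have h1 := (hasDerivAt_unitVec_neg φ).mul_const z
    have h2 := Complex.reCLM.hasFDerivAt.comp_hasDerivAt φ h1
    refine h2.congr_deriv ?_
    rw [mul_assoc, neg_mul]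
    simp
  have hmin : IsLocalMin (fun ψ => h ψ - dirRe ψ z) φ :=
    Eventually.of_forall fun ψ => by
      simp only [heq, sub_self]; linarith [hle ψ]
  have h0 := hmin.hasDerivAt_eq_zero hd
  refine ⟨φ, ?_⟩
  have : unitVec (-φ) * z = h φ + I * h₁ φ := by
    apply Complex.ext
    · rw [show (unitVec (-φ) * z).re = dirRe φ z from rfl, heq]; simp
    · have : (unitVec (-φ) * z).im = h₁ φ := by linarith
      rw [this]; simp
  rw [supportCurve, ← this, ← mul_assoc, mul_comm (unitVec φ), unitVec_neg_mul, one_mul]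

/-- A branch of the logarithm of `supportCurve θ - z`. -/
def logCurve (h h₁ : ℝ → ℝ) (z : ℂ) (θ : ℝ) : ℂ :=
  θ * I + Complex.log (unitVec (-θ) * (supportCurve h h₁ θ - z))

theorem re_unitVec_neg_mul_curve_sub (h h₁ : ℝ → ℝ) (z : ℂ) (θ : ℝ) :
    (unitVec (-θ) * (supportCurve h h₁ θ - z)).re = h θ - dirRe θ z := by
  have : (unitVec (-θ) * (supportCurve h h₁ θ - z)).re = dirRe θ (supportCurve h h₁ θ - z) := rfl
  rw [this, dirRe_sub, dirRe_curve_self]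

/-- Rotating by the normal angle puts `supportCurve θ - z` in the right half-plane, its real part
being `h θ - dirRe θ z`. Hence the principal logarithm is smooth there and the term `θ I` carries
the whole winding. -/
theorem hasDerivAt_logCurve (H : IsSupportFunction h h₁ ρ) {z : ℂ} {θ : ℝ} (hz : dirRe θ z < h θ) :
    HasDerivAt (logCurve h h₁ z)
      (deriv (supportCurve h h₁) θ * (supportCurve h h₁ θ - z)⁻¹) θ := by
  have hre : 0 < (unitVec (-θ) * (supportCurve h h₁ θ - z)).re := by
    rw [re_unitVec_neg_mul_curve_sub]; linarith
  have hne : supportCurve h h₁ θ - z ≠ 0 := fun h0 => by simp [h0] at hre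
  have h1 : HasDerivAt (fun t : ℝ => (t : ℂ) * I) (1 * I) θ :=
    (Complex.ofRealCLM.hasDerivAt (x := θ)).mul_const I
  have h2 := ((hasDerivAt_unitVec_neg θ).mul
    ((H.hasDerivAt_curve θ).sub_const z)).clog_real (Complex.mem_slitPlane_iff.2 (Or.inl hre))
  refine (h1.add h2).congr_deriv ?_
  rw [H.deriv_curve]
  have := unitVec_ne_zero (-θ)
  simp only [Pi.mul_apply]
  field_simp
  ring

theorem integral_inv_curve_sub (H : IsSupportFunction h h₁ ρ) {z : ℂ} (hz : z ∈ supportDomain h)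
    (x y : ℝ) :
    ∫ θ in x..y, deriv (supportCurve h h₁) θ * (supportCurve h h₁ θ - z)⁻¹ =
      logCurve h h₁ z y - logCurve h h₁ z x := by
  refine intervalIntegral.integral_eq_sub_of_hasDerivAt
    (fun θ _ => H.hasDerivAt_logCurve (hz θ)) (Continuous.intervalIntegrable ?_ _ _)
  refine (H.contDiff_curve.continuous_deriv le_rfl).mul
    ((H.continuous_curve.sub continuous_const).inv₀ fun θ h0 => ?_)
  exact notMem_domain h h₁ θ (sub_eq_zero.1 h0 ▸ hz)

theorem isConvexContour (H : IsSupportFunction h h₁ ρ) (hne : (supportDomain h).Nonempty) :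
    IsConvexContour (supportDomain h) (supportCurve h h₁) where
  isOpen := H.isOpen_domain
  isBounded := H.isBounded_domain
  convex := convex_domain h
  contDiff := H.contDiff_curve
  closed := by simpa using H.curve_periodic 0
  mem_frontier := H.curve_mem_frontier hne
  winding w hw := by
    have h1 := H.integral_inv_curve_sub hw 0 (2 * Real.pi)
    simp only [contourIntegral, smul_eq_mul]
    rw [h1]
    -- Over a period the logarithm returns to its value, and only `2π I` from the linear term
    -- survives.
    have h2 := unitVec_neg_periodic 0
    have h3 := H.curve_periodic 0
    rw [zero_add] at h2 h3
    simp only [logCurve, h2, h3]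
    push_cast
    ring

/-- The kernel of the double layer potential is positive. -/
theorem im_deriv_mul_inv_pos (H : IsSupportFunction h h₁ ρ) {z : ℂ} (hz : z ∈ supportDomain h)
    (θ : ℝ) : 0 < (deriv (supportCurve h h₁) θ * (supportCurve h h₁ θ - z)⁻¹).im := by
  have hre : 0 < (unitVec (-θ) * (supportCurve h h₁ θ - z)).re := by
    rw [re_unitVec_neg_mul_curve_sub]; linarith [hz θ]
  set q := unitVec (-θ) * (supportCurve h h₁ θ - z) with hq
  have hq0 : q ≠ 0 := fun h0 => by simp [h0] at hre
  have : deriv (supportCurve h h₁) θ * (supportCurve h h₁ θ - z)⁻¹ = (ρ θ : ℝ) * (I * q⁻¹) := by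
    rw [H.deriv_curve, hq, mul_inv]
    have : (unitVec (-θ))⁻¹ = unitVec θ := inv_eq_of_mul_eq_one_right (unitVec_neg_mul θ)
    rw [this]; ring
  rw [this, Complex.im_ofReal_mul, Complex.I_mul_im, Complex.inv_re]
  exact mul_pos (H.pos θ) (div_pos hre (Complex.normSq_pos.2 hq0))

end IsSupportFunction

end SupportCurve

/-! ### The Cauchy transform of the adjoint boundary values and its bound near the boundary. -/

section ConjugateCauchy

variable {m p : Type*} [Fintype m] [Fintype p] [DecidableEq m] [DecidableEq p]

/-- The conjugate transpose as a continuous real linear map. -/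
def conjTransposeCLM (m p : Type*) [Fintype m] [Fintype p] [DecidableEq m] [DecidableEq p] :
    Matrix m p ℂ →L[ℝ] Matrix p m ℂ :=
  LinearMap.mkContinuous
    { toFun := fun X => Xᴴ
      map_add' := Matrix.conjTranspose_add
      map_smul' := fun r X => by ext; simp } 1
    fun X => by simp [Matrix.l2_opNorm_conjTranspose]

@[simp] theorem conjTransposeCLM_apply (X : Matrix m p ℂ) : conjTransposeCLM m p X = Xᴴ := rfl

theorem Continuous.matrix_conjTranspose' {X : Type*} [TopologicalSpace X] {f : X → Matrix m p ℂ}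
    (hf : Continuous f) : Continuous fun x => (f x)ᴴ :=
  (conjTransposeCLM m p).continuous.comp hf

/-- The Cauchy transform of the conjugate transpose of the boundary values of `F`. -/
def conjCauchy (γ : ℝ → ℂ) (F : ℂ → Matrix m p ℂ) (z : ℂ) : Matrix p m ℂ :=
  (2 * Real.pi * Complex.I : ℂ)⁻¹ •
    ∫ t in (0 : ℝ)..(2 * Real.pi), (γ t - z)⁻¹ • (deriv γ t • (F (γ t))ᴴ)

/-- The kernel of the double layer potential. -/
def doubleLayer (γ : ℝ → ℂ) (z : ℂ) (t : ℝ) : ℝ := (deriv γ t * (γ t - z)⁻¹).im / Real.pi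

/-- Division by `π` rather than `2π` makes this kernel twice the real part of the Cauchy kernel; its
total mass is therefore `2`. -/
theorem doubleLayer_eq (γ : ℝ → ℂ) (z : ℂ) (t : ℝ) :
    ((doubleLayer γ z t : ℝ) : ℂ) =
      (2 * Real.pi * Complex.I : ℂ)⁻¹ * (deriv γ t * (γ t - z)⁻¹) +
        (starRingEnd ℂ) ((2 * Real.pi * Complex.I : ℂ)⁻¹ * (deriv γ t * (γ t - z)⁻¹)) := by
  rw [Complex.add_conj, doubleLayer]
  set k := deriv γ t * (γ t - z)⁻¹
  have hpi : (Real.pi : ℂ) ≠ 0 := by exact_mod_cast Real.pi_ne_zero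
  have : (2 * Real.pi * Complex.I : ℂ)⁻¹ * k = ((1 / (2 * Real.pi) : ℝ) : ℂ) * (-Complex.I * k) := by
    rw [mul_inv, Complex.inv_I]; push_cast; field_simp
  rw [this, Complex.re_ofReal_mul]
  have h2 : (-Complex.I * k).re = k.im := by simp
  rw [h2]
  push_cast
  field_simp

namespace IsConvexContour

variable {Ω : Set ℂ} {γ : ℝ → ℂ}

theorem continuous_doubleLayer (hΩ : IsConvexContour Ω γ) {z : ℂ} (hz : z ∈ Ω) :
    Continuous (doubleLayer γ z) := by
  refine Continuous.div_const (Complex.continuous_im.comp (hΩ.continuous_deriv.mul ?_)) _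
  exact (hΩ.continuous.sub continuous_const).inv₀ fun t => hΩ.sub_ne_zero t hz

/-- Adding the adjoint of Cauchy's formula for `F z` turns the Cauchy kernel into the real double
layer kernel. -/
theorem conjCauchy_eq (hΩ : IsConvexContour Ω γ) {F : ℂ → Matrix m p ℂ} (hF : DiffContOnCl ℂ F Ω)
    {z : ℂ} (hz : z ∈ Ω) :
    conjCauchy γ F z =
      (∫ t in (0 : ℝ)..(2 * Real.pi), doubleLayer γ z t • (F (γ t))ᴴ) - (F z)ᴴ := by
  have hFc := hΩ.continuous_comp hF.continuousOn
  have hinv : Continuous fun t => (γ t - z)⁻¹ :=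
    (hΩ.continuous.sub continuous_const).inv₀ fun t => hΩ.sub_ne_zero t hz
  have h1 : F z = ∫ t in (0 : ℝ)..(2 * Real.pi),
      ((2 * Real.pi * Complex.I : ℂ)⁻¹ * (deriv γ t * (γ t - z)⁻¹)) • F (γ t) := by
    have := hΩ.integral_formula hF hz
    have h2 : (2 * Real.pi * Complex.I : ℂ) ≠ 0 := by simp [Real.pi_ne_zero]
    rw [← inv_smul_eq_iff₀ h2] at this
    rw [← this, contourIntegral, ← intervalIntegral.integral_smul]
    congr 1
    funext t
    rw [smul_smul, smul_smul, mul_assoc]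
  have hk : Continuous fun t => (2 * Real.pi * Complex.I : ℂ)⁻¹ * (deriv γ t * (γ t - z)⁻¹) :=
    continuous_const.mul (hΩ.continuous_deriv.mul hinv)
  have h2 : (F z)ᴴ = ∫ t in (0 : ℝ)..(2 * Real.pi),
      (starRingEnd ℂ) ((2 * Real.pi * Complex.I : ℂ)⁻¹ * (deriv γ t * (γ t - z)⁻¹)) •
        (F (γ t))ᴴ := by
    rw [← conjTransposeCLM_apply, h1,
      ← (conjTransposeCLM m p).intervalIntegral_comp_comm (Continuous.intervalIntegrable
        (u := fun t => ((2 * Real.pi * Complex.I : ℂ)⁻¹ * (deriv γ t * (γ t - z)⁻¹)) • F (γ t))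
        (hk.smul hFc) _ _)]
    simp only [conjTransposeCLM_apply, Matrix.conjTranspose_smul]
    rfl
  have h3 : conjCauchy γ F z = ∫ t in (0 : ℝ)..(2 * Real.pi),
      ((2 * Real.pi * Complex.I : ℂ)⁻¹ * (deriv γ t * (γ t - z)⁻¹)) • (F (γ t))ᴴ := by
    rw [conjCauchy, ← intervalIntegral.integral_smul]
    congr 1
    funext t
    rw [smul_smul, smul_smul]
    congr 1
    ring
  rw [eq_sub_iff_add_eq, h2, h3, ← intervalIntegral.integral_add]
  · congr 1
    funext t
    rw [← add_smul, ← doubleLayer_eq, Complex.coe_smul]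
  · exact (hk.smul hFc.matrix_conjTranspose').intervalIntegrable _ _
  · exact ((Complex.continuous_conj.comp hk).smul hFc.matrix_conjTranspose').intervalIntegrable _ _

theorem differentiableOn_conjCauchy (hΩ : IsConvexContour Ω γ) {F : ℂ → Matrix m p ℂ}
    (hF : ContinuousOn F (closure Ω)) : DifferentiableOn ℂ (conjCauchy γ F) Ω :=
  (hΩ.differentiableOn_cauchyIntegral
    (k := fun t => deriv γ t • (F (γ t))ᴴ)
    (hΩ.continuous_deriv.smul (hΩ.continuous_comp hF).matrix_conjTranspose')).const_smul
      (2 * Real.pi * Complex.I : ℂ)⁻¹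

/-- `conjCauchy` is controlled only inside `Ω`; composing it with a contraction produces functions
continuous up to the boundary, to which the functional calculus applies. -/
theorem diffContOnCl_comp_dilate {E : Type*} [NormedAddCommGroup E] [NormedSpace ℂ E]
    (ho : IsOpen Ω) (hconv : Convex ℝ Ω) {g : ℂ → E} (hg : DifferentiableOn ℂ g Ω) {c : ℂ}
    (hc : c ∈ Ω) {r : ℝ} (hr : r ∈ Ico (0 : ℝ) 1) : DiffContOnCl ℂ (fun z => g (dilate c r z)) Ω :=
  have hmaps : MapsTo (dilate c r) (closure Ω) Ω := fun _ hz => dilate_mem ho hconv hc hz hr.1 hr.2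
  ⟨hg.comp (differentiable_dilate c r).differentiableOn (hmaps.mono_left subset_closure),
    hg.continuousOn.comp (differentiable_dilate c r).continuous.continuousOn hmaps⟩

end IsConvexContour

theorem arg_add_of_re_nonpos {q : ℂ} {s : ℝ} (hq : 0 < q.re)
    (h : (unitVec s * q).re ≤ 0) : Real.pi / 2 ≤ |s + q.arg| := by
  have harg := Complex.abs_arg_lt_pi_div_two_iff.2 (Or.inl hq)
  have hq0 : 0 < ‖q‖ := norm_pos_iff.2 fun h0 => by simp [h0] at hq
  have hre : (unitVec s * q).re = ‖q‖ * Real.cos (s + q.arg) := by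
    have : q = ‖q‖ * unitVec q.arg := (Complex.norm_mul_exp_arg_mul_I q).symm
    nth_rewrite 1 [this]
    rw [mul_left_comm, ← unitVec_add, Complex.re_ofReal_mul, unitVec_re]
  by_contra! hlt
  rw [hre] at h
  have := Real.cos_pos_of_mem_Ioo (abs_lt.1 hlt)
  nlinarith

namespace IsSupportFunction

variable {h h₁ ρ : ℝ → ℝ}

theorem doubleLayer_pos (H : IsSupportFunction h h₁ ρ) {z : ℂ} (hz : z ∈ supportDomain h) (t : ℝ) :
    0 < doubleLayer (supportCurve h h₁) z t :=
  div_pos (H.im_deriv_mul_inv_pos hz t) Real.pi_pos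

theorem deriv_curve_periodic (H : IsSupportFunction h h₁ ρ) (t : ℝ) :
    deriv (supportCurve h h₁) (t + 2 * Real.pi) = deriv (supportCurve h h₁) t := by
  have h1 := (H.hasDerivAt_curve (t + 2 * Real.pi)).comp_add_const t (2 * Real.pi)
  simp only [H.curve_periodic] at h1
  rw [H.deriv_curve (t + 2 * Real.pi), h1.deriv]

theorem doubleLayer_periodic (H : IsSupportFunction h h₁ ρ) (z : ℂ) :
    Function.Periodic (doubleLayer (supportCurve h h₁) z) (2 * Real.pi) := fun t => by
  rw [doubleLayer, H.curve_periodic, H.deriv_curve_periodic, doubleLayer]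

theorem integral_doubleLayer (H : IsSupportFunction h h₁ ρ) {z : ℂ} (hz : z ∈ supportDomain h)
    (x y : ℝ) : ∫ t in x..y, doubleLayer (supportCurve h h₁) z t =
      ((logCurve h h₁ z y).im - (logCurve h h₁ z x).im) / Real.pi := by
  have hΩ := H.isConvexContour ⟨z, hz⟩
  have hk : Continuous fun t => deriv (supportCurve h h₁) t * (supportCurve h h₁ t - z)⁻¹ :=
    hΩ.continuous_deriv.mul
      ((hΩ.continuous.sub continuous_const).inv₀ fun t => hΩ.sub_ne_zero t hz)
  simp only [doubleLayer]
  rw [intervalIntegral.integral_div]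
  have := Complex.imCLM.intervalIntegral_comp_comm (hk.intervalIntegrable (μ := volume) x y)
  simp only [Complex.imCLM_apply] at this
  rw [this, H.integral_inv_curve_sub hz, Complex.sub_im]

theorem im_logCurve (h h₁ : ℝ → ℝ) (z : ℂ) (θ : ℝ) : (logCurve h h₁ z θ).im =
    θ + (unitVec (-θ) * (supportCurve h h₁ θ - z)).arg := by
  simp [logCurve, Complex.log_im]

theorem im_logCurve_add_two_pi (H : IsSupportFunction h h₁ ρ) (z : ℂ) (θ : ℝ) :
    (logCurve h h₁ z (θ + 2 * Real.pi)).im = (logCurve h h₁ z θ).im + 2 * Real.pi := by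
  rw [im_logCurve, im_logCurve, unitVec_neg_periodic, H.curve_periodic]; ring

theorem integral_doubleLayer_period (H : IsSupportFunction h h₁ ρ) {z : ℂ}
    (hz : z ∈ supportDomain h) (x : ℝ) :
    ∫ t in x..(x + 2 * Real.pi), doubleLayer (supportCurve h h₁) z t = 2 := by
  rw [H.integral_doubleLayer hz, H.im_logCurve_add_two_pi]
  field_simp [Real.pi_ne_zero]
  ring

theorem re_curve_add_sub_pos (H : IsSupportFunction h h₁ ρ) (φ : ℝ) {u : ℝ} (hu0 : u ≠ 0)
    (hu : |u| ≤ Real.pi / 2) :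
    0 < (unitVec (-(φ + u)) * (supportCurve h h₁ (φ + u) - supportCurve h h₁ φ)).re := by
  have hpi := Real.pi_pos
  have hu' := abs_le.1 hu
  rw [re_unitVec_neg_mul_curve_sub, sub_pos]
  have := H.dirRe_curve_lt (φ + u) (s := -u) (by simpa using hu0) ⟨by linarith, by linarith⟩
  rwa [add_neg_cancel_right] at this

/-- This transfers angle estimates from boundary points to nearby interior ones. The condition `u ≠
0` keeps the chord from `φ` to `φ + u` nonzero, and its rotated direction has positive real part,
away from the cut of `arg`. -/
theorem continuousAt_im_logCurve_dilate (H : IsSupportFunction h h₁ ρ) (c : ℂ) (φ : ℝ) {u : ℝ}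
    (hu0 : u ≠ 0) (hu : |u| ≤ Real.pi / 2) :
    ContinuousAt (fun q : ℝ × ℝ =>
      (logCurve h h₁ (dilate c q.1 (supportCurve h h₁ q.2)) (q.2 + u)).im) (1, φ) := by
  simp only [im_logCurve]
  have hγ := H.continuous_curve
  have h1 : Continuous fun q : ℝ × ℝ => unitVec (-(q.2 + u)) *
      (supportCurve h h₁ (q.2 + u) - dilate c q.1 (supportCurve h h₁ q.2)) := by
    have h2 : Continuous fun q : ℝ × ℝ => dilate c q.1 (supportCurve h h₁ q.2) :=
      (continuous_dilate c).comp (continuous_fst.prodMk (hγ.comp continuous_snd))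
    exact (continuous_unitVec.comp (by fun_prop)).mul ((hγ.comp (by fun_prop)).sub h2)
  refine ContinuousAt.add (by fun_prop) (ContinuousAt.comp (g := Complex.arg) ?_ h1.continuousAt)
  refine Complex.continuousAt_arg (Complex.mem_slitPlane_iff.2 (Or.inl ?_))
  simpa using H.re_curve_add_sub_pos φ hu0 hu

/-- The angle under which a boundary point sees the complement of an arc around it. -/
theorem im_logCurve_sub_le (H : IsSupportFunction h h₁ ρ) (φ : ℝ) {s : ℝ} (hs0 : 0 < s)
    (hs : s ≤ Real.pi / 2) :
    (logCurve h h₁ (supportCurve h h₁ φ) (φ - s)).im + 2 * Real.pi -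
      (logCurve h h₁ (supportCurve h h₁ φ) (φ + s)).im ≤ Real.pi := by
  -- The curve lies in the half-plane below the supporting line at `φ`, so directions to other
  -- points make an angle of at least `π/2` with the normal there. The bound `|arg| < π/2` fixes the
  -- sign: at least `π/2` at `φ + s`, at most `-π/2` at `φ - s`. The complementary arc then subtends
  -- at most `2π - π/2 - π/2`.
  have hpi := Real.pi_pos
  have key : ∀ u : ℝ, u ≠ 0 → |u| ≤ Real.pi / 2 →
      |(unitVec (-(φ + u)) * (supportCurve h h₁ (φ + u) - supportCurve h h₁ φ)).arg| < Real.pi / 2 ∧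
      Real.pi / 2 ≤
        |u + (unitVec (-(φ + u)) * (supportCurve h h₁ (φ + u) - supportCurve h h₁ φ)).arg| := by
    intro u hu0 hu
    have hre := H.re_curve_add_sub_pos φ hu0 hu
    refine ⟨Complex.abs_arg_lt_pi_div_two_iff.2 (Or.inl hre),
      arg_add_of_re_nonpos hre ?_⟩
    rw [← mul_assoc, ← unitVec_add, show u + -(φ + u) = -φ by ring]
    have h1 : (unitVec (-φ) * (supportCurve h h₁ (φ + u) - supportCurve h h₁ φ)).re =
        dirRe φ (supportCurve h h₁ (φ + u) - supportCurve h h₁ φ) := rfl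
    rw [h1, dirRe_sub, dirRe_curve_self]
    linarith [H.dirRe_curve_le φ (φ + u)]
  have k1 := key s hs0.ne' (by rwa [abs_of_pos hs0])
  have k2 := key (-s) (neg_ne_zero.2 hs0.ne') (by rwa [abs_neg, abs_of_pos hs0])
  rw [im_logCurve, im_logCurve]
  rw [← sub_eq_add_neg] at k2
  have e1 := abs_lt.1 k1.1
  have e2 := abs_lt.1 k2.1
  rcases le_abs.1 k1.2 with a1 | a1 <;> rcases le_abs.1 k2.2 with a2 | a2 <;> linarith

/-- Split the mass `2` of the kernel into `mN` on the arc near `φ` and `mF ≤ 1 + η` on the rest. On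
the near arc `F` is almost `F z`, so up to an error `mN * η ≤ 2 * η` the transform is `(mN - 1) • (F
z)ᴴ` plus the far integral, and `|mN - 1| + mF ≤ 1 + 2 * η`. -/
theorem norm_conjCauchy_le (H : IsSupportFunction h h₁ ρ) {F : ℂ → Matrix m p ℂ}
    (hF : DiffContOnCl ℂ F (supportDomain h)) (hF1 : ∀ z ∈ closure (supportDomain h), ‖F z‖ ≤ 1)
    {z : ℂ} (hz : z ∈ supportDomain h) {φ s η : ℝ} (hs0 : 0 < s) (hs : s ≤ Real.pi / 2)
    (hη : 0 ≤ η)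
    (hnear : ∀ θ ∈ Icc (φ - s) (φ + s), ‖F (supportCurve h h₁ θ) - F z‖ ≤ η)
    (hfar : (logCurve h h₁ z (φ - s)).im + 2 * Real.pi - (logCurve h h₁ z (φ + s)).im ≤
      Real.pi * (1 + η)) :
    ‖conjCauchy (supportCurve h h₁) F z‖ ≤ 1 + 4 * η := by
  have hpi := Real.pi_pos
  have hΩ := H.isConvexContour ⟨z, hz⟩
  set γ := supportCurve h h₁ with hγ
  set μ := doubleLayer γ z with hμ
  have hμc : Continuous μ := hΩ.continuous_doubleLayer hz
  have hμ0 : ∀ t, 0 ≤ μ t := fun t => (H.doubleLayer_pos hz t).le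
  have hFc := hΩ.continuous_comp hF.continuousOn
  have hc : Continuous fun t => μ t • (F (γ t))ᴴ := hμc.smul hFc.matrix_conjTranspose'
  have hper : Function.Periodic (fun t => μ t • (F (γ t))ᴴ) (2 * Real.pi) := fun t => by
    simp only [hμ, H.doubleLayer_periodic z t, hγ, H.curve_periodic]
  have hint : ∫ t in (0 : ℝ)..(2 * Real.pi), μ t • (F (γ t))ᴴ =
      (∫ t in (φ - s)..(φ + s), μ t • (F (γ t))ᴴ) +
        ∫ t in (φ + s)..(φ - s + 2 * Real.pi), μ t • (F (γ t))ᴴ := by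
    rw [intervalIntegral.integral_add_adjacent_intervals (hc.intervalIntegrable _ _)
      (hc.intervalIntegrable _ _), ← hper.intervalIntegral_add_eq 0 (φ - s), zero_add]
  set mN := ∫ t in (φ - s)..(φ + s), μ t with hmN
  set mF := ∫ t in (φ + s)..(φ - s + 2 * Real.pi), μ t with hmF
  have hsum : mN + mF = 2 := by
    rw [hmN, hmF, intervalIntegral.integral_add_adjacent_intervals (hμc.intervalIntegrable _ _)
      (hμc.intervalIntegrable _ _)]
    exact H.integral_doubleLayer_period hz _
  have hmF0 : 0 ≤ mF := intervalIntegral.integral_nonneg (by linarith) fun t _ => hμ0 t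
  have hmN0 : 0 ≤ mN := intervalIntegral.integral_nonneg (by linarith) fun t _ => hμ0 t
  have hmF1 : mF ≤ 1 + η := by
    rw [hmF, hμ, hγ, H.integral_doubleLayer hz, H.im_logCurve_add_two_pi, div_le_iff₀ hpi]
    linarith
  have hsplit : ∫ t in (φ - s)..(φ + s), μ t • (F (γ t))ᴴ =
      (∫ t in (φ - s)..(φ + s), μ t • (F (γ t) - F z)ᴴ) + mN • (F z)ᴴ := by
    rw [hmN, ← intervalIntegral.integral_smul_const, ← intervalIntegral.integral_add]
    · congr 1
      funext t
      rw [← smul_add, Matrix.conjTranspose_sub, sub_add_cancel]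
    · exact (hμc.smul (hFc.sub continuous_const).matrix_conjTranspose').intervalIntegrable _ _
    · exact (hμc.smul continuous_const).intervalIntegrable _ _
  have b1 : ‖∫ t in (φ - s)..(φ + s), μ t • (F (γ t) - F z)ᴴ‖ ≤ mN * η := by
    rw [hmN, ← intervalIntegral.integral_mul_const]
    refine intervalIntegral.norm_integral_le_of_norm_le (by linarith) (ae_of_all _ fun t ht => ?_)
      ((hμc.mul continuous_const).intervalIntegrable _ _)
    rw [norm_smul, Real.norm_of_nonneg (hμ0 t), Matrix.l2_opNorm_conjTranspose]
    exact mul_le_mul_of_nonneg_left (hnear t (Ioc_subset_Icc_self ht)) (hμ0 t)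
  have b2 : ‖∫ t in (φ + s)..(φ - s + 2 * Real.pi), μ t • (F (γ t))ᴴ‖ ≤ mF := by
    refine intervalIntegral.norm_integral_le_of_norm_le (by linarith) (ae_of_all _ fun t ht => ?_)
      (hμc.intervalIntegrable _ _)
    rw [norm_smul, Real.norm_of_nonneg (hμ0 t), Matrix.l2_opNorm_conjTranspose]
    exact mul_le_of_le_one_right (hμ0 t) (hF1 _ (hΩ.mem_closure t))
  have b3 : ‖(mN - 1) • (F z)ᴴ‖ ≤ |mN - 1| := by
    rw [norm_smul, Matrix.l2_opNorm_conjTranspose, Real.norm_eq_abs]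
    exact mul_le_of_le_one_right (abs_nonneg _) (hF1 _ (subset_closure hz))
  have heq : conjCauchy γ F z = (∫ t in (φ - s)..(φ + s), μ t • (F (γ t) - F z)ᴴ) +
      (mN - 1) • (F z)ᴴ + ∫ t in (φ + s)..(φ - s + 2 * Real.pi), μ t • (F (γ t))ᴴ := by
    rw [hΩ.conjCauchy_eq hF hz, ← hμ, hint, hsplit, sub_smul, one_smul]
    abel
  rw [heq]
  refine (norm_add₃_le).trans ?_
  have : |mN - 1| + mF ≤ 1 + 2 * η := by
    rcases abs_cases (mN - 1) with ⟨e, -⟩ | ⟨e, -⟩ <;> rw [e] <;> linarith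
  nlinarith

/-- The previous bound holds uniformly on contracted copies of the boundary, by uniform continuity
and compactness of a period; the maximum principle carries it inside. -/
theorem eventually_norm_conjCauchy_le (H : IsSupportFunction h h₁ ρ) {F : ℂ → Matrix m p ℂ}
    (hF : DiffContOnCl ℂ F (supportDomain h)) (hF1 : ∀ z ∈ closure (supportDomain h), ‖F z‖ ≤ 1)
    {c : ℂ} (hc : c ∈ supportDomain h) {η : ℝ} (hη : 0 < η) :
    ∀ᶠ r : ℝ in 𝓝[<] 1, ∀ z ∈ closure (supportDomain h),
      ‖conjCauchy (supportCurve h h₁) F (dilate c r z)‖ ≤ 1 + 4 * η := by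
  have hpi := Real.pi_pos
  have hΩ := H.isConvexContour ⟨c, hc⟩
  set Ω := supportDomain h with hΩdef
  set γ := supportCurve h h₁ with hγ
  have hcomp : IsCompact (closure Ω) := hΩ.isBounded.isCompact_closure
  obtain ⟨δ, hδ, hFδ⟩ := Metric.uniformContinuousOn_iff.1
    (hcomp.uniformContinuousOn_of_continuous hF.continuousOn) η hη
  -- The interval contains every `φ ± s` with `φ` in `[0, 2π)` and `s ≤ π/2`, so no reduction modulo
  -- the period is needed.
  obtain ⟨s₀, hs₀, hγs⟩ := Metric.uniformContinuousOn_iff.1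
    ((isCompact_Icc (a := -(2 * Real.pi)) (b := 4 * Real.pi)).uniformContinuousOn_of_continuous
      hΩ.continuous.continuousOn) (δ / 2) (by positivity)
  set s := min (s₀ / 2) (Real.pi / 2) with hs
  have hs0 : 0 < s := lt_min (by positivity) (by positivity)
  have hs1 : s ≤ Real.pi / 2 := min_le_right _ _
  have hs2 : s < s₀ := (min_le_left _ _).trans_lt (by linarith)
  have habs : |s| ≤ Real.pi / 2 := by rwa [abs_of_pos hs0]
  have htube : ∀ᶠ r : ℝ in 𝓝 1, ∀ φ ∈ Icc 0 (2 * Real.pi),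
      dist (dilate c r (γ φ)) (γ φ) < δ / 2 ∧
        (logCurve h h₁ (dilate c r (γ φ)) (φ + -s)).im + 2 * Real.pi -
          (logCurve h h₁ (dilate c r (γ φ)) (φ + s)).im < Real.pi * (1 + η) := by
    refine isCompact_Icc.eventually_forall_of_forall_eventually
      (P := fun r φ => dist (dilate c r (γ φ)) (γ φ) < δ / 2 ∧
        (logCurve h h₁ (dilate c r (γ φ)) (φ + -s)).im + 2 * Real.pi -
          (logCurve h h₁ (dilate c r (γ φ)) (φ + s)).im < Real.pi * (1 + η)) fun φ _ => ?_
    refine Eventually.and ?_ ?_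
    · have hcont : Continuous fun q : ℝ × ℝ => dist (dilate c q.1 (γ q.2)) (γ q.2) :=
        ((continuous_dilate c).comp
          (continuous_fst.prodMk (hΩ.continuous.comp continuous_snd))).dist
          (hΩ.continuous.comp continuous_snd)
      exact (hcont.continuousAt (x := (1, φ))).eventually_lt continuousAt_const
        (by simpa using half_pos hδ)
    · have h1 := H.continuousAt_im_logCurve_dilate c φ (u := -s) (neg_ne_zero.2 hs0.ne')
        (by rwa [abs_neg])
      have h2 := H.continuousAt_im_logCurve_dilate c φ (u := s) hs0.ne' habs
      refine ((h1.add continuousAt_const).sub h2).eventually_lt continuousAt_const ?_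
      have := H.im_logCurve_sub_le φ hs0 hs1
      change (logCurve h h₁ (dilate c 1 (γ φ)) (φ + -s)).im + 2 * Real.pi -
          (logCurve h h₁ (dilate c 1 (γ φ)) (φ + s)).im < Real.pi * (1 + η)
      rw [dilate_one, ← sub_eq_add_neg]
      nlinarith
  have hpos : ∀ᶠ r : ℝ in 𝓝[<] 1, 0 ≤ r :=
    nhdsWithin_le_nhds ((eventually_gt_nhds (zero_lt_one' ℝ)).mono fun r hr => hr.le)
  filter_upwards [nhdsWithin_le_nhds htube, self_mem_nhdsWithin, hpos] with r hr hr1 hr0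
  intro z hz
  refine Complex.norm_le_of_forall_mem_frontier_norm_le hΩ.isBounded
    (IsConvexContour.diffContOnCl_comp_dilate hΩ.isOpen hΩ.convex
      (hΩ.differentiableOn_conjCauchy hF.continuousOn) hc ⟨hr0, hr1⟩) (fun w hw => ?_) hz
  obtain ⟨t, rfl⟩ := H.exists_curve_eq hw
  have hper : Function.Periodic γ (2 * Real.pi) := H.curve_periodic
  obtain ⟨φ, hφ, hφt⟩ := hper.exists_mem_Ico₀ Real.two_pi_pos t
  rw [← hγ, hφt]
  obtain ⟨hr2, hr3⟩ := hr φ (Ico_subset_Icc_self hφ)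
  have hzΩ : dilate c r (γ φ) ∈ Ω :=
    dilate_mem hΩ.isOpen hΩ.convex hc (hΩ.mem_closure φ) hr0 hr1
  refine H.norm_conjCauchy_le hF hF1 hzΩ hs0 hs1 hη.le (fun θ hθ => ?_)
    (by rw [sub_eq_add_neg φ s]; exact hr3.le)
  rw [← dist_eq_norm]
  refine (hFδ _ (hΩ.mem_closure θ) _ (subset_closure hzΩ) ?_).le
  have h1 : dist (γ θ) (γ φ) < δ / 2 := by
    refine hγs θ ⟨by linarith [hθ.1, hφ.1], by linarith [hθ.2, hφ.2]⟩ φ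
      ⟨by linarith [hφ.1], by linarith [hφ.2]⟩ ?_
    rw [Real.dist_eq, abs_lt]
    exact ⟨by linarith [hθ.1], by linarith [hθ.2]⟩
  calc dist (γ θ) (dilate c r (γ φ)) ≤ dist (γ θ) (γ φ) + dist (γ φ) (dilate c r (γ φ)) :=
        dist_triangle _ _ _
    _ < δ / 2 + δ / 2 := add_lt_add h1 (by rwa [dist_comm])
    _ = δ := add_halves δ

end IsSupportFunction

end ConjugateCauchy

/-! ### The Crouzeix–Palencia inequality on support domains. -/

section CrouzeixPalencia

variable {m p a : Type*} [Fintype m] [Fintype p] [Fintype a]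
  [DecidableEq m] [DecidableEq p] [DecidableEq a]

theorem commute_matrixDilate (c : ℂ) (r : ℝ) (A : Matrix a a ℂ) (z : ℂ) :
    A * (z • 1 - matrixDilate c r A) = (z • 1 - matrixDilate c r A) * A := by
  have hA1 : Commute A (1 : Matrix a a ℂ) := Commute.one_right A
  have : Commute A (z • 1 - matrixDilate c r A) :=
    (hA1.smul_right z).sub_right ((hA1.smul_right c).add_right
      (((Commute.refl A).sub_right (hA1.smul_right c)).smul_right _))
  exact this.eq

namespace IsConvexContour

variable {Ω : Set ℂ} {γ : ℝ → ℂ} {A : Matrix a a ℂ}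

/-- The value at the dilated matrix of the Cauchy transform of the conjugate transpose. -/
def _root_.conjCauchyMatrix (γ : ℝ → ℂ) (F : ℂ → Matrix m p ℂ) (B : Matrix a a ℂ) :
    Matrix (p × a) (m × a) ℂ :=
  (2 * Real.pi * Complex.I : ℂ)⁻¹ • ∫ t in (0 : ℝ)..(2 * Real.pi),
    deriv γ t • ((F (γ t))ᴴ ⊗ₖ (γ t • (1 : Matrix a a ℂ) - B)⁻¹)

/-- Put `w = dilate c r z` and `B = matrixDilate c r A`. Since `r (z - A) = (γ t - B) - (γ t - w)`,
the difference `(γ t - w)⁻¹ - (γ t - B)⁻¹` is divisible by `z - A` for each `t`; the quotient `Q` is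
`r` times a Cauchy integral evaluated at `w`. -/
theorem hasMatrixValue_conjCauchy (hΩ : IsConvexContour Ω γ) (hA : numericalRange A ⊆ Ω)
    {F : ℂ → Matrix m p ℂ} (hF : ContinuousOn F (closure Ω)) {c : ℂ} (hc : c ∈ Ω) {r : ℝ}
    (hr : r ∈ Ico (0 : ℝ) 1) :
    HasMatrixValue Ω A (fun z => conjCauchy γ F (dilate c r z))
      (conjCauchyMatrix γ F (matrixDilate c r A)) := by
  set B := matrixDilate c r A with hB
  have hBΩ : numericalRange B ⊆ Ω :=
    hΩ.numericalRange_matrixDilate_subset hA hc (Ico_subset_Icc_self hr)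
  have hR := hΩ.continuous_resolvent hBΩ
  have hFc := (hΩ.continuous_comp hF).matrix_conjTranspose'
  set k : ℝ → Matrix (p × a) (m × a) ℂ := fun t =>
    deriv γ t • ((F (γ t))ᴴ ⊗ₖ (γ t • (1 : Matrix a a ℂ) - B)⁻¹) with hk
  have hkc : Continuous k := hΩ.continuous_deriv.smul (hFc.kronecker hR)
  refine ⟨?_, fun z => (2 * Real.pi * Complex.I : ℂ)⁻¹ • ((r : ℂ) •
      ∫ t in (0 : ℝ)..(2 * Real.pi), (γ t - dilate c r z)⁻¹ • k t), ?_, fun z hz => ?_⟩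
  · have e1 := (matrixMulCLM _ _ (m × a) ((1 : Matrix p p ℂ) ⊗ₖ A)).intervalIntegral_comp_comm
      (hkc.intervalIntegrable (μ := volume) 0 (2 * Real.pi))
    have e2 := ((matrixMulCLM (p × a) _ _).flip
      ((1 : Matrix m m ℂ) ⊗ₖ A)).intervalIntegral_comp_comm
      (hkc.intervalIntegrable (μ := volume) 0 (2 * Real.pi))
    simp only [matrixMulCLM_apply, ContinuousLinearMap.flip_apply] at e1 e2
    rw [conjCauchyMatrix, Matrix.mul_smul, Matrix.smul_mul, ← e1, ← e2]
    congr 2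
    funext t
    simp only [hk, Matrix.mul_smul, Matrix.smul_mul]
    rw [← Matrix.mul_kronecker_mul, ← Matrix.mul_kronecker_mul, Matrix.one_mul, Matrix.mul_one]
    have hdet := hΩ.det_ne_zero hBΩ t
    rw [← inv_mul_eq_mul_inv hdet hdet (commute_matrixDilate c r A (γ t)).symm]
  · exact ((diffContOnCl_comp_dilate hΩ.isOpen hΩ.convex (hΩ.differentiableOn_cauchyIntegral hkc)
      hc hr).const_smul (r : ℂ)).const_smul (2 * Real.pi * Complex.I : ℂ)⁻¹
  · have hzΩ : dilate c r z ∈ Ω := dilate_mem hΩ.isOpen hΩ.convex hc hz hr.1 hr.2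
    set w := dilate c r z with hw
    have hinv : Continuous fun t => (γ t - w)⁻¹ :=
      (hΩ.continuous.sub continuous_const).inv₀ fun t => hΩ.sub_ne_zero t hzΩ
    have hc1 : Continuous fun t => (γ t - w)⁻¹ • (deriv γ t • (F (γ t))ᴴ) :=
      hinv.smul (hΩ.continuous_deriv.smul hFc)
    have e1 := ((kroneckerCLM p m a a).flip 1).intervalIntegral_comp_comm
      (hc1.intervalIntegrable (μ := volume) 0 (2 * Real.pi))
    have e2 := ((matrixMulCLM (p × a) _ _).flip
      ((1 : Matrix m m ℂ) ⊗ₖ (z • (1 : Matrix a a ℂ) - A))).intervalIntegral_comp_comm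
      ((hinv.smul hkc).intervalIntegrable (μ := volume) 0 (2 * Real.pi))
    simp only [kroneckerCLM_apply, matrixMulCLM_apply, ContinuousLinearMap.flip_apply] at e1 e2
    have hpt : ∀ t, ((γ t - w)⁻¹ • deriv γ t • (F (γ t))ᴴ) ⊗ₖ (1 : Matrix a a ℂ) - k t =
        (r : ℂ) • (((γ t - w)⁻¹ • k t) *
          ((1 : Matrix m m ℂ) ⊗ₖ (z • (1 : Matrix a a ℂ) - A))) := by
      intro t
      have hdet := hΩ.det_ne_zero hBΩ t
      have hne := hΩ.sub_ne_zero t hzΩ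
      simp only [hk]
      set S := γ t • (1 : Matrix a a ℂ) - B with hS
      have hzA : (r : ℂ) • (z • (1 : Matrix a a ℂ) - A) = S - (γ t - w) • (1 : Matrix a a ℂ) := by
        simp only [hS, hB, hw, matrixDilate, dilate]
        module
      have hkey : (γ t - w)⁻¹ • (1 : Matrix a a ℂ) - S⁻¹ =
          (γ t - w)⁻¹ • (S⁻¹ * ((r : ℂ) • (z • (1 : Matrix a a ℂ) - A))) := by
        rw [hzA, mul_sub, Matrix.nonsing_inv_mul _ (isUnit_iff_ne_zero.2 hdet), mul_smul_comm,
          mul_one, smul_sub, smul_smul, inv_mul_cancel₀ hne, one_smul]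
      have h3 : ((γ t - w)⁻¹ • deriv γ t • (F (γ t))ᴴ) ⊗ₖ (1 : Matrix a a ℂ) =
          deriv γ t • ((F (γ t))ᴴ ⊗ₖ ((γ t - w)⁻¹ • (1 : Matrix a a ℂ))) := by
        rw [Matrix.smul_kronecker, Matrix.smul_kronecker, Matrix.kronecker_smul, smul_comm]
      have h4 : (F (γ t))ᴴ ⊗ₖ ((γ t - w)⁻¹ • (1 : Matrix a a ℂ)) - (F (γ t))ᴴ ⊗ₖ S⁻¹ =
          (γ t - w)⁻¹ • (r : ℂ) • ((F (γ t))ᴴ ⊗ₖ S⁻¹ *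
            ((1 : Matrix m m ℂ) ⊗ₖ (z • (1 : Matrix a a ℂ) - A))) := by
        have hsub : (F (γ t))ᴴ ⊗ₖ ((γ t - w)⁻¹ • (1 : Matrix a a ℂ) - S⁻¹) =
            (F (γ t))ᴴ ⊗ₖ ((γ t - w)⁻¹ • (1 : Matrix a a ℂ)) - (F (γ t))ᴴ ⊗ₖ S⁻¹ := by
          ext i j
          simp only [Matrix.kroneckerMap_apply, Matrix.sub_apply, mul_sub]
        rw [← hsub, hkey, ← Matrix.mul_kronecker_mul, Matrix.mul_one, ← Matrix.kronecker_smul,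
          ← Matrix.kronecker_smul, Matrix.mul_smul]
      rw [h3, ← smul_sub, h4]
      simp only [Matrix.smul_mul, smul_smul]
      congr 1
      ring
    have hint : (∫ t in (0 : ℝ)..(2 * Real.pi),
          ((γ t - w)⁻¹ • deriv γ t • (F (γ t))ᴴ) ⊗ₖ (1 : Matrix a a ℂ)) -
        ∫ t in (0 : ℝ)..(2 * Real.pi), k t =
        (r : ℂ) • ∫ t in (0 : ℝ)..(2 * Real.pi), ((γ t - w)⁻¹ • k t) *
          ((1 : Matrix m m ℂ) ⊗ₖ (z • (1 : Matrix a a ℂ) - A)) := by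
      rw [← intervalIntegral.integral_sub, ← intervalIntegral.integral_smul]
      · exact intervalIntegral.integral_congr fun t _ => hpt t
      · exact (hc1.kronecker continuous_const).intervalIntegrable _ _
      · exact hkc.intervalIntegrable _ _
    change conjCauchy γ F w ⊗ₖ (1 : Matrix a a ℂ) - conjCauchyMatrix γ F B = _
    rw [conjCauchy, conjCauchyMatrix, Matrix.smul_kronecker, ← smul_sub, Matrix.smul_mul,
      Matrix.smul_mul]
    exact congrArg _ ((congrArg₂ _ e1.symm rfl).trans (hint.trans (congrArg _ e2)))

theorem tendsto_conjCauchyMatrix (hΩ : IsConvexContour Ω γ) (hA : numericalRange A ⊆ Ω)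
    {F : ℂ → Matrix m p ℂ} (hF : ContinuousOn F (closure Ω)) {c : ℂ} (hc : c ∈ Ω) :
    Tendsto (fun r : ℝ => conjCauchyMatrix γ F (matrixDilate c r A)) (𝓝[<] 1)
      (𝓝 (conjCauchyMatrix γ F A)) := by
  have hFc := (hΩ.continuous_comp hF).matrix_conjTranspose'
  have hcont : ContinuousOn (fun r : ℝ => conjCauchyMatrix γ F (matrixDilate c r A)) (Icc 0 1) := by
    have h0 : ContinuousOn (fun r : ℝ => ∫ t in (0 : ℝ)..(2 * Real.pi), deriv γ t •
        ((F (γ t))ᴴ ⊗ₖ (γ t • (1 : Matrix a a ℂ) - matrixDilate c r A)⁻¹)) (Icc 0 1) := by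
      refine continuousOn_intervalIntegral_of_continuousOn
        (Φ := fun (r t : ℝ) => deriv γ t •
          ((F (γ t))ᴴ ⊗ₖ (γ t • (1 : Matrix a a ℂ) - matrixDilate c r A)⁻¹)) ?_ _ _
      refine (hΩ.continuous_deriv.comp continuous_snd).continuousOn.smul ?_
      exact (hFc.comp continuous_snd).continuousOn.kronecker
        (hΩ.continuousOn_resolvent_matrixDilate hA hc)
    exact h0.const_smul (2 * Real.pi * Complex.I : ℂ)⁻¹
  have h1 : matrixDilate c 1 A = A := by simp [matrixDilate]
  have h2 := (hcont 1 (by simp)).tendsto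
  rw [h1] at h2
  refine h2.mono_left ?_
  rw [← nhdsWithin_Ico_eq_nhdsLT (zero_lt_one' ℝ)]
  exact nhdsWithin_mono _ Ico_subset_Icc_self

/-- A crude bound, needed only so that the supremum in the extremal argument is finite. -/
theorem exists_bound_resolventIntegral (hΩ : IsConvexContour Ω γ) (hA : numericalRange A ⊆ Ω)
    (m p : Type*) [Fintype m] [Fintype p] [DecidableEq m] [DecidableEq p] :
    ∃ C : ℝ, ∀ F : ℂ → Matrix m p ℂ, (∀ z ∈ closure Ω, ‖F z‖ ≤ 1) →
      ‖resolventIntegral γ A F‖ ≤ C := by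
  obtain ⟨L, hL⟩ := (isCompact_Icc (a := 0) (b := 2 * Real.pi)).exists_bound_of_continuousOn
    hΩ.continuous_deriv.continuousOn
  have hR : Continuous fun t => (1 : Matrix p p ℂ) ⊗ₖ (γ t • (1 : Matrix a a ℂ) - A)⁻¹ :=
    continuous_const.kronecker (hΩ.continuous_resolvent hA)
  obtain ⟨C, hC⟩ := (isCompact_Icc (a := 0) (b := 2 * Real.pi)).exists_bound_of_continuousOn
    hR.continuousOn
  refine ⟨‖(2 * Real.pi * Complex.I : ℂ)⁻¹‖ * (L * C * (2 * Real.pi)), fun F hF => ?_⟩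
  rw [resolventIntegral, norm_smul]
  refine mul_le_mul_of_nonneg_left (norm_contourIntegral_le hL fun t ht => ?_) (norm_nonneg _)
  rw [kronecker_eq_mul_one_kronecker]
  calc _ ≤ ‖F (γ t) ⊗ₖ (1 : Matrix a a ℂ)‖ *
        ‖(1 : Matrix p p ℂ) ⊗ₖ (γ t • (1 : Matrix a a ℂ) - A)⁻¹‖ := Matrix.l2_opNorm_mul _ _
    _ ≤ 1 * C := mul_le_mul ((norm_kronecker_one_le _).trans (hF _ (hΩ.mem_closure t))) (hC t ht)
        (norm_nonneg _) zero_le_one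
    _ = C := one_mul C

end IsConvexContour

/-- By the C⋆-identity used twice, `‖X‖⁴ = ‖Xᴴ (X Xᴴ X)‖ ≤ ‖X‖ ‖X Xᴴ X‖`. -/
theorem norm_pow_three_le (X : Matrix m p ℂ) : ‖X‖ ^ 3 ≤ ‖X * Xᴴ * X‖ := by
  by_cases h0 : ‖X‖ = 0
  · rw [h0]; simp
  have h1 : ‖(Xᴴ * X)ᴴ * (Xᴴ * X)‖ = (‖X‖ * ‖X‖) * (‖X‖ * ‖X‖) := by
    rw [Matrix.l2_opNorm_conjTranspose_mul_self, Matrix.l2_opNorm_conjTranspose_mul_self]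
  have h2 : (Xᴴ * X)ᴴ * (Xᴴ * X) = Xᴴ * (X * Xᴴ * X) := by
    rw [Matrix.conjTranspose_mul, Matrix.conjTranspose_conjTranspose]
    simp only [Matrix.mul_assoc]
  have h3 := Matrix.l2_opNorm_mul Xᴴ (X * Xᴴ * X)
  rw [← h2, h1, Matrix.l2_opNorm_conjTranspose] at h3
  have hpos : 0 < ‖X‖ := lt_of_le_of_ne (norm_nonneg X) (Ne.symm h0)
  refine le_of_mul_le_mul_left ?_ hpos
  calc ‖X‖ * ‖X‖ ^ 3 = ‖X‖ * ‖X‖ * (‖X‖ * ‖X‖) := by ring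
    _ ≤ _ := h3

/-- Passing to the supremum `K` in the hypothesis gives `K³ ≤ 2K² + K`, that is `K² ≤ 2K + 1` when
`K > 0`, and `1 + √2` is the positive root of the corresponding equation. No extremal function is
required. -/
theorem le_one_add_sqrt_two {S : Set ℝ} (hne : S.Nonempty) (hbdd : BddAbove S)
    (h0 : ∀ x ∈ S, 0 ≤ x) (h : ∀ x ∈ S, x ^ 3 ≤ 2 * x ^ 2 + sSup S) {x : ℝ} (hx : x ∈ S) :
    x ≤ 1 + Real.sqrt 2 := by
  refine (le_csSup hbdd hx).trans ?_
  by_contra! hlt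
  set K := sSup S with hK
  have hs : 0 ≤ Real.sqrt 2 := Real.sqrt_nonneg 2
  have hs2 : Real.sqrt 2 ^ 2 = 2 := Real.sq_sqrt (by norm_num)
  have hK0 : 0 < K := by linarith
  have hK3 : 2 * K ^ 2 + K < K ^ 3 := by
    have : 2 * K + 1 < K ^ 2 := by nlinarith
    nlinarith
  -- If `K > 1 + √2`, this cube root lies below `K`; an element of `S` between the two violates the
  -- hypothesis.
  set b := (2 * K ^ 2 + K) ^ (1 / 3 : ℝ) with hb
  have hb0 : 0 ≤ b := Real.rpow_nonneg (by positivity) _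
  have hb3 : b ^ 3 = 2 * K ^ 2 + K := by
    rw [hb, ← Real.rpow_natCast, ← Real.rpow_mul (by positivity)]
    norm_num
  have hbK : b < K := lt_of_pow_lt_pow_left₀ 3 hK0.le (by rwa [hb3])
  obtain ⟨y, hy, hby⟩ := exists_lt_of_lt_csSup hne hbK
  have h1 := h y hy
  have h2 : y ≤ K := le_csSup hbdd hy
  have h3 : b ^ 3 < y ^ 3 := pow_lt_pow_left₀ hby hb0 (by norm_num)
  have h4 : y ^ 2 ≤ K ^ 2 := pow_le_pow_left₀ (h0 y hy) h2 2
  rw [hb3] at h3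
  linarith

namespace IsSupportFunction

variable {h h₁ ρ : ℝ → ℝ} {A : Matrix a a ℂ}

/-- The operator valued kernel of the double layer potential. -/
def _root_.doubleLayerMatrix (γ : ℝ → ℂ) (A : Matrix a a ℂ) (t : ℝ) : Matrix a a ℂ :=
  ((2 * Real.pi * Complex.I : ℂ)⁻¹ * deriv γ t) • (γ t • (1 : Matrix a a ℂ) - A)⁻¹ +
    (((2 * Real.pi * Complex.I : ℂ)⁻¹ * deriv γ t) • (γ t • (1 : Matrix a a ℂ) - A)⁻¹)ᴴ

open scoped ComplexOrder InnerProductSpace in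
-- With `S = γ t - A`, the kernel is a nonnegative multiple of `(S⁻¹)ᴴ (e^{it} Sᴴ + e^{-it} S) S⁻¹`.
-- For `v ≠ 0`, the form of the middle factor is `2 ‖v‖² (h t - dirRe t w)` for some `w ∈ W(A)`,
-- which is nonnegative because `W(A)` lies in the supporting half-plane.
theorem posSemidef_doubleLayerMatrix (H : IsSupportFunction h h₁ ρ)
    (hA : numericalRange A ⊆ supportDomain h) (t : ℝ) :
    (doubleLayerMatrix (supportCurve h h₁) A t).PosSemidef := by
  set S := supportCurve h h₁ t • (1 : Matrix a a ℂ) - A with hS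
  have hdet : S.det ≠ 0 := det_sub_ne_zero fun hmem => notMem_domain h h₁ t (hA hmem)
  have hSS : S * S⁻¹ = 1 := Matrix.mul_nonsing_inv _ (isUnit_iff_ne_zero.2 hdet)
  have hw : (2 * Real.pi * Complex.I : ℂ)⁻¹ * deriv (supportCurve h h₁) t =
      ((ρ t / (2 * Real.pi) : ℝ) : ℂ) * unitVec t := by
    rw [H.deriv_curve]
    have : (Real.pi : ℂ) ≠ 0 := by exact_mod_cast Real.pi_ne_zero
    push_cast
    field_simp
  set T : Matrix a a ℂ := unitVec t • Sᴴ + unitVec (-t) • S with hT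
  have hTpos : T.PosSemidef := by
    have hTh : T.IsHermitian := by
      rw [Matrix.IsHermitian, hT, Matrix.conjTranspose_add, Matrix.conjTranspose_smul,
        Matrix.conjTranspose_smul, Matrix.conjTranspose_conjTranspose, add_comm]
      have e1 : star (unitVec t) = unitVec (-t) := conj_unitVec t
      have e2 : star (unitVec (-t)) = unitVec t := by
        have := conj_unitVec (-t); rwa [neg_neg] at this
      rw [e1, e2]
    refine Matrix.PosSemidef.of_dotProduct_mulVec_nonneg hTh fun v => ?_
    rcases eq_or_ne (WithLp.toLp 2 v : EuclideanSpace ℂ a) 0 with h0 | h0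
    · have : v = 0 := by simpa using h0
      simp [this]
    obtain ⟨w, hw, hvw⟩ := inner_toEuclideanLin_mem A h0
    have hTv : star v ⬝ᵥ (T *ᵥ v) =
        ((2 * dirRe t (star v ⬝ᵥ (S *ᵥ v)) : ℝ) : ℂ) := by
      have e1 : star v ⬝ᵥ (Sᴴ *ᵥ v) = (starRingEnd ℂ) (star v ⬝ᵥ (S *ᵥ v)) := by
        have : (starRingEnd ℂ) (star v ⬝ᵥ (S *ᵥ v)) = star (star v ⬝ᵥ (S *ᵥ v)) := rfl
        rw [this, Matrix.star_dotProduct, Matrix.star_mulVec, Matrix.conjTranspose_conjTranspose,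
          Matrix.dotProduct_mulVec]
      rw [hT, Matrix.add_mulVec, Matrix.smul_mulVec, Matrix.smul_mulVec, dotProduct_add,
        dotProduct_smul, dotProduct_smul, e1, smul_eq_mul, smul_eq_mul, ← conj_unitVec]
      generalize star v ⬝ᵥ (S *ᵥ v) = q
      have hq : unitVec t * (starRingEnd ℂ) q = (starRingEnd ℂ) ((starRingEnd ℂ) (unitVec t) * q) := by
        rw [map_mul, Complex.conj_conj]
      rw [hq, add_comm, Complex.add_conj, dirRe, conj_unitVec]
    have hSv : star v ⬝ᵥ (S *ᵥ v) = ((‖WithLp.toLp 2 v‖ ^ 2 : ℝ) : ℂ) *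
        (supportCurve h h₁ t - w) := by
      have e1 := star_dotProduct_mulVec_eq_inner A (WithLp.toLp 2 v)
      rw [hvw] at e1
      have e2 : star v ⬝ᵥ v = ((‖WithLp.toLp 2 v‖ : ℝ) : ℂ) ^ 2 := by
        have := inner_self_eq_norm_sq_to_K (𝕜 := ℂ) (WithLp.toLp 2 v : EuclideanSpace ℂ a)
        rw [EuclideanSpace.inner_eq_star_dotProduct, dotProduct_comm] at this
        exact this
      rw [hS, Matrix.sub_mulVec, Matrix.smul_mulVec, Matrix.one_mulVec, dotProduct_sub,
        dotProduct_smul, e1, e2, smul_eq_mul]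
      push_cast
      ring
    have hpos : 0 ≤ dirRe t (supportCurve h h₁ t - w) := by
      rw [dirRe_sub, dirRe_curve_self]
      exact sub_nonneg.2 (hA hw t).le
    have hmul : ∀ (x : ℝ) (z : ℂ), dirRe t ((x : ℂ) * z) = x * dirRe t z := by
      intro x z
      rw [dirRe, mul_left_comm, Complex.re_ofReal_mul, dirRe]
    rw [hTv, hSv, hmul]
    have : 0 ≤ 2 * (‖WithLp.toLp 2 v‖ ^ 2 * dirRe t (supportCurve h h₁ t - w)) := by positivity
    exact_mod_cast this
  have hM : doubleLayerMatrix (supportCurve h h₁) A t =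
      ((ρ t / (2 * Real.pi) : ℝ) : ℂ) • ((S⁻¹)ᴴ * T * S⁻¹) := by
    have hSS' : (S⁻¹)ᴴ * Sᴴ = 1 := by
      rw [← Matrix.conjTranspose_mul, hSS, Matrix.conjTranspose_one]
    rw [doubleLayerMatrix, ← hS, hw, hT, Matrix.mul_add, Matrix.add_mul, Matrix.mul_smul,
      Matrix.mul_smul, hSS', Matrix.smul_mul, Matrix.smul_mul, Matrix.mul_assoc _ S, hSS,
      Matrix.one_mul, Matrix.mul_one, Matrix.conjTranspose_smul, smul_add, smul_smul, smul_smul]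
    congr 2
    have e1 : star (((ρ t / (2 * Real.pi) : ℝ) : ℂ) * unitVec t) =
      ((ρ t / (2 * Real.pi) : ℝ) : ℂ) * unitVec (-t) := by
      have : star (((ρ t / (2 * Real.pi) : ℝ) : ℂ) * unitVec t) =
        (starRingEnd ℂ) (((ρ t / (2 * Real.pi) : ℝ) : ℂ) * unitVec t) := rfl
      rw [this, map_mul, Complex.conj_ofReal, conj_unitVec]
    exact e1
  rw [hM]
  refine (hTpos.conjTranspose_mul_mul_same _).smul ?_
  have : 0 ≤ ρ t / (2 * Real.pi) := div_nonneg (H.pos t).le Real.two_pi_pos.le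
  exact_mod_cast this

theorem integral_doubleLayerMatrix {Ω : Set ℂ} {γ : ℝ → ℂ} (hΩ : IsConvexContour Ω γ)
    (hA : numericalRange A ⊆ Ω) :
    ∫ t in (0 : ℝ)..(2 * Real.pi), doubleLayerMatrix γ A t = ((2 : ℝ) : ℂ) • (1 : Matrix a a ℂ) := by
  have hR := hΩ.continuous_resolvent hA
  have hc : Continuous fun t => ((2 * Real.pi * Complex.I : ℂ)⁻¹ * deriv γ t) •
      (γ t • (1 : Matrix a a ℂ) - A)⁻¹ := (continuous_const.mul hΩ.continuous_deriv).smul hR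
  have h1 : ∫ t in (0 : ℝ)..(2 * Real.pi), ((2 * Real.pi * Complex.I : ℂ)⁻¹ * deriv γ t) •
      (γ t • (1 : Matrix a a ℂ) - A)⁻¹ = 1 := by
    have := hΩ.integral_resolvent hA
    simp only [mul_smul]
    rw [intervalIntegral.integral_smul]
    change (2 * Real.pi * Complex.I : ℂ)⁻¹ •
      contourIntegral γ (fun z => (z • (1 : Matrix a a ℂ) - A)⁻¹) = 1
    rw [this, smul_smul, inv_mul_cancel₀ (by simp [Real.pi_ne_zero]), one_smul]
  have h2 := (conjTransposeCLM a a).intervalIntegral_comp_comm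
    (hc.intervalIntegrable (μ := volume) 0 (2 * Real.pi))
  simp only [conjTransposeCLM_apply] at h2
  simp only [doubleLayerMatrix]
  rw [intervalIntegral.integral_add (hc.intervalIntegrable _ _)
    (hc.matrix_conjTranspose'.intervalIntegrable _ _), h2, h1, Matrix.conjTranspose_one]
  push_cast
  rw [two_smul]

/-- Taking the adjoint of `conjCauchyMatrix` restores `F` and replaces the weighted resolvent by its
adjoint, so the two integrals combine into one against the positive kernel. -/
theorem resolventIntegral_add_eq {Ω : Set ℂ} {γ : ℝ → ℂ} (hΩ : IsConvexContour Ω γ)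
    (hA : numericalRange A ⊆ Ω) {F : ℂ → Matrix m p ℂ} (hF : ContinuousOn F (closure Ω)) :
    resolventIntegral γ A F + (conjCauchyMatrix γ F A)ᴴ =
      ∫ t in (0 : ℝ)..(2 * Real.pi), F (γ t) ⊗ₖ doubleLayerMatrix γ A t := by
  have hR := hΩ.continuous_resolvent hA
  have hFc := hΩ.continuous_comp hF
  set w : ℝ → ℂ := fun t => (2 * Real.pi * Complex.I : ℂ)⁻¹ * deriv γ t with hw
  have hwc : Continuous w := continuous_const.mul hΩ.continuous_deriv
  have hc1 : Continuous fun t => F (γ t) ⊗ₖ (w t • (γ t • (1 : Matrix a a ℂ) - A)⁻¹) :=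
    hFc.kronecker (hwc.smul hR)
  have hc2 : Continuous fun t => (F (γ t))ᴴ ⊗ₖ (w t • (γ t • (1 : Matrix a a ℂ) - A)⁻¹) :=
    hFc.matrix_conjTranspose'.kronecker (hwc.smul hR)
  have e1 : resolventIntegral γ A F = ∫ t in (0 : ℝ)..(2 * Real.pi),
      F (γ t) ⊗ₖ (w t • (γ t • (1 : Matrix a a ℂ) - A)⁻¹) := by
    rw [resolventIntegral, contourIntegral, ← intervalIntegral.integral_smul]
    congr 1
    funext t
    rw [Matrix.kronecker_smul, smul_smul]
  have e2 : conjCauchyMatrix γ F A = ∫ t in (0 : ℝ)..(2 * Real.pi),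
      (F (γ t))ᴴ ⊗ₖ (w t • (γ t • (1 : Matrix a a ℂ) - A)⁻¹) := by
    rw [conjCauchyMatrix, ← intervalIntegral.integral_smul]
    congr 1
    funext t
    rw [Matrix.kronecker_smul, smul_smul]
  have e3 := (conjTransposeCLM (p × a) (m × a)).intervalIntegral_comp_comm
    (hc2.intervalIntegrable (μ := volume) 0 (2 * Real.pi))
  simp only [conjTransposeCLM_apply, Matrix.conjTranspose_kronecker,
    Matrix.conjTranspose_conjTranspose] at e3
  rw [e1, e2, ← e3, ← intervalIntegral.integral_add (hc1.intervalIntegrable _ _)]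
  · congr 1
    funext t
    rw [doubleLayerMatrix, Matrix.kronecker_add]
  · exact (hFc.kronecker (hwc.smul hR).matrix_conjTranspose').intervalIntegrable _ _

theorem norm_resolventIntegral_add_le (H : IsSupportFunction h h₁ ρ)
    (hne : (supportDomain h).Nonempty)
    (hA : numericalRange A ⊆ supportDomain h) {F : ℂ → Matrix m p ℂ}
    (hF : ContinuousOn F (closure (supportDomain h)))
    (hF1 : ∀ z ∈ closure (supportDomain h), ‖F z‖ ≤ 1) :
    ‖resolventIntegral (supportCurve h h₁) A F +
      (conjCauchyMatrix (supportCurve h h₁) F A)ᴴ‖ ≤ 2 := by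
  have hΩ := H.isConvexContour hne
  have hR := hΩ.continuous_resolvent hA
  rw [resolventIntegral_add_eq hΩ hA hF]
  have hM : Continuous (doubleLayerMatrix (supportCurve h h₁) A) := by
    have := (continuous_const (y := (2 * Real.pi * Complex.I : ℂ)⁻¹)).mul hΩ.continuous_deriv
    exact (this.smul hR).add (this.smul hR).matrix_conjTranspose'
  have := norm_integral_kronecker_le (φ := fun t => F (supportCurve h h₁ t)) (C := 1) (D := 2)
    Real.two_pi_pos.le (hΩ.continuous_comp hF) hM (H.posSemidef_doubleLayerMatrix hA)
    (fun t => hF1 _ (hΩ.mem_closure t)) (integral_doubleLayerMatrix hΩ hA) (by norm_num)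
  simpa using this

theorem resolventIntegral_smul (γ : ℝ → ℂ) (A : Matrix a a ℂ) (c : ℂ) (F : ℂ → Matrix m p ℂ) :
    resolventIntegral γ A (fun z => c • F z) = c • resolventIntegral γ A F := by
  simp only [resolventIntegral, Matrix.smul_kronecker, contourIntegral_smul]
  rw [smul_comm]

/-- For `r < 1` let `g` be the contracted transform. By multiplicativity `F g F`, again of size `m ×
p`, has at `A` the value `X * conjCauchyMatrix γ F (matrixDilate c r A) * X`, and its norm on the
domain is at most `1 + 4 * η`. Then `r → 1` and `η → 0`. -/
theorem norm_mul_conjCauchyMatrix_mul_le {Ω : Set ℂ} {γ : ℝ → ℂ} (hΩ : IsConvexContour Ω γ)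
    (hA : numericalRange A ⊆ Ω) {F : ℂ → Matrix m p ℂ} (hF : DiffContOnCl ℂ F Ω)
    (hF1 : ∀ z ∈ closure Ω, ‖F z‖ ≤ 1) {c : ℂ} (hc : c ∈ Ω)
    (hg : ∀ η : ℝ, 0 < η → ∀ᶠ r : ℝ in 𝓝[<] 1, ∀ z ∈ closure Ω,
      ‖conjCauchy γ F (dilate c r z)‖ ≤ 1 + 4 * η) {K : ℝ} (hK0 : 0 ≤ K)
    (hK : ∀ G : ℂ → Matrix m p ℂ, DiffContOnCl ℂ G Ω → (∀ z ∈ closure Ω, ‖G z‖ ≤ 1) →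
      ‖resolventIntegral γ A G‖ ≤ K) {X : Matrix (m × a) (p × a) ℂ}
    (hX : HasMatrixValue Ω A F X) : ‖X * conjCauchyMatrix γ F A * X‖ ≤ K := by
  have hη : ∀ η : ℝ, 0 < η → ‖X * conjCauchyMatrix γ F A * X‖ ≤ K * (1 + 4 * η) := by
    intro η hη
    have hlim : Tendsto (fun r : ℝ => ‖X * conjCauchyMatrix γ F (matrixDilate c r A) * X‖)
        (𝓝[<] 1) (𝓝 ‖X * conjCauchyMatrix γ F A * X‖) := by
      have h1 := hΩ.tendsto_conjCauchyMatrix hA hF.continuousOn hc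
      have h2 : Continuous fun Z : Matrix (p × a) (m × a) ℂ => ‖X * Z * X‖ := by fun_prop
      exact (h2.tendsto _).comp h1
    refine le_of_tendsto hlim ?_
    have hpos : ∀ᶠ r : ℝ in 𝓝[<] 1, 0 ≤ r :=
      nhdsWithin_le_nhds ((eventually_gt_nhds (zero_lt_one' ℝ)).mono fun r hr => hr.le)
    filter_upwards [hg η hη, hpos, self_mem_nhdsWithin] with r hr hr0 hr1
    have hgd := IsConvexContour.diffContOnCl_comp_dilate hΩ.isOpen hΩ.convex
      (hΩ.differentiableOn_conjCauchy hF.continuousOn) hc (r := r) ⟨hr0, hr1⟩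
    have hval := hΩ.hasMatrixValue_conjCauchy hA hF.continuousOn hc (r := r) ⟨hr0, hr1⟩
    generalize hgdef : (fun z => conjCauchy γ F (dilate c r z)) = g at hgd hval
    have hg1 : ∀ z ∈ closure Ω, ‖g z‖ ≤ 1 + 4 * η := fun z hz => hgdef ▸ hr z hz
    have e1 : resolventIntegral γ A (fun z => F z * g z * F z) =
        X * conjCauchyMatrix γ F (matrixDilate c r A) * X := by
      rw [hX.resolventIntegral_mul hΩ hA (F := fun z => F z * g z) (hF.matrix_mul hgd),
        hval.resolventIntegral_mul hΩ hA hF, hX.resolventIntegral_eq hΩ hA]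
    have hpos : (0 : ℝ) < 1 + 4 * η := by positivity
    have h2 := hK (fun z => (((1 + 4 * η)⁻¹ : ℝ) : ℂ) • (F z * g z * F z))
      (((hF.matrix_mul hgd).matrix_mul hF).const_smul (((1 + 4 * η)⁻¹ : ℝ) : ℂ)) fun z hz => by
        rw [norm_smul, Complex.norm_real, Real.norm_of_nonneg (by positivity), inv_mul_le_iff₀ hpos,
          mul_one]
        calc ‖F z * g z * F z‖ ≤ ‖F z‖ * ‖g z‖ * ‖F z‖ :=
              (Matrix.l2_opNorm_mul _ _).trans
                (mul_le_mul_of_nonneg_right (Matrix.l2_opNorm_mul _ _) (norm_nonneg _))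
          _ ≤ 1 * (1 + 4 * η) * 1 := by
              gcongr
              · exact hF1 z hz
              · exact hg1 z hz
              · exact hF1 z hz
          _ = 1 + 4 * η := by ring
    rw [resolventIntegral_smul, e1, norm_smul, Complex.norm_real,
      Real.norm_of_nonneg (by positivity), inv_mul_le_iff₀ hpos] at h2
    rwa [mul_comm] at h2
  refine le_of_forall_pos_le_add fun ε hε => (hη (ε / (4 * (K + 1))) (by positivity)).trans ?_
  have h1 : K * (1 + 4 * (ε / (4 * (K + 1)))) = K + ε * (K / (K + 1)) := by field_simp
  rw [h1]
  have h2 : K / (K + 1) ≤ 1 := (div_le_one (by positivity)).2 (by linarith)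
  nlinarith

/-- The **Crouzeix–Palencia theorem** for matrix valued functions on a domain with a smooth
support function. -/
theorem norm_resolventIntegral_le (H : IsSupportFunction h h₁ ρ)
    (hne : (supportDomain h).Nonempty) (hA : numericalRange A ⊆ supportDomain h)
    {F : ℂ → Matrix m p ℂ} (hF : DiffContOnCl ℂ F (supportDomain h))
    (hF1 : ∀ z ∈ closure (supportDomain h), ‖F z‖ ≤ 1) :
    ‖resolventIntegral (supportCurve h h₁) A F‖ ≤ 1 + Real.sqrt 2 := by
  have hΩ := H.isConvexContour hne
  obtain ⟨c, hc⟩ := hne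
  set Ω := supportDomain h with hΩdef
  set γ := supportCurve h h₁ with hγ
  obtain ⟨C, hC⟩ := hΩ.exists_bound_resolventIntegral hA m p
  set S : Set ℝ := {x | ∃ F : ℂ → Matrix m p ℂ, DiffContOnCl ℂ F Ω ∧
    (∀ z ∈ closure Ω, ‖F z‖ ≤ 1) ∧ x = ‖resolventIntegral γ A F‖} with hS
  have hbdd : BddAbove S := ⟨C, by rintro _ ⟨F, -, hF1, rfl⟩; exact hC F hF1⟩
  refine le_one_add_sqrt_two (S := S) ⟨_, F, hF, hF1, rfl⟩ hbdd ?_ ?_ ⟨F, hF, hF1, rfl⟩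
  · rintro _ ⟨F, -, -, rfl⟩; exact norm_nonneg _
  rintro _ ⟨F, hF, hF1, rfl⟩
  set K := sSup S with hK
  have hK0 : 0 ≤ K := (norm_nonneg _).trans (le_csSup hbdd ⟨F, hF, hF1, rfl⟩)
  obtain ⟨X, hX⟩ := exists_hasMatrixValue hΩ.isOpen hA hF
  rw [hX.resolventIntegral_eq hΩ hA]
  set Y := conjCauchyMatrix γ F A with hY
  have hXY : ‖X * Y * X‖ ≤ K :=
    norm_mul_conjCauchyMatrix_mul_le hΩ hA hF hF1 hc
      (fun η hη => H.eventually_norm_conjCauchy_le hF hF1 hc hη) hK0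
      (fun G hG hG1 => le_csSup hbdd ⟨G, hG, hG1, rfl⟩) hX
  have h2 : ‖X + Yᴴ‖ ≤ 2 := by
    have := H.norm_resolventIntegral_add_le ⟨c, hc⟩ hA hF.continuousOn hF1
    rwa [hX.resolventIntegral_eq hΩ hA] at this
  -- The extremal identity: the first term is quadratic in `‖X‖` by `h2`, the second is bounded by
  -- `K` itself by `hXY`.
  have h3 : X * Xᴴ * X = X * (X + Yᴴ)ᴴ * X - X * Y * X := by
    rw [Matrix.conjTranspose_add, Matrix.conjTranspose_conjTranspose, Matrix.mul_add,
      Matrix.add_mul, add_sub_cancel_right]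
  calc ‖X‖ ^ 3 ≤ ‖X * Xᴴ * X‖ := norm_pow_three_le X
    _ ≤ ‖X * (X + Yᴴ)ᴴ * X‖ + ‖X * Y * X‖ := by rw [h3]; exact norm_sub_le _ _
    _ ≤ 2 * ‖X‖ ^ 2 + K := by
      refine add_le_add ?_ hXY
      calc ‖X * (X + Yᴴ)ᴴ * X‖ ≤ ‖X‖ * ‖(X + Yᴴ)ᴴ‖ * ‖X‖ :=
            (Matrix.l2_opNorm_mul _ _).trans
              (mul_le_mul_of_nonneg_right (Matrix.l2_opNorm_mul _ _) (norm_nonneg _))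
        _ ≤ ‖X‖ * 2 * ‖X‖ := by
            rw [Matrix.l2_opNorm_conjTranspose]; gcongr
        _ = 2 * ‖X‖ ^ 2 := by ring

end IsSupportFunction

end CrouzeixPalencia

/-! ### Smoothing of support functions by averaging. -/

section Mollification

/-- The average of `k` over the interval of radius `δ` around `θ`. -/
def movingAverage (δ : ℝ) (k : ℝ → ℝ) (θ : ℝ) : ℝ := (2 * δ)⁻¹ * ∫ u in (-δ)..δ, k (θ + u)

/-- The inequality satisfied by the support functions of convex sets. -/
def IsTrigConvex (k : ℝ → ℝ) : Prop :=
  ∀ θ s, 2 * Real.cos s * k θ ≤ k (θ + s) + k (θ - s)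

variable {δ : ℝ} {k : ℝ → ℝ}

theorem hasDerivAt_movingAverage (hk : Continuous k) (δ θ : ℝ) :
    HasDerivAt (movingAverage δ k) ((2 * δ)⁻¹ * (k (θ + δ) - k (θ - δ))) θ := by
  have hG : ∀ x, HasDerivAt (fun x => ∫ u in (0 : ℝ)..x, k u) (k x) x := fun x =>
    (hk.integral_hasStrictDerivAt 0 x).hasDerivAt
  have e : movingAverage δ k = fun θ => (2 * δ)⁻¹ *
      ((∫ u in (0 : ℝ)..(θ + δ), k u) - ∫ u in (0 : ℝ)..(θ - δ), k u) := by
    funext θ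
    rw [movingAverage, intervalIntegral.integral_interval_sub_left (hk.intervalIntegrable _ _)
      (hk.intervalIntegrable _ _), intervalIntegral.integral_comp_add_left (fun u => k u) θ,
      ← sub_eq_add_neg]
  rw [e]
  exact (((hG (θ + δ)).comp_add_const θ δ).sub ((hG (θ - δ)).comp_sub_const θ δ)).const_mul _

theorem continuous_movingAverage (hk : Continuous k) (δ : ℝ) : Continuous (movingAverage δ k) :=
  continuous_iff_continuousAt.2 fun θ => (hasDerivAt_movingAverage hk δ θ).continuousAt

theorem movingAverage_periodic (hp : ∀ t, k (t + 2 * Real.pi) = k t) (δ t : ℝ) :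
    movingAverage δ k (t + 2 * Real.pi) = movingAverage δ k t := by
  simp only [movingAverage, add_right_comm t, hp]

theorem movingAverage_mem_Icc (hδ : 0 < δ) (hk : Continuous k) {θ x y : ℝ}
    (h : ∀ u ∈ Icc (-δ) δ, k (θ + u) ∈ Icc x y) : movingAverage δ k θ ∈ Icc x y := by
  have hki : IntervalIntegrable (fun u => k (θ + u)) volume (-δ) δ :=
    (hk.comp (continuous_const.add continuous_id)).intervalIntegrable _ _
  have h1 := intervalIntegral.integral_mono_on (by linarith) intervalIntegrable_const hki
    fun u hu => (h u hu).1
  have h2 := intervalIntegral.integral_mono_on (by linarith) hki intervalIntegrable_const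
    fun u hu => (h u hu).2
  rw [intervalIntegral.integral_const, smul_eq_mul] at h1 h2
  have e : δ - -δ = 2 * δ := by ring
  rw [e] at h1 h2
  exact ⟨(le_inv_mul_iff₀ (by positivity)).2 h1, (inv_mul_le_iff₀ (by positivity)).2 h2⟩

theorem IsTrigConvex.movingAverage (hδ : 0 < δ) (hk : Continuous k) (h : IsTrigConvex k) :
    IsTrigConvex (movingAverage δ k) := by
  intro θ s
  have hc : ∀ x : ℝ, Continuous fun u => k (x + u) := fun x => by fun_prop
  simp only [_root_.movingAverage]
  rw [← mul_add, mul_left_comm, ← intervalIntegral.integral_const_mul,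
    ← intervalIntegral.integral_add ((hc _).intervalIntegrable _ _)
      ((hc _).intervalIntegrable _ _)]
  refine mul_le_mul_of_nonneg_left ?_ (by positivity)
  refine intervalIntegral.integral_mono_on (by linarith)
    (((hc _).const_mul _).intervalIntegrable _ _)
    (((hc _).add (hc _)).intervalIntegrable _ _) fun u _ => ?_
  have := h (θ + u) s
  rwa [add_right_comm, add_sub_right_comm] at this

/-- Integrate the defining inequality over `s ∈ [-δ, δ]`; the factor `sin δ / δ` is the mean of the
cosine there. -/
theorem IsTrigConvex.le_movingAverage (hδ : 0 < δ) (hk : Continuous k) (h : IsTrigConvex k)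
    (θ : ℝ) : Real.sin δ / δ * k θ ≤ _root_.movingAverage δ k θ := by
  have hc : Continuous fun u => k (θ + u) := by fun_prop
  have hc' : Continuous fun u => k (θ - u) := by fun_prop
  have e1 : ∫ u in (-δ)..δ, k (θ - u) = ∫ u in (-δ)..δ, k (θ + u) := by
    have := intervalIntegral.integral_comp_neg (a := -δ) (b := δ) (fun u => k (θ + u))
    simpa [sub_eq_add_neg] using this
  have h1 : ∫ u in (-δ)..δ, 2 * Real.cos u * k θ ≤ ∫ u in (-δ)..δ, (k (θ + u) + k (θ - u)) :=
    intervalIntegral.integral_mono_on (by linarith)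
      ((by fun_prop : Continuous fun u => 2 * Real.cos u * k θ).intervalIntegrable _ _)
      ((hc.add hc').intervalIntegrable _ _) fun u _ => h θ u
  rw [intervalIntegral.integral_add (hc.intervalIntegrable _ _) (hc'.intervalIntegrable _ _), e1,
    intervalIntegral.integral_mul_const, intervalIntegral.integral_const_mul, integral_cos,
    Real.sin_neg] at h1
  rw [_root_.movingAverage, le_inv_mul_iff₀ (by positivity)]
  have : 2 * δ * (Real.sin δ / δ * k θ) = 2 * Real.sin δ * k θ := by field_simp
  rw [this]
  linarith

/-- Two averages make a continuous function `C²`, with second derivative the second difference of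
`k` at step `2δ` divided by `(2δ)²`. Trigonometric convexity bounds this difference below by `-(sin
δ / δ)² k`, and the twice averaged function is at least `(sin δ / δ)² k`; the constant `ε` makes the
radius of curvature strictly positive. -/
theorem IsTrigConvex.isSupportFunction (hδ : δ ∈ Ioo 0 Real.pi) (hk : Continuous k)
    (h : IsTrigConvex k) (hp : ∀ t, k (t + 2 * Real.pi) = k t) {ε : ℝ} (hε : 0 < ε) :
    IsSupportFunction (fun t => _root_.movingAverage δ (_root_.movingAverage δ k) t + ε)
      (fun t => (2 * δ)⁻¹ * (_root_.movingAverage δ k (t + δ) - _root_.movingAverage δ k (t - δ)))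
      (fun t => _root_.movingAverage δ (_root_.movingAverage δ k) t + ε +
        (2 * δ)⁻¹ * ((2 * δ)⁻¹ * (k (t + δ + δ) - k (t + δ - δ)) -
          (2 * δ)⁻¹ * (k (t - δ + δ) - k (t - δ - δ)))) := by
  have hmk := continuous_movingAverage hk δ
  refine ⟨fun t => (hasDerivAt_movingAverage hmk δ t).add_const ε, fun t => ?_, ?_, fun t => ?_,
    fun t => ?_⟩
  · rw [add_sub_cancel_left]
    exact (((hasDerivAt_movingAverage hk δ (t + δ)).comp_add_const t δ).sub
      ((hasDerivAt_movingAverage hk δ (t - δ)).comp_sub_const t δ)).const_mul _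
  · have := continuous_movingAverage hmk δ
    fun_prop
  · have hs : 0 < Real.sin δ := Real.sin_pos_of_mem_Ioo hδ
    have h1 := (h.movingAverage hδ.1 hk).le_movingAverage hδ.1 hmk t
    have h2 : Real.sin δ / δ * (Real.sin δ / δ * k t) ≤ Real.sin δ / δ * _root_.movingAverage δ k t :=
      mul_le_mul_of_nonneg_left (h.le_movingAverage hδ.1 hk t) (div_nonneg hs.le hδ.1.le)
    have h3 := h t (2 * δ)
    have e1 : t + δ + δ = t + 2 * δ := by ring
    have e2 : t - δ - δ = t - 2 * δ := by ring
    rw [e1, e2, add_sub_cancel_right, sub_add_cancel]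
    -- The identity `2 - 2 cos 2δ = 4 sin² δ` makes the two lower bounds cancel exactly.
    have h4 : Real.sin δ / δ * (Real.sin δ / δ * k t) =
        (2 * δ)⁻¹ * (2 * δ)⁻¹ * (2 * k t - 2 * Real.cos (2 * δ) * k t) := by
      have hδ0 := hδ.1.ne'
      rw [Real.cos_two_mul, Real.cos_sq']
      field_simp
      ring
    have h5 := mul_le_mul_of_nonneg_left h3
      (mul_self_nonneg ((2 * δ)⁻¹))
    have h6 : (2 * δ)⁻¹ * (2 * δ)⁻¹ * (2 * k t - 2 * Real.cos (2 * δ) * k t) =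
      (2 * δ)⁻¹ * (2 * δ)⁻¹ * (2 * k t) - (2 * δ)⁻¹ * (2 * δ)⁻¹ * (2 * Real.cos (2 * δ) * k t) := by
      ring
    have h7 : (2 * δ)⁻¹ * ((2 * δ)⁻¹ * (k (t + 2 * δ) - k t) - (2 * δ)⁻¹ * (k t - k (t - 2 * δ))) =
      (2 * δ)⁻¹ * (2 * δ)⁻¹ * (k (t + 2 * δ) + k (t - 2 * δ)) -
        (2 * δ)⁻¹ * (2 * δ)⁻¹ * (2 * k t) := by ring
    rw [h7]
    linarith
  · rw [movingAverage_periodic (movingAverage_periodic hp δ)]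

theorem uniformContinuous_of_periodic (hk : Continuous k) {T : ℝ} (hT : 0 < T)
    (hp : Function.Periodic k T) : UniformContinuous k := by
  have : Fact (0 < T) := ⟨hT⟩
  have h1 : Continuous (hp.lift : AddCircle T → ℝ) := continuous_quot_lift _ hk
  have h2 : UniformContinuous ((↑) : ℝ → AddCircle T) :=
    uniformContinuous_addMonoidHom_of_continuous (f := QuotientAddGroup.mk' (AddSubgroup.zmultiples T))
      (AddCircle.continuous_mk' T)
  exact (CompactSpace.uniformContinuous_of_continuous h1).comp h2

/-- Two averages over radius `d ≤ δ / 3` shift the argument by less than `δ`, so they change `k` by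
at most `ε / 4`; adding `ε / 2` puts the result strictly above `k`. The bound `d ≤ 1` ensures `d <
π`. -/
theorem exists_isSupportFunction_lt (hk : Continuous k) (h : IsTrigConvex k)
    (hp : ∀ t, k (t + 2 * Real.pi) = k t) {ε : ℝ} (hε : 0 < ε) :
    ∃ g g₁ ρ : ℝ → ℝ, IsSupportFunction g g₁ ρ ∧ ∀ t, k t < g t ∧ g t ≤ k t + ε := by
  have hu : UniformContinuous k := uniformContinuous_of_periodic hk Real.two_pi_pos hp
  obtain ⟨δ, hδ, hδk⟩ := Metric.uniformContinuous_iff.1 hu (ε / 4) (by positivity)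
  set d := min (δ / 3) 1 with hd
  have hd0 : 0 < d := lt_min (by positivity) one_pos
  have hd1 : d ≤ 1 := min_le_right _ _
  have hd2 : d ≤ δ / 3 := min_le_left _ _
  refine ⟨_, _, _, h.isSupportFunction (δ := d) ⟨hd0, hd1.trans_lt (by linarith [Real.pi_gt_three])⟩
    hk hp (half_pos hε), fun t => ?_⟩
  have : _root_.movingAverage d (_root_.movingAverage d k) t ∈ Icc (k t - ε / 4) (k t + ε / 4) := by
    refine movingAverage_mem_Icc hd0 (continuous_movingAverage hk d) fun u hu => ?_
    refine movingAverage_mem_Icc hd0 hk fun v hv => ?_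
    have := hδk (a := t + u + v) (b := t) (by
      rw [Real.dist_eq, abs_lt]
      constructor <;> linarith [hu.1, hu.2, hv.1, hv.2])
    rw [Real.dist_eq, abs_lt] at this
    constructor <;> linarith
  constructor <;> linarith [this.1, this.2]

end Mollification

/-! ### Outer approximation of compact convex sets by support domains. -/

section Approximation

variable {K : Set ℂ}

/-- The support function of a plane set. -/
def supportFunction (K : Set ℂ) (θ : ℝ) : ℝ := sSup (dirRe θ '' K)

theorem continuous_dirRe_right (θ : ℝ) : Continuous (dirRe θ) :=
  continuous_dirRe.comp (continuous_id.prodMk continuous_const)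

theorem continuous_supportFunction (hK : IsCompact K) : Continuous (supportFunction K) :=
  hK.continuous_sSup (f := dirRe) (continuous_dirRe.comp continuous_swap)

theorem dirRe_le_supportFunction (hK : IsCompact K) {w : ℂ} (hw : w ∈ K) (θ : ℝ) :
    dirRe θ w ≤ supportFunction K θ :=
  le_csSup (hK.image (continuous_dirRe_right θ)).bddAbove (mem_image_of_mem _ hw)

theorem exists_supportFunction_eq (hK : IsCompact K) (hne : K.Nonempty) (θ : ℝ) :
    ∃ w ∈ K, supportFunction K θ = dirRe θ w :=
  hK.exists_sSup_image_eq hne (continuous_dirRe_right θ).continuousOn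

theorem dirRe_add_dirRe (θ s : ℝ) (w : ℂ) :
    dirRe (θ + s) w + dirRe (θ - s) w = 2 * Real.cos s * dirRe θ w := by
  have h1 : unitVec (-(θ + s)) = unitVec (-θ) * unitVec (-s) := by rw [← unitVec_add]; ring_nf
  have h2 : unitVec (-(θ - s)) = unitVec (-θ) * unitVec s := by rw [← unitVec_add]; ring_nf
  have h3 : unitVec (-s) + unitVec s = ((2 * Real.cos s : ℝ) : ℂ) := by
    apply Complex.ext
    · simp only [Complex.add_re, unitVec_re, Real.cos_neg, Complex.ofReal_re]; ring
    · simp [unitVec_im]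
  have h4 : dirRe (θ + s) w + dirRe (θ - s) w =
      (((2 * Real.cos s : ℝ) : ℂ) * (unitVec (-θ) * w)).re := by
    rw [← h3, dirRe, dirRe, h1, h2, ← Complex.add_re]
    ring_nf
  rw [h4, Complex.re_ofReal_mul, dirRe]

/-- A point of `K` that is extremal in direction `θ` is a competitor in the directions `θ ± s`, and
for a single point the inequality is an equality. -/
theorem isTrigConvex_supportFunction (hK : IsCompact K) (hne : K.Nonempty) :
    IsTrigConvex (supportFunction K) := by
  intro θ s
  obtain ⟨w, hw, h⟩ := exists_supportFunction_eq hK hne θ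
  rw [h, ← dirRe_add_dirRe]
  exact add_le_add (dirRe_le_supportFunction hK hw _) (dirRe_le_supportFunction hK hw _)

/-- Let `v` be the nearest point of `K` to `z`. The direction of `z - v` supports `K` at `v`, so in
that direction the hypothesis says exactly that `‖z - v‖ ≤ ε`. -/
theorem mem_cthickening_of_dirRe_le (hK : IsCompact K) (hconv : Convex ℝ K) (hne : K.Nonempty)
    {ε : ℝ} (hε : 0 ≤ ε) {z : ℂ} (hz : ∀ θ, dirRe θ z ≤ supportFunction K θ + ε) :
    z ∈ Metric.cthickening ε K := by
  obtain ⟨v, hv, hmin⟩ := exists_norm_eq_iInf_of_complete_convex hne hK.isComplete hconv z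
  rw [norm_eq_iInf_iff_real_inner_le_zero hconv hv] at hmin
  refine Metric.mem_cthickening_of_dist_le z v ε K hv ?_
  set θ := (z - v).arg with hθ
  have hzv : z - v = ‖z - v‖ * unitVec θ := (Complex.norm_mul_exp_arg_mul_I _).symm
  have hdir : ∀ w : ℂ, ‖z - v‖ * dirRe θ w = inner ℝ (z - v) w := by
    intro w
    have : (starRingEnd ℂ) (z - v) = ‖z - v‖ * unitVec (-θ) := by
      conv_lhs => rw [hzv]
      rw [map_mul, Complex.conj_ofReal, conj_unitVec]
    rw [Complex.inner, this, dirRe, mul_comm w, mul_assoc, Complex.re_ofReal_mul]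
  rw [dist_eq_norm]
  rcases (norm_nonneg (z - v)).eq_or_lt with h0 | h0
  · rwa [← h0]
  obtain ⟨w, hw, h⟩ := exists_supportFunction_eq hK hne θ
  have h1 : dirRe θ (w - v) ≤ 0 := by
    have := hmin w hw
    rw [← hdir] at this
    exact nonpos_of_mul_nonpos_right this h0
  have h2 : dirRe θ (z - v) = ‖z - v‖ := by
    have : ‖z - v‖ * dirRe θ (z - v) = ‖z - v‖ * ‖z - v‖ := by
      rw [hdir, real_inner_self_eq_norm_mul_norm]
    exact mul_left_cancel₀ h0.ne' this
  rw [← h2, dirRe_sub]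
  rw [dirRe_sub] at h1
  linarith [hz θ]

theorem exists_supportDomain (hK : IsCompact K) (hconv : Convex ℝ K) (hne : K.Nonempty)
    {ε : ℝ} (hε : 0 < ε) :
    ∃ h h₁ ρ : ℝ → ℝ, IsSupportFunction h h₁ ρ ∧ K ⊆ supportDomain h ∧
      closure (supportDomain h) ⊆ Metric.cthickening ε K := by
  have hp : ∀ t, supportFunction K (t + 2 * Real.pi) = supportFunction K t := fun t => by
    have : dirRe (t + 2 * Real.pi) = dirRe t := funext (dirRe_periodic t)
    rw [supportFunction, this, supportFunction]
  obtain ⟨h, h₁, ρ, H, hb⟩ := exists_isSupportFunction_lt (continuous_supportFunction hK)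
    (isTrigConvex_supportFunction hK hne) hp hε
  refine ⟨h, h₁, ρ, H, fun w hw θ => (dirRe_le_supportFunction hK hw θ).trans_lt (hb θ).1,
    fun z hz => mem_cthickening_of_dirRe_le hK hconv hne hε.le fun θ => ?_⟩
  exact (IsSupportFunction.dirRe_le_of_mem_closure h hz θ).trans (hb θ).2

end Approximation

/-! ### From support domains to the numerical range, then to two variables. -/

section SpectralBound

variable {m p a b : Type*} [Fintype m] [Fintype p] [Fintype a] [Fintype b]
  [DecidableEq m] [DecidableEq p] [DecidableEq a] [DecidableEq b]

/-- The numerical range is a `(1 + √2)`-spectral set for matrix valued functions. -/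
theorem IsConvexContour.norm_resolventIntegral_le [Nonempty a] {Ω : Set ℂ} {γ : ℝ → ℂ}
    (hΩ : IsConvexContour Ω γ) {A : Matrix a a ℂ} (hA : numericalRange A ⊆ Ω)
    {F : ℂ → Matrix m p ℂ} (hF : DiffContOnCl ℂ F Ω) {M : ℝ}
    (hM : ∀ z ∈ numericalRange A, ‖F z‖ ≤ M) :
    ‖resolventIntegral γ A F‖ ≤ (1 + Real.sqrt 2) * M := by
  have hne := numericalRange_nonempty A
  have hM0 : 0 ≤ M := (norm_nonneg _).trans (hM _ hne.some_mem)
  have key : ∀ η : ℝ, 0 < η → ‖resolventIntegral γ A F‖ ≤ (1 + Real.sqrt 2) * (M + η) := by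
    intro η hη
    -- A neighbourhood of `W(A)` on which `‖F‖` exceeds `M` by less than `η`; a support domain fits
    -- between it and `W(A)`.
    have hU : IsOpen (Ω ∩ (fun z => ‖F z‖) ⁻¹' Iio (M + η)) :=
      (hF.continuousOn.mono subset_closure).norm.isOpen_inter_preimage hΩ.isOpen isOpen_Iio
    obtain ⟨δ, hδ, hδU⟩ := (isCompact_numericalRange A).exists_cthickening_subset_open hU
      fun z hz => ⟨hA hz, (hM z hz).trans_lt (lt_add_of_pos_right M hη)⟩
    obtain ⟨h, h₁, ρ, H, hAh, hcl⟩ := exists_supportDomain (isCompact_numericalRange A)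
      (convex_numericalRange A) hne hδ
    have hsub := hcl.trans hδU
    have hDΩ : supportDomain h ⊆ Ω := fun z hz => (hsub (subset_closure hz)).1
    have hne' : (supportDomain h).Nonempty := hne.mono hAh
    obtain ⟨X, hX⟩ := exists_hasMatrixValue hΩ.isOpen hA hF
    have hMη : 0 < M + η := by positivity
    -- The same `X` is the value of `F` at `A` on both domains, so the contour may be moved to the
    -- smaller one.
    rw [hX.resolventIntegral_eq hΩ hA,
      ← (hX.mono hDΩ).resolventIntegral_eq (H.isConvexContour hne') hAh]
    have := H.norm_resolventIntegral_le hne' hAh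
      ((hF.mono hDΩ).const_smul (((M + η)⁻¹ : ℝ) : ℂ)) fun z hz => by
        have hz' : ‖F z‖ < M + η := (hsub hz).2
        rw [Pi.smul_apply, norm_smul, Complex.norm_real, Real.norm_of_nonneg (by positivity),
          inv_mul_le_iff₀ hMη, mul_one]
        exact hz'.le
    change ‖resolventIntegral _ A (fun z => (((M + η)⁻¹ : ℝ) : ℂ) • F z)‖ ≤ _ at this
    rwa [IsSupportFunction.resolventIntegral_smul, norm_smul, Complex.norm_real,
      Real.norm_of_nonneg (by positivity), inv_mul_le_iff₀ hMη, mul_comm] at this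
  have hs : 0 < 1 + Real.sqrt 2 := by positivity
  refine le_of_forall_pos_le_add fun ε hε => (key (ε / (1 + Real.sqrt 2)) (by positivity)).trans ?_
  rw [mul_add, mul_div_cancel₀ _ hs.ne']

/-- The inner contour runs over the boundary, where analyticity in the other variable is not
assumed. It follows there from uniform continuity on the compact product, as a uniform limit of
holomorphic slices. -/
theorem differentiableOn_of_mem_closure {E : Type*} [NormedAddCommGroup E] [NormedSpace ℂ E]
    [CompleteSpace E] {U V : Set ℂ} (hU : IsOpen U) (hUb : Bornology.IsBounded U)
    (hVb : Bornology.IsBounded V) {F : ℂ × ℂ → E}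
    (hc : ContinuousOn F (closure U ×ˢ closure V))
    (hd : ∀ y ∈ V, DifferentiableOn ℂ (fun x => F (x, y)) U) {y : ℂ} (hy : y ∈ closure V) :
    DifferentiableOn ℂ (fun x => F (x, y)) U := by
  have hK : IsCompact (closure U ×ˢ closure V) := hUb.isCompact_closure.prod hVb.isCompact_closure
  have hu := Metric.uniformContinuousOn_iff.1 (hK.uniformContinuousOn_of_continuous hc)
  have : (𝓝[V] y).NeBot := mem_closure_iff_nhdsWithin_neBot.1 hy
  refine TendstoLocallyUniformlyOn.differentiableOn (F := fun y' x => F (x, y')) (φ := 𝓝[V] y)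
    (TendstoUniformlyOn.tendstoLocallyUniformlyOn ?_) (eventually_mem_nhdsWithin.mono hd) hU
  rw [Metric.tendstoUniformlyOn_iff]
  intro ε hε
  obtain ⟨δ, hδ, h⟩ := hu ε hε
  filter_upwards [eventually_mem_nhdsWithin, nhdsWithin_le_nhds (Metric.ball_mem_nhds y hδ)]
    with y' hy' hyd x hx
  refine h _ ⟨subset_closure hx, hy⟩ _ ⟨subset_closure hx, subset_closure hy'⟩ ?_
  rw [Prod.dist_eq, dist_self, max_lt_iff]
  exact ⟨hδ, by rwa [dist_comm]⟩

variable {ΩA ΩB : Set ℂ} {γA γB : ℝ → ℂ} {A : Matrix a a ℂ} {B : Matrix b b ℂ}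
  {F : ℂ × ℂ → Matrix m p ℂ}

theorem diffContOnCl_resolventIntegral (hΩA : IsConvexContour ΩA γA)
    (hΩB : IsConvexContour ΩB γB) (hB : numericalRange B ⊆ ΩB)
    (hF : ∀ y ∈ ΩB, DifferentiableOn ℂ (fun x => F (x, y)) ΩA)
    (hFc : ContinuousOn F (closure ΩA ×ˢ closure ΩB)) :
    DiffContOnCl ℂ (fun x => resolventIntegral γB B fun y => F (x, y)) ΩA := by
  have hR := hΩB.continuous_resolvent hB
  have hc : ContinuousOn (fun q : ℂ × ℝ => deriv γB q.2 •
      (F (q.1, γB q.2) ⊗ₖ (γB q.2 • (1 : Matrix b b ℂ) - B)⁻¹)) (closure ΩA ×ˢ univ) := by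
    refine (hΩB.continuous_deriv.comp continuous_snd).continuousOn.smul ?_
    refine ContinuousOn.kronecker ?_ (hR.comp continuous_snd).continuousOn
    refine hFc.comp (continuous_fst.prodMk (hΩB.continuous.comp continuous_snd)).continuousOn ?_
    exact fun q hq => ⟨hq.1, hΩB.mem_closure q.2⟩
  refine ⟨?_, ?_⟩
  · refine DifferentiableOn.const_smul (𝕜 := ℂ) (F := Matrix (m × b) (p × b) ℂ) ?_
      (2 * Real.pi * Complex.I : ℂ)⁻¹
    refine differentiableOn_intervalIntegral (Φ := fun x t => deriv γB t •
      (F (x, γB t) ⊗ₖ (γB t • (1 : Matrix b b ℂ) - B)⁻¹)) hΩA.isOpen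
      (hc.mono (prod_mono subset_closure Subset.rfl)) (fun t => ?_) _ _
    have h1 := differentiableOn_of_mem_closure hΩA.isOpen hΩA.isBounded hΩB.isBounded hFc hF
      (hΩB.mem_closure t)
    have h2 := ((kroneckerCLM m p b b).flip
      (γB t • (1 : Matrix b b ℂ) - B)⁻¹).differentiable.comp_differentiableOn h1
    exact h2.const_smul (deriv γB t)
  · have h0 : ContinuousOn (fun x => ∫ t in (0 : ℝ)..(2 * Real.pi), deriv γB t •
        (F (x, γB t) ⊗ₖ (γB t • (1 : Matrix b b ℂ) - B)⁻¹)) (closure ΩA) :=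
      continuousOn_intervalIntegral_of_continuousOn (Φ := fun x t => deriv γB t •
        (F (x, γB t) ⊗ₖ (γB t • (1 : Matrix b b ℂ) - B)⁻¹)) hc _ _
    exact h0.const_smul (2 * Real.pi * Complex.I : ℂ)⁻¹

theorem bivariateMatrixFunction_eq (hΩA : IsConvexContour ΩA γA)
    (hΩB : IsConvexContour ΩB γB) (hB : numericalRange B ⊆ ΩB)
    (hFc : ContinuousOn F (closure ΩA ×ˢ closure ΩB)) :
    bivariateMatrixFunction γA γB F A B =
      resolventIntegral γA A fun x => resolventIntegral γB B fun y => F (x, y) := by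
  have hR := hΩB.continuous_resolvent hB
  have hin : ∀ t, (contourIntegral γB fun y => F (γA t, y) ⊗ₖ (y • (1 : Matrix b b ℂ) - B)⁻¹ ⊗ₖ
      (γA t • (1 : Matrix a a ℂ) - A)⁻¹) =
      (contourIntegral γB fun y => F (γA t, y) ⊗ₖ (y • (1 : Matrix b b ℂ) - B)⁻¹) ⊗ₖ
      (γA t • (1 : Matrix a a ℂ) - A)⁻¹ := by
    intro t
    have hFt : Continuous fun s => F (γA t, γB s) :=
      hFc.comp_continuous (continuous_const.prodMk hΩB.continuous)
        fun s => ⟨hΩA.mem_closure t, hΩB.mem_closure s⟩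
    exact ((kroneckerCLM (m × b) (p × b) a a).flip
      (γA t • (1 : Matrix a a ℂ) - A)⁻¹).contourIntegral_comp hΩB.contDiff
      (f := fun y => F (γA t, y) ⊗ₖ (y • (1 : Matrix b b ℂ) - B)⁻¹) (hFt.kronecker hR)
  simp only [bivariateMatrixFunction, resolventIntegral, Matrix.smul_kronecker]
  rw [contourIntegral_smul, smul_smul, contourIntegral_congr
    (g := fun x => (contourIntegral γB fun y => F (x, y) ⊗ₖ (y • (1 : Matrix b b ℂ) - B)⁻¹) ⊗ₖ
      (x • (1 : Matrix a a ℂ) - A)⁻¹) hin]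
  -- What remains is the comparison of constants, `-1 / (4π²) = (2πi)⁻¹ (2πi)⁻¹`.
  congr 1
  have : (Real.pi : ℂ) ≠ 0 := by exact_mod_cast Real.pi_ne_zero
  field_simp
  rw [Complex.I_sq]
  norm_num

/-- The bivariate matrix function is bounded on the product of the numerical ranges. -/
theorem norm_bivariateMatrixFunction_le [Nonempty a] [Nonempty b] (hΩA : IsConvexContour ΩA γA)
    (hΩB : IsConvexContour ΩB γB) (hA : numericalRange A ⊆ ΩA) (hB : numericalRange B ⊆ ΩB)
    (hF : DifferentiableOn ℂ F (ΩA ×ˢ ΩB)) (hFc : ContinuousOn F (closure ΩA ×ˢ closure ΩB))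
    {M : ℝ} (hM : ∀ z ∈ numericalRange A ×ˢ numericalRange B, ‖F z‖ ≤ M) :
    ‖bivariateMatrixFunction γA γB F A B‖ ≤ (1 + Real.sqrt 2) ^ 2 * M := by
  rw [bivariateMatrixFunction_eq hΩA hΩB hB hFc, sq, mul_assoc]
  -- The outer application takes the whole inner functional calculus at `B` as its matrix-valued
  -- function. Its bound is needed only for `x ∈ W(A)`, where the inner application provides `(1 +
  -- √2) * M`.
  refine hΩA.norm_resolventIntegral_le hA
    (diffContOnCl_resolventIntegral hΩA hΩB hB (fun y hy => ?_) hFc) fun x hx => ?_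
  · exact hF.comp (differentiable_id.prodMk (differentiable_const y)).differentiableOn
      fun x hx => ⟨hx, hy⟩
  · refine hΩB.norm_resolventIntegral_le hB ⟨?_, ?_⟩ fun y hy => hM (x, y) ⟨hx, hy⟩
    · exact hF.comp ((differentiable_const x).prodMk differentiable_id).differentiableOn
        fun y hy => ⟨hA hx, hy⟩
    · exact hFc.comp (continuous_const.prodMk continuous_id).continuousOn
        fun y hy => ⟨subset_closure (hA hx), hy⟩

end SpectralBound

end

/-- All matrix norms are spectral norms. -/
theorem theorem3p1 (m p nA nB : ℕ) (hnA : 0 < nA) (hnB : 0 < nB)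
    (A : Matrix (Fin nA) (Fin nA) ℂ) (B : Matrix (Fin nB) (Fin nB) ℂ)
    (ΩA ΩB : Set ℂ) (γA γB : ℝ → ℂ)
    (hΩA : IsSmoothConvexDomain ΩA γA) (hΩB : IsSmoothConvexDomain ΩB γB)
    (hA : numericalRange A ⊆ ΩA) (hB : numericalRange B ⊆ ΩB)
    (F : ℂ × ℂ → Matrix (Fin m) (Fin p) ℂ)
    (hF : AnalyticOnNhd ℂ F (ΩA ×ˢ ΩB))
    (hFc : ContinuousOn F (closure ΩA ×ˢ closure ΩB)) :
    ∃ M : ℝ, IsGreatest ((fun z => ‖F z‖) '' (numericalRange A ×ˢ numericalRange B)) M ∧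
      ‖bivariateMatrixFunction γA γB F A B‖ ≤ (1 + Real.sqrt 2) ^ 2 * M := by
  have : Nonempty (Fin nA) := ⟨⟨0, hnA⟩⟩
  have : Nonempty (Fin nB) := ⟨⟨0, hnB⟩⟩
  have hK := (isCompact_numericalRange A).prod (isCompact_numericalRange B)
  have hsub : numericalRange A ×ˢ numericalRange B ⊆ closure ΩA ×ˢ closure ΩB :=
    prod_mono (hA.trans subset_closure) (hB.trans subset_closure)
  obtain ⟨M, hM⟩ := (hK.image_of_continuousOn (hFc.mono hsub).norm).exists_isGreatest
    (((numericalRange_nonempty A).prod (numericalRange_nonempty B)).image _)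
  exact ⟨M, hM, norm_bivariateMatrixFunction_le hΩA.isConvexContour hΩB.isConvexContour hA hB
    hF.differentiableOn hFc fun z hz => hM.2 (mem_image_of_mem _ hz)⟩
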